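/- Let $\mathbb T=\mathbb R/2\pi\mathbb Z$ and write $f(x)=\sum_{n\in\mathbb Z}\hat f(n)e^{inx}$. For an integer $s\ge 0$ let $H^s$ be the space of real-valued functions $f\in L^2(\mathbb T)$ with $\hat f(0)=0$ and $\sum_{n}(1+|n|)^{2s}|\hat f(n)|^2<\infty$, with norm $\|f\|_{H^s}=\big(\sum_{n\ge 1}n^{2s}|\hat f(n)|^2\big)^{1/2}$ and its Borel $\sigma$-algebra. Let $|D_x|^\gamma$ be the Fourier multiplier $|n|^\gamma$. Let $\gamma>4/3$ be real and let $s\ge\gamma/2$ be an integer. Let $g_n=\frac{1}{\sqrt2}(h_n+il_n)$, $n\ge1$, where all $h_n,l_n$ are independent real $\mathcal N(0,1)$ variables, and let $g_{-n}=\overline{g_n}$. The random Fourier series $$\varphi_s(\omega,x)=\sum_{n\ne0}\frac{g_n(\omega)}{|n|^{s+\gamma/2}}e^{inx}$$ (with the terms $\pm n$ grouped) converges in $H^s$ almost surely, and its law $\mu_s$ is a Borel probability measure on $H^s$. The equation $$\partial_tu+\partial_t|D_x|^\gamma u+\partial_xu+\partial_x(u^2)=0$$ has a global flow $\Phi(t)$,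 $t\in\mathbb R$, on $H^s$: for every $u_0\in H^s$, $t\mapsto\Phi(t)u_0$ is its unique solution in $C(\mathbb R;H^s)$ with value $u_0$ at $t=0$. A solution means that, for every $n\in\mathbb Z$, $t\mapsto(1+|n|^\gamma)\hat u(t,n)$ is differentiable on $\mathbb R$ with derivative $-in\big(\hat u(t,n)+\widehat{u(t)^2}(n)\big)$. Then $\mu_s$ is quasi-invariant under $\Phi(t)$ for every $t\in\mathbb R$: $\Phi(t)$ is Borel measurable and the image measure $\Phi(t)_*\mu_s$ is absolutely continuous with respect to $\mu_s$. -/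

import Mathlib

open MeasureTheory ProbabilityTheory

noncomputable section

namespace BBM

instance twoPiPos : Fact (0 < 2 * Real.pi) := ⟨Real.two_pi_pos⟩

/-- The torus `ℝ / 2πℤ`; here `fourier n x = exp (i n x)`. -/
abbrev Torus : Type := AddCircle (2 * Real.pi)

/-- Real-valued square integrable functions on the torus, modulo a.e. equality
(`AddCircle.haarAddCircle` is `dx / 2π`). -/
abbrev L2 : Type := Lp ℝ 2 (AddCircle.haarAddCircle : Measure Torus)

/-- The Fourier coefficient `f̂(n) = (1 / 2π) ∫ f(x) exp (- i n x) dx` of a real-valued function,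
so that `f(x) = ∑ n, f̂(n) exp (i n x)`. -/
def coeff (f : Torus → ℝ) (n : ℤ) : ℂ := fourierCoeff (fun x => (f x : ℂ)) n

theorem integrable_coe (f : L2) :
    Integrable (fun x => ((f x : ℝ) : ℂ)) (AddCircle.haarAddCircle : Measure Torus) :=
  (((Lp.memLp f).integrable (by norm_num)).ofReal : _)

theorem coeff_congr {f g : Torus → ℝ}
    (h : f =ᵐ[(AddCircle.haarAddCircle : Measure Torus)] g) (n : ℤ) : coeff f n = coeff g n := by
  unfold coeff
  rw [fourierCoeff_congr_ae]
  filter_upwards [h] with x hx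
  rw [hx]

theorem coeff_add (f g : L2) (n : ℤ) : coeff (f + g : L2) n = coeff f n + coeff g n := by
  rw [coeff_congr (Lp.coeFn_add f g) n]
  have := congrFun (fourierCoeff.add (integrable_coe f) (integrable_coe g)) n
  simp only [Pi.add_apply] at this
  rw [coeff, coeff, coeff, ← this]
  congr 1
  ext x
  simp

theorem coeff_smul (c : ℝ) (f : L2) (n : ℤ) : coeff (c • f : L2) n = (c : ℂ) * coeff f n := by
  rw [coeff_congr (Lp.coeFn_smul c f) n, coeff, coeff, ← fourierCoeff.const_mul]
  congr 1
  ext x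
  simp

theorem coeff_zero (n : ℤ) : coeff (0 : L2) n = 0 := by
  have := coeff_smul 0 0 n
  simpa using this

/-- Real-valued functions have `f̂(-n) = conj f̂(n)`. -/
theorem coeff_neg (f : Torus → ℝ) (n : ℤ) :
    coeff f (-n) = (starRingEnd ℂ) (coeff f n) := by
  unfold coeff fourierCoeff
  rw [← integral_conj]
  congr 1
  ext x
  rw [smul_eq_mul, smul_eq_mul, map_mul, Complex.conj_ofReal, ← fourier_neg]

/-- A real-valued `L²` function is determined by its Fourier coefficients. -/
theorem eq_zero_of_coeff (f : L2) (h : ∀ n, coeff f n = 0) : f = 0 := by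
  have hm : MemLp (fun x => ((f x : ℝ) : ℂ)) 2 (AddCircle.haarAddCircle : Measure Torus) :=
    (Lp.memLp f).ofReal
  have h0 : hm.toLp _ = 0 := by
    apply fourierBasis.repr.injective
    ext n
    rw [fourierBasis_repr, fourierCoeff_congr_ae hm.coeFn_toLp]
    exact (h n).trans (by simp)
  have h1 := hm.coeFn_toLp
  rw [h0] at h1
  apply Lp.ext
  filter_upwards [h1, Lp.coeFn_zero ℂ 2 (AddCircle.haarAddCircle : Measure Torus),
    Lp.coeFn_zero ℝ 2 (AddCircle.haarAddCircle : Measure Torus)] with x h1 h2 h3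
  rw [h3]
  rw [h2] at h1
  simpa using h1.symm

theorem summable_add {s : ℕ} {a b : ℤ → ℂ}
    (ha : Summable fun n : ℤ => (1 + |(n : ℝ)|) ^ (2 * s) * ‖a n‖ ^ 2)
    (hb : Summable fun n : ℤ => (1 + |(n : ℝ)|) ^ (2 * s) * ‖b n‖ ^ 2) :
    Summable fun n : ℤ => (1 + |(n : ℝ)|) ^ (2 * s) * ‖a n + b n‖ ^ 2 := by
  refine Summable.of_nonneg_of_le (fun n => by positivity) (fun n => ?_)
    ((ha.add hb).mul_left 2)
  have h1 : ‖a n + b n‖ ^ 2 ≤ 2 * (‖a n‖ ^ 2 + ‖b n‖ ^ 2) := by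
    nlinarith [norm_add_le (a n) (b n), norm_nonneg (a n + b n), sq_nonneg (‖a n‖ - ‖b n‖)]
  calc _ ≤ (1 + |(n : ℝ)|) ^ (2 * s) * (2 * (‖a n‖ ^ 2 + ‖b n‖ ^ 2)) := by gcongr
    _ = _ := by ring

/-- The real-valued functions with mean zero and `∑ n, (1 + |n|) ^ (2 s) |f̂(n)| ^ 2 < ∞`. -/
def sobolev (s : ℕ) : Submodule ℝ L2 where
  carrier := {f | coeff f 0 = 0 ∧
    Summable fun n : ℤ => (1 + |(n : ℝ)|) ^ (2 * s) * ‖coeff f n‖ ^ 2}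
  zero_mem' := by
    refine ⟨coeff_zero 0, ?_⟩
    simp_rw [coeff_zero]
    simp
  add_mem' := by
    rintro f g ⟨hf0, hf⟩ ⟨hg0, hg⟩
    refine ⟨by rw [coeff_add, hf0, hg0, add_zero], ?_⟩
    simpa only [coeff_add] using summable_add hf hg
  smul_mem' := by
    rintro c f ⟨hf0, hf⟩
    refine ⟨by rw [coeff_smul, hf0, mul_zero], ?_⟩
    refine (hf.mul_left (‖c‖ ^ 2)).congr fun n => ?_
    rw [coeff_smul, norm_mul, mul_pow, Complex.norm_real]
    ring

/-- The Sobolev space `H^s` of real-valued mean-zero functions on the torus. It is not reducible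
to the subspace of `L²`, since it carries the `H^s` norm and not the `L²` norm. -/
def H (s : ℕ) : Type := sobolev s

instance (s : ℕ) : AddCommGroup (H s) := inferInstanceAs (AddCommGroup (sobolev s))

instance (s : ℕ) : Module ℝ (H s) := inferInstanceAs (Module ℝ (sobolev s))

/-- An element of `H^s` as a function on the torus. -/
def H.toFun {s : ℕ} (f : H s) : Torus → ℝ := (f.1 : L2)

theorem H.memℓp {s : ℕ} (f : H s) :
    Memℓp (fun n : ℕ+ => ((n : ℕ) : ℂ) ^ s * coeff f.toFun n) 2 := by
  rw [memℓp_gen_iff (by norm_num)]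
  have h := f.2.2.comp_injective (i := fun n : ℕ+ => ((n : ℕ) : ℤ))
    (fun a b h => by simpa using h)
  refine Summable.of_nonneg_of_le (fun n => by positivity) (fun n => ?_) h
  simp only [Function.comp, ENNReal.toReal_ofNat, Real.rpow_ofNat, norm_mul, norm_pow,
    Complex.norm_natCast, mul_pow, ← pow_mul, Int.cast_natCast, Nat.abs_cast, mul_comm s 2]
  gcongr
  · linarith
  · exact le_rfl

/-- The linear map `f ↦ (n ^ s f̂(n))` for `n ≥ 1`, with values in `ℓ²`. -/
def H.toLp (s : ℕ) : H s →+ lp (fun _ : ℕ+ => ℂ) 2 where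
  toFun f := ⟨fun n => ((n : ℕ) : ℂ) ^ s * coeff f.toFun n, f.memℓp⟩
  map_zero' := by
    ext n
    change ((n : ℕ) : ℂ) ^ s * coeff (0 : L2) n = 0
    rw [coeff_zero, mul_zero]
  map_add' f g := by
    ext n
    change ((n : ℕ) : ℂ) ^ s * coeff (f.1 + g.1 : L2) n =
      ((n : ℕ) : ℂ) ^ s * coeff (f.1 : L2) n + ((n : ℕ) : ℂ) ^ s * coeff (g.1 : L2) n
    rw [coeff_add, mul_add]

theorem H.toLp_injective (s : ℕ) : Function.Injective (H.toLp s) := by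
  rw [injective_iff_map_eq_zero]
  intro f hf
  have hpos : ∀ n : ℕ, 0 < n → coeff f.1 (n : ℤ) = 0 := by
    intro n hn
    have h1 : ((n : ℕ) : ℂ) ^ s * coeff f.1 (n : ℤ) = 0 :=
      congrFun (congrArg (fun g : lp (fun _ : ℕ+ => ℂ) 2 => (g : ℕ+ → ℂ)) hf) ⟨n, hn⟩
    exact (mul_eq_zero.1 h1).resolve_left (pow_ne_zero _ (Nat.cast_ne_zero.2 hn.ne'))
  refine Subtype.ext (eq_zero_of_coeff f.1 fun n => ?_)
  obtain ⟨m, rfl | rfl⟩ := n.eq_nat_or_neg <;> rcases Nat.eq_zero_or_pos m with rfl | hm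
  · exact f.2.1
  · exact hpos m hm
  · simpa using f.2.1
  · rw [coeff_neg, hpos m hm, map_zero]

/-- `H^s` is normed by `‖f‖ = (∑ n ≥ 1, n ^ (2 s) |f̂(n)| ^ 2) ^ (1 / 2)`. -/
instance (s : ℕ) : NormedAddCommGroup (H s) :=
  NormedAddCommGroup.induced (H s) (lp (fun _ : ℕ+ => ℂ) 2) (H.toLp s) (H.toLp_injective s)

theorem H.norm_sq {s : ℕ} (f : H s) :
    ‖f‖ ^ 2 = ∑' n : ℕ+, ((n : ℕ) : ℝ) ^ (2 * s) * ‖coeff f.toFun n‖ ^ 2 := by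
  have h := lp.norm_rpow_eq_tsum (p := 2) (by norm_num) (H.toLp s f)
  simp only [ENNReal.toReal_ofNat, Real.rpow_ofNat] at h
  change ‖H.toLp s f‖ ^ 2 = _
  rw [h]
  refine tsum_congr fun n => ?_
  change ‖((n : ℕ) : ℂ) ^ s * coeff f.toFun n‖ ^ 2 = _
  rw [norm_mul, norm_pow, Complex.norm_natCast, mul_pow, ← pow_mul, mul_comm s 2]

/-- `H^s` carries its Borel σ-algebra. -/
instance (s : ℕ) : MeasurableSpace (H s) := borel (H s)

instance (s : ℕ) : BorelSpace (H s) := ⟨rfl⟩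

/-- `u : ℝ → H^s` is a global solution in `C(ℝ; H^s)` of
`∂ₜ u + ∂ₜ |D|^γ u + ∂ₓ u + ∂ₓ (u²) = 0`. The equation is tested against every `exp (- i n x)`:
`|D|^γ` multiplies the `n`-th Fourier coefficient by `|n| ^ γ` and `∂ₓ` multiplies it by `i n`,
while `u²` is the pointwise square. -/
def IsSolution (γ : ℝ) {s : ℕ} (u : ℝ → H s) : Prop :=
  Continuous u ∧ ∀ (n : ℤ) (t : ℝ),
    HasDerivAt (fun τ => ((1 + |(n : ℝ)| ^ γ : ℝ) : ℂ) * coeff (u τ).toFun n)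
      (-(Complex.I * n * coeff (u t).toFun n
        + Complex.I * n * coeff (fun x => (u t).toFun x ^ 2) n)) t

/-- `Φ` is the flow of the equation on `H^s`: for every `u₀`, the curve `t ↦ Φ t u₀` is the unique
global solution in `C(ℝ; H^s)` with value `u₀` at time `0`. -/
def IsFlow (γ : ℝ) (s : ℕ) (Φ : ℝ → H s → H s) : Prop :=
  ∀ u₀ : H s, (IsSolution γ (fun t => Φ t u₀) ∧ Φ 0 u₀ = u₀) ∧
    ∀ u : ℝ → H s, IsSolution γ u → u 0 = u₀ → ∀ t, u t = Φ t u₀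

/-- The function `x ↦ z exp (i n x) + conj z exp (- i n x) = 2 Re (z exp (i n x))`. -/
def modeFun (n : ℕ+) (z : ℂ) : C(Torus, ℝ) where
  toFun x := 2 * (z * fourier (n : ℤ) x).re
  continuous_toFun := by fun_prop

theorem coeff_modeFun (n : ℕ+) (z : ℂ) (m : ℤ) :
    coeff (modeFun n z) m =
      (if m = n then z else 0) + (if m = -n then (starRingEnd ℂ) z else 0) := by
  have h : (fun x : Torus => ((modeFun n z x : ℝ) : ℂ)) =
      (z • (fourier (n : ℤ) : Torus → ℂ))
        + ((starRingEnd ℂ) z • (fourier (-(n : ℤ)) : Torus → ℂ)) := by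
    ext x
    simp only [modeFun, ContinuousMap.coe_mk, Pi.add_apply, Pi.smul_apply, smul_eq_mul,
      fourier_neg, ← map_mul, Complex.add_conj]
  have hi : ∀ (k : ℤ) (c : ℂ), Integrable (c • (fourier k : Torus → ℂ))
      (AddCircle.haarAddCircle : Measure Torus) := fun k c =>
    ((map_continuous (fourier k)).integrable_of_hasCompactSupport
      (HasCompactSupport.of_compactSpace _)).smul c
  rw [coeff, h, fourierCoeff.add (hi _ _) (hi _ _), Pi.add_apply, fourierCoeff.const_smul,
    fourierCoeff.const_smul, fourierCoeff_fourier, fourierCoeff_fourier]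
  simp [Pi.single_apply]

/-- `modeFun n z` as an element of `H^s`. -/
def mode (s : ℕ) (n : ℕ+) (z : ℂ) : H s :=
  ⟨ContinuousMap.toLp (E := ℝ) 2 AddCircle.haarAddCircle ℝ (modeFun n z), by
    have hn : (0 : ℤ) < ((n : ℕ) : ℤ) := by exact_mod_cast n.pos
    have h := fun m => (coeff_congr (ContinuousMap.coeFn_toLp (p := 2) (𝕜 := ℝ)
      (AddCircle.haarAddCircle : Measure Torus) (modeFun n z)) m).trans (coeff_modeFun n z m)
    constructor
    · rw [h, if_neg (by omega), if_neg (by omega), add_zero]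
    · refine summable_of_ne_finset_zero (s := {((n : ℕ) : ℤ), -((n : ℕ) : ℤ)}) fun m hm => ?_
      simp only [Finset.mem_insert, Finset.mem_singleton, not_or] at hm
      rw [h, if_neg hm.1, if_neg hm.2]
      simp⟩

/-- The sample space: sequences of pairs `(hₙ, lₙ)`, `n ≥ 1`. -/
abbrev Sample : Type := ℕ+ → ℝ × ℝ

/-- All `hₙ` and `lₙ` are independent standard real Gaussians. -/
def prob : Measure Sample :=
  Measure.infinitePi fun _ => (gaussianReal 0 1).prod (gaussianReal 0 1)

/-- The standard complex Gaussian `gₙ = (hₙ + i lₙ) / √2`, for `n ≥ 1`. -/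
def gauss (n : ℕ+) (ω : Sample) : ℂ :=
  (((ω n).1 : ℂ) + Complex.I * ((ω n).2 : ℂ)) / (Real.sqrt 2 : ℂ)

/-- The modes `± n` of the random Fourier series, i.e.
`(gₙ exp (i n x) + conj gₙ exp (- i n x)) / n ^ (s + γ / 2)`. -/
def randomTerm (γ : ℝ) (s : ℕ) (ω : Sample) (n : ℕ+) : H s :=
  mode s n (gauss n ω / (((n : ℕ) : ℝ) ^ ((s : ℝ) + γ / 2) : ℝ))

/-- The random Fourier series `∑ n ≠ 0, gₙ |n| ^ (- (s + γ / 2)) exp (i n x)` with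
`g₋ₙ = conj gₙ`, summed in `H^s`. -/
def randomSeries (γ : ℝ) (s : ℕ) (ω : Sample) : H s := ∑' n : ℕ+, randomTerm γ s ω n

/-- The law `μ_s` of the random Fourier series on `H^s`. -/
def gaussianMeasure (γ : ℝ) (s : ℕ) : Measure (H s) := prob.map (randomSeries γ s)

end BBM

end

/-! In the coordinates `x n = n ^ s * û(n)`, `n ≥ 1`, the space `H^s` is `ℓ²`. Since `γ > 1`, the
operator `∂ₓ (1 + |D|^γ)⁻¹` is bounded, and `H^s` is an algebra because `s ≥ 1`. The equation is
therefore an ODE `x' = F x` with a polynomial field. The energy `∑ (1 + n^γ) |û(n)|²` is conserved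
and controls `∑ |û(n)|`, so on its level sets `F` grows at most linearly in every `H^σ` norm, `σ ≥
0`. This makes the flow global and lets the truncated flows propagate higher regularity
(`TameField`, `Params.normSq_field_le`).

Galerkin truncations of `F` keep these properties and are divergence-free, so they preserve Lebesgue
measure (`TameField.measurePreserving_flow`, `Params.trace_fderiv_coordField`). The truncated
Gaussian measure has density proportional to `exp (-W)` with `W = ∑ n^γ |x n|²`, and its image at
time `t` has density `exp (W - W ∘ Φ(-t))` with respect to itself.

The crux is an upper bound for `W ∘ Φ(-t) - W`, uniform in the truncation. The derivative of `W +
‖x‖²` along the flow is a cubic sum with symbol `n^(2s+1)`. Symmetrising it over the three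
frequencies produces `(k+l)^(2s+1) - k^(2s+1) - l^(2s+1)`, which is `O(|k+l|^s |k|^s |l|^s)`
(`three_mul_tri`, `abs_add_pow_sub_sub_le`). The resulting sum is controlled by the `H^(s+θ)` norm
if `θ > 1/6`, and the samples lie in `H^(s+θ)` almost surely if `θ < (γ-1)/2`. Such a `θ` exists
exactly when `γ > 4/3`. Hence along almost every sample the densities stay above a positive number
(`Params.exists_weight_gflow_le`).

Let `f` be the liminf of the densities, which is positive almost surely. Galerkin convergence and
Fatou's lemma give `∫ g f dμ ≤ ∫ g ∘ Φ(t) dμ` for continuous `0 ≤ g ≤ 1`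
(`Params.exists_lintegral_le`), so `μ` is absolutely continuous with respect to its image. Applying
this at time `-t` gives the converse relation. No upper bound on the densities is needed. -/

namespace BBM

open Set Metric Filter Topology
open scoped NNReal ENNReal

/-! ### Globally defined flows of locally Lipschitz vector fields -/

section Flow

variable {X : Type*} [NormedAddCommGroup X]

/-- A Lipschitz cutoff function. -/
def cutoff (R : ℝ) (x : X) : ℝ := max 0 (min 1 (R + 1 - ‖x‖))

theorem abs_cutoff_le (R : ℝ) (x : X) : |cutoff R x| ≤ 1 := by
  rw [abs_le]; unfold cutoff
  exact ⟨by linarith [le_max_left (0 : ℝ) (min 1 (R + 1 - ‖x‖))], by simp⟩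

theorem cutoff_eq_one {R : ℝ} {x : X} (h : ‖x‖ ≤ R) : cutoff R x = 1 := by
  unfold cutoff
  rw [min_eq_left (by linarith), max_eq_right zero_le_one]

theorem cutoff_eq_zero {R : ℝ} {x : X} (h : R + 1 ≤ ‖x‖) : cutoff R x = 0 := by
  unfold cutoff
  rw [max_eq_left]
  exact (min_le_right _ _).trans (by linarith)

theorem abs_cutoff_sub_le (R : ℝ) (x y : X) : |cutoff R x - cutoff R y| ≤ ‖x - y‖ := by
  unfold cutoff
  refine (abs_max_sub_max_le_max _ _ _ _).trans (max_le (by simp) ?_)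
  refine (abs_min_sub_min_le_max _ _ _ _).trans (max_le (by simp) ?_)
  rw [sub_sub_sub_cancel_left]
  rw [norm_sub_rev]
  exact abs_norm_sub_norm_le _ _

variable [NormedSpace ℝ X]

/-- A two-sided Grönwall inequality. -/
theorem norm_le_gronwallBound_abs {α α' : ℝ → X} {T K ε : ℝ}
    (h : ∀ t ∈ Ioo (-T) T, HasDerivAt α (α' t) t)
    (hb : ∀ t ∈ Ioo (-T) T, ‖α' t‖ ≤ K * ‖α t‖ + ε) {t : ℝ} (ht : t ∈ Ioo (-T) T) :
    ‖α t‖ ≤ gronwallBound ‖α 0‖ K ε |t| := by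
  rcases le_total 0 t with h0 | h0
  · have hs : ∀ x ∈ Icc 0 t, x ∈ Ioo (-T) T := fun x hx =>
      ⟨by linarith [hx.1, ht.1, ht.2], by linarith [hx.2, ht.2]⟩
    have := norm_le_gronwallBound_of_norm_deriv_right_le (f := α) (f' := α') (a := 0) (b := t)
      (δ := ‖α 0‖) (K := K) (ε := ε)
      (fun x hx => (h x (hs x hx)).continuousAt.continuousWithinAt)
      (fun x hx => (h x (hs x ⟨hx.1, hx.2.le⟩)).hasDerivWithinAt) le_rfl
      (fun x hx => hb x (hs x ⟨hx.1, hx.2.le⟩)) t ⟨h0, le_rfl⟩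
    simpa [abs_of_nonneg h0] using this
  · have hs : ∀ x ∈ Icc 0 (-t), -x ∈ Ioo (-T) T := fun x hx =>
      ⟨by linarith [hx.2, ht.1], by linarith [hx.1, ht.1, ht.2]⟩
    have hd : ∀ x ∈ Icc 0 (-t), HasDerivAt (fun x => α (-x)) (-α' (-x)) x := fun x hx => by
      simpa [Function.comp_def] using (h (-x) (hs x hx)).scomp x (hasDerivAt_neg x)
    have := norm_le_gronwallBound_of_norm_deriv_right_le (f := fun x => α (-x))
      (f' := fun x => -α' (-x)) (a := 0) (b := -t) (δ := ‖α 0‖) (K := K) (ε := ε)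
      (fun x hx => (hd x hx).continuousAt.continuousWithinAt)
      (fun x hx => (hd x ⟨hx.1, hx.2.le⟩).hasDerivWithinAt) (by simp)
      (fun x hx => by simpa using hb (-x) (hs x ⟨hx.1, hx.2.le⟩)) (-t) ⟨by linarith, le_rfl⟩
    simpa [abs_of_nonpos h0] using this

/-- A locally Lipschitz vector field `F` which conserves an energy `E` and whose growth is linear
on the level sets of `E`. -/
structure TameField (F : X → X) (E : X → ℝ) (k : ℝ → ℝ) : Prop where
  lip : ∀ R : ℝ, ∃ L : ℝ≥0, LipschitzOnWith L F (closedBall 0 R)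
  energy : ∀ x, ∃ E' : X →L[ℝ] ℝ, HasFDerivAt E E' x ∧ E' (F x) = 0
  growth : ∀ x, ‖F x‖ ≤ k (E x) * ‖x‖

namespace TameField

variable {F : X → X} {E : X → ℝ} {k : ℝ → ℝ}

/-- The scalar factor `χ` does not disturb conservation, since `E' (χ • F) = χ * E' F = 0`. It is
included so that the lemma also covers the cut-off field. -/
theorem energy_eq_of_mem (hF : TameField F E k) {χ : ℝ → ℝ} {α : ℝ → X} {T : ℝ}
    (h : ∀ t ∈ Ioo (-T) T, HasDerivAt α (χ t • F (α t)) t) {t : ℝ} (ht : t ∈ Ioo (-T) T) :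
    E (α t) = E (α 0) := by
  have hd : ∀ t ∈ Ioo (-T) T, HasDerivAt (fun t => E (α t) - E (α 0)) 0 t := fun t ht => by
    obtain ⟨E', hE, h0⟩ := hF.energy (α t)
    have := (hE.comp_hasDerivAt t (h t ht)).sub_const (E (α 0))
    simpa [h0] using this
  have := norm_le_gronwallBound_abs (K := 0) (ε := 0) hd (by simp) ht
  rw [sub_self, norm_zero, gronwallBound_ε0_δ0] at this
  exact sub_eq_zero.1 (norm_le_zero_iff.1 this)

/-- Conservation of `E` freezes the growth rate `k (E (α t))` at its initial value, so the linear
Grönwall inequality applies even though `F` is superlinear. -/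
theorem norm_le_of_mem (hF : TameField F E k) {χ : ℝ → ℝ} (hχ : ∀ t, |χ t| ≤ 1) {α : ℝ → X}
    {T : ℝ} (h : ∀ t ∈ Ioo (-T) T, HasDerivAt α (χ t • F (α t)) t) {t : ℝ}
    (ht : t ∈ Ioo (-T) T) : ‖α t‖ ≤ ‖α 0‖ * Real.exp (k (E (α 0)) * |t|) := by
  rw [← gronwallBound_ε0]
  refine norm_le_gronwallBound_abs h (fun t ht => ?_) ht
  rw [norm_smul, add_zero, ← hF.energy_eq_of_mem h ht]
  calc ‖χ t‖ * ‖F (α t)‖ ≤ 1 * ‖F (α t)‖ := by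
        gcongr
        exact hχ t
    _ ≤ _ := by simpa using hF.growth (α t)

theorem energy_eq (hF : TameField F E k) {α : ℝ → X} (h : ∀ t, HasDerivAt α (F (α t)) t) (t : ℝ) :
    E (α t) = E (α 0) :=
  hF.energy_eq_of_mem (χ := 1) (T := |t| + 1) (fun t _ => by simpa using h t)
    (abs_lt.1 (lt_add_one _))

theorem norm_le (hF : TameField F E k) {α : ℝ → X} (h : ∀ t, HasDerivAt α (F (α t)) t) (t : ℝ) :
    ‖α t‖ ≤ ‖α 0‖ * Real.exp (k (E (α 0)) * |t|) :=
  hF.norm_le_of_mem (χ := 1) (by simp) (T := |t| + 1) (fun t _ => by simpa using h t)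
    (abs_lt.1 (lt_add_one _))

theorem map_zero (hF : TameField F E k) : F 0 = 0 := by
  simpa using hF.growth 0

/-- The a priori bound puts both curves in one ball, where `F` is Lipschitz; Grönwall then applies
to the difference. -/
theorem eqOn_of_mem (hF : TameField F E k) {α β : ℝ → X} {T : ℝ}
    (hα : ∀ t ∈ Ioo (-T) T, HasDerivAt α (F (α t)) t)
    (hβ : ∀ t ∈ Ioo (-T) T, HasDerivAt β (F (β t)) t) (h0 : α 0 = β 0) {t : ℝ}
    (ht : t ∈ Ioo (-T) T) : α t = β t := by
  set R := ‖α 0‖ * Real.exp (|k (E (α 0))| * T)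
  have hR : ∀ γ : ℝ → X, (∀ t ∈ Ioo (-T) T, HasDerivAt γ (F (γ t)) t) → γ 0 = α 0 →
      ∀ t ∈ Ioo (-T) T, γ t ∈ closedBall (0 : X) R := fun γ h h0 t ht => by
    rw [mem_closedBall_zero_iff]
    refine (hF.norm_le_of_mem (χ := 1) (by simp) (fun t ht => by simpa using h t ht) ht).trans ?_
    rw [h0]
    have : |t| ≤ T := (abs_lt.2 ht).le
    unfold R
    gcongr
    exact le_abs_self _
  obtain ⟨L, hL⟩ := hF.lip R
  have := norm_le_gronwallBound_abs (K := L) (ε := 0) (fun t ht => (hα t ht).fun_sub (hβ t ht))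
    (fun t ht => by
      simpa using hL.norm_sub_le (hR α hα rfl t ht) (hR β hβ h0.symm t ht)) ht
  rw [h0, sub_self, norm_zero, gronwallBound_ε0_δ0] at this
  exact sub_eq_zero.1 (norm_le_zero_iff.1 this)

theorem eq_of_hasDerivAt (hF : TameField F E k) {α β : ℝ → X}
    (hα : ∀ t, HasDerivAt α (F (α t)) t) (hβ : ∀ t, HasDerivAt β (F (β t)) t) (h0 : α 0 = β 0) :
    α = β :=
  funext fun t => hF.eqOn_of_mem (T := |t| + 1) (fun t _ => hα t) (fun t _ => hβ t) h0
    (abs_lt.1 (lt_add_one _))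

/-- A globally bounded and Lipschitz field can be solved on any prescribed time interval. -/
theorem exists_bounded_lipschitz_cutoff (hF : TameField F E k) {R : ℝ} (hR : 0 ≤ R) :
    ∃ M L : ℝ≥0, (∀ x, ‖cutoff R x • F x‖ ≤ M) ∧ LipschitzWith L fun x => cutoff R x • F x := by
  obtain ⟨L, hL⟩ := hF.lip (R + 1)
  have hM : ∀ x, ‖x‖ ≤ R + 1 → ‖F x‖ ≤ L * (R + 1) := fun x hx => by
    have := hL.norm_sub_le (x := x) (y := 0) (by simpa using hx) (by simpa using by linarith)
    rw [hF.map_zero, sub_zero, sub_zero] at this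
    exact this.trans (by gcongr)
  lift R to ℝ≥0 using hR
  refine ⟨L * (R + 1), L * (R + 1) + L, fun x => ?_, LipschitzWith.of_dist_le_mul fun x y => ?_⟩
  · rcases le_total ‖x‖ (R + 1) with hx | hx
    · rw [norm_smul]
      exact (mul_le_of_le_one_left (norm_nonneg _) (abs_cutoff_le _ _)).trans (hM x hx)
    · rw [cutoff_eq_zero hx, zero_smul, norm_zero]
      positivity
  · rw [dist_eq_norm, dist_eq_norm]
    -- The splitting uses a bound on `F x`, hence needs `x` in the ball. The other cases follow by
    -- symmetry, or both terms vanish.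
    have key : ∀ x y : X, ‖x‖ ≤ R + 1 → ‖cutoff R x • F x - cutoff R y • F y‖ ≤
        ((L * (R + 1) + L : ℝ≥0) : ℝ) * ‖x - y‖ := fun x y hx => by
      have h1 : ‖(cutoff R x - cutoff R y) • F x‖ ≤ L * (R + 1) * ‖x - y‖ := by
        rw [norm_smul, mul_comm]
        exact mul_le_mul (hM x hx) (abs_cutoff_sub_le _ _ _) (norm_nonneg _) (by positivity)
      have h2 : ‖cutoff R y • (F x - F y)‖ ≤ L * ‖x - y‖ := by
        rcases le_total ‖y‖ (R + 1) with hy | hy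
        · rw [norm_smul]
          exact (mul_le_of_le_one_left (norm_nonneg _) (abs_cutoff_le _ _)).trans
            (hL.norm_sub_le (by simpa using hx) (by simpa using hy))
        · rw [cutoff_eq_zero hy, zero_smul, norm_zero]
          positivity
      have h3 : cutoff R x • F x - cutoff R y • F y =
          (cutoff R x - cutoff R y) • F x + cutoff R y • (F x - F y) := by module
      rw [h3]
      push_cast
      linarith [norm_add_le ((cutoff R x - cutoff R y) • F x) (cutoff R y • (F x - F y))]
    rcases le_total ‖x‖ (R + 1) with hx | hx
    · exact key x y hx
    · rcases le_total ‖y‖ (R + 1) with hy | hy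
      · rw [norm_sub_rev, norm_sub_rev x]
        exact key y x hy
      · rw [cutoff_eq_zero hx, cutoff_eq_zero hy, zero_smul, zero_smul, sub_zero, norm_zero]
        positivity

/-- The time `T` is prescribed. The a priori bound holds for the cut-off equation too and keeps its
solution in the ball of radius `R`, where the cutoff equals `1`. -/
theorem exists_local [CompleteSpace X] (hF : TameField F E k) (x₀ : X) {T : ℝ} (hT : 0 < T) :
    ∃ α : ℝ → X, α 0 = x₀ ∧ ∀ t ∈ Ioo (-T) T, HasDerivAt α (F (α t)) t := by
  set R := ‖x₀‖ * Real.exp (|k (E x₀)| * T)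
  obtain ⟨M, L, hM, hL⟩ := hF.exists_bounded_lipschitz_cutoff (R := R) (by positivity)
  lift T to ℝ≥0 using hT.le
  -- A curve of speed at most `M` stays in the ball of radius `M * T` up to time `T`, so the
  -- interval need not shrink.
  have hP : IsPicardLindelof (fun _ x => cutoff R x • F x) (tmin := -T) (tmax := T)
      ⟨0, by simp⟩ x₀ (M * T) 0 M L :=
    .of_time_independent (fun x _ => hM x) hL.lipschitzOnWith (by simp)
  obtain ⟨α, h0, hα⟩ := hP.exists_eq_forall_mem_Icc_hasDerivWithinAt₀
  have hα' : ∀ t ∈ Ioo (-T : ℝ) T, HasDerivAt α (cutoff R (α t) • F (α t)) t := fun t ht =>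
    (hα t (Ioo_subset_Icc_self ht)).hasDerivAt (Icc_mem_nhds ht.1 ht.2)
  refine ⟨α, h0, fun t ht => ?_⟩
  have h1 := hF.norm_le_of_mem (χ := fun t => cutoff R (α t)) (fun t => abs_cutoff_le _ _) hα' ht
  have h2 : ‖α t‖ ≤ R := by
    refine h1.trans ?_
    have : |t| ≤ T := (abs_lt.2 ht).le
    simp only at h0
    rw [h0]
    unfold R
    gcongr
    exact le_abs_self _
  simpa [cutoff_eq_one h2] using hα' t ht

theorem exists_global [CompleteSpace X] (hF : TameField F E k) (x₀ : X) :
    ∃ α : ℝ → X, α 0 = x₀ ∧ ∀ t, HasDerivAt α (F (α t)) t := by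
  -- At time `t` the solution of index `⌈|t|⌉₊` is used; uniqueness makes it agree with every other
  -- one defined at `t`.
  choose α h0 hα using fun n : ℕ => hF.exists_local x₀ (T := n + 1) (by positivity)
  have hm : ∀ (t : ℝ) (n : ℕ), ⌈|t|⌉₊ ≤ n → t ∈ Ioo (-(n + 1) : ℝ) (n + 1) := fun t n hn =>
    abs_lt.1 (by linarith [Nat.le_ceil |t|, (Nat.cast_le (α := ℝ)).2 hn])
  have heq : ∀ (t : ℝ) (n : ℕ), t ∈ Ioo (-(n + 1) : ℝ) (n + 1) → α ⌈|t|⌉₊ t = α n t := by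
    intro t n ht
    rcases le_total ⌈|t|⌉₊ n with h | h
    · refine hF.eqOn_of_mem (T := ⌈|t|⌉₊ + 1) (hα _) (fun s hs => hα n s ?_)
        ((h0 _).trans (h0 _).symm) (hm t _ le_rfl)
      have : (⌈|t|⌉₊ : ℝ) ≤ n := Nat.cast_le.2 h
      exact ⟨by linarith [hs.1], by linarith [hs.2]⟩
    · refine hF.eqOn_of_mem (T := n + 1) (fun s hs => hα _ s ?_) (hα n)
        ((h0 _).trans (h0 _).symm) ht
      have : (n : ℝ) ≤ ⌈|t|⌉₊ := Nat.cast_le.2 h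
      exact ⟨by linarith [hs.1], by linarith [hs.2]⟩
  refine ⟨fun t => α ⌈|t|⌉₊ t, h0 _, fun t => ?_⟩
  refine (hα _ t (hm t _ le_rfl)).congr_of_eventuallyEq ?_
  filter_upwards [isOpen_Ioo.mem_nhds (hm t _ le_rfl)] with s hs using heq s _ hs

variable [CompleteSpace X]

/-- The global flow of a tame vector field. -/
noncomputable def flow (hF : TameField F E k) (t : ℝ) (x : X) : X := (hF.exists_global x).choose t

theorem flow_zero (hF : TameField F E k) (x : X) : hF.flow 0 x = x :=
  (hF.exists_global x).choose_spec.1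

theorem hasDerivAt_flow (hF : TameField F E k) (x : X) (t : ℝ) :
    HasDerivAt (fun t => hF.flow t x) (F (hF.flow t x)) t :=
  (hF.exists_global x).choose_spec.2 t

theorem eq_flow (hF : TameField F E k) {α : ℝ → X} (hα : ∀ t, HasDerivAt α (F (α t)) t) (t : ℝ) :
    α t = hF.flow t (α 0) :=
  congrFun (hF.eq_of_hasDerivAt hα (hF.hasDerivAt_flow (α 0)) (hF.flow_zero _).symm) t

theorem energy_flow (hF : TameField F E k) (t : ℝ) (x : X) : E (hF.flow t x) = E x := by
  have := hF.energy_eq (hF.hasDerivAt_flow x) t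
  rwa [hF.flow_zero] at this

theorem norm_flow_le (hF : TameField F E k) (t : ℝ) (x : X) :
    ‖hF.flow t x‖ ≤ ‖x‖ * Real.exp (k (E x) * |t|) := by
  have := hF.norm_le (hF.hasDerivAt_flow x) t
  rwa [hF.flow_zero] at this

theorem flow_add (hF : TameField F E k) (s t : ℝ) (x : X) :
    hF.flow (t + s) x = hF.flow t (hF.flow s x) := by
  have := hF.eq_flow (α := fun t => hF.flow (t + s) x)
    (fun t => (hF.hasDerivAt_flow x (t + s)).comp_add_const t s) t
  rwa [zero_add] at this

theorem flow_neg_flow (hF : TameField F E k) (t : ℝ) (x : X) :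
    hF.flow (-t) (hF.flow t x) = x := by
  rw [← hF.flow_add, neg_add_cancel, hF.flow_zero]

theorem flow_flow_neg (hF : TameField F E k) (t : ℝ) (x : X) :
    hF.flow t (hF.flow (-t) x) = x := by
  rw [← hF.flow_add, add_neg_cancel, hF.flow_zero]

/-- The flow is Lipschitz on balls, uniformly on bounded time intervals. -/
theorem exists_lipschitzOnWith_flow (hF : TameField F E k)
    (hk : ∀ R, ∃ K, ∀ x, ‖x‖ ≤ R → k (E x) ≤ K) (R T : ℝ) :
    ∃ C : ℝ≥0, ∀ t, |t| < T → LipschitzOnWith C (hF.flow t) (closedBall 0 R) := by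
  obtain ⟨K, hK⟩ := hk R
  obtain ⟨L, hL⟩ := hF.lip (R * Real.exp (|K| * T))
  refine ⟨(Real.exp (L * T)).toNNReal, fun t ht => LipschitzOnWith.of_dist_le_mul
    fun x hx y hy => ?_⟩
  have hR : ∀ x, ‖x‖ ≤ R → ∀ t ∈ Ioo (-T) T,
      hF.flow t x ∈ closedBall (0 : X) (R * Real.exp (|K| * T)) := fun x hx t ht => by
    rw [mem_closedBall_zero_iff]
    refine (hF.norm_flow_le t x).trans ?_
    have h1 : |t| ≤ T := (abs_lt.2 ht).le
    have h2 := (hK x hx).trans (le_abs_self K)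
    have h3 := (norm_nonneg x).trans hx
    gcongr
  rw [mem_closedBall_zero_iff] at hx hy
  have := norm_le_gronwallBound_abs (K := L) (ε := 0)
    (fun t _ => (hF.hasDerivAt_flow x t).fun_sub (hF.hasDerivAt_flow y t))
    (fun t ht => by simpa using hL.norm_sub_le (hR x hx t ht) (hR y hy t ht)) (abs_lt.1 ht)
  rw [hF.flow_zero, hF.flow_zero, gronwallBound_ε0] at this
  rw [dist_eq_norm, dist_eq_norm, Real.coe_toNNReal _ (Real.exp_nonneg _), mul_comm]
  exact this.trans (by gcongr)

theorem continuous_flow (hF : TameField F E k) (hk : ∀ R, ∃ K, ∀ x, ‖x‖ ≤ R → k (E x) ≤ K)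
    (t : ℝ) : Continuous (hF.flow t) := by
  rw [continuous_iff_continuousAt]
  intro x
  obtain ⟨C, hC⟩ := hF.exists_lipschitzOnWith_flow hk (‖x‖ + 1) (|t| + 1)
  refine (hC t (lt_add_one _)).continuousOn.continuousAt ?_
  rw [_root_.mem_nhds_iff]
  refine ⟨ball 0 (‖x‖ + 1), ball_subset_closedBall, isOpen_ball, by simp⟩

end TameField

end Flow

/-! ### Flows of divergence-free vector fields preserve the Haar measure -/

section Liouville

variable {V : Type*} [NormedAddCommGroup V] [NormedSpace ℝ V] [FiniteDimensional ℝ V]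

/-- In a basis, the Leibniz formula makes the determinant a polynomial in the entries of `f`. -/
theorem differentiable_det_id_add :
    Differentiable ℝ fun f : V →L[ℝ] V => (ContinuousLinearMap.id ℝ V + f).det := by
  let b := Module.finBasis ℝ V
  have h : (fun f : V →L[ℝ] V => (ContinuousLinearMap.id ℝ V + f).det) = fun f =>
      ∑ σ : Equiv.Perm (Fin (Module.finrank ℝ V)), ((Equiv.Perm.sign σ : ℤ) : ℝ) *
        ∏ i, b.repr (b i + f (b i)) (σ i) := by
    ext f
    rw [ContinuousLinearMap.det, ← LinearMap.det_toMatrix b, Matrix.det_apply']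
    simp [LinearMap.toMatrix_apply]
  rw [h]
  have he : ∀ i j, Differentiable ℝ fun f : V →L[ℝ] V => b.repr (b i + f (b i)) j := fun i j => by
    have h1 : Differentiable ℝ (b.coord j) :=
      (LinearMap.toContinuousLinearMap (b.coord j)).differentiable
    exact h1.comp ((differentiable_const _).add
      (ContinuousLinearMap.apply ℝ V (b i)).differentiable)
  fun_prop

/-- The derivative exists, so it can be read off on lines, where `det (1 + t M) = 1 + t tr M + t²
p(t)`. -/
theorem hasFDerivAt_det_id_add : ∃ D : (V →L[ℝ] V) →L[ℝ] ℝ,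
    (∀ f : V →L[ℝ] V, D f = LinearMap.trace ℝ V f) ∧
    HasFDerivAt (fun f : V →L[ℝ] V => (ContinuousLinearMap.id ℝ V + f).det) D 0 := by
  have h := (differentiable_det_id_add (V := V) 0).hasFDerivAt
  refine ⟨_, fun f => ?_, h⟩
  set D := fderiv ℝ (fun f : V →L[ℝ] V => (ContinuousLinearMap.id ℝ V + f).det) 0
  let b := Module.finBasis ℝ V
  have h0 : HasDerivAt (fun t : ℝ => t • f) f 0 := by
    simpa using (hasDerivAt_id (0 : ℝ)).smul_const f
  have h1 : HasDerivAt (fun t : ℝ => (ContinuousLinearMap.id ℝ V + t • f).det) (D f) 0 :=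
    HasFDerivAt.comp_hasDerivAt (x := (0 : ℝ))
      (l := fun f : V →L[ℝ] V => (ContinuousLinearMap.id ℝ V + f).det) (f := fun t => t • f)
      (by simpa using h) h0
  set M := LinearMap.toMatrix b b (f : V →ₗ[ℝ] V)
  set p := (Matrix.det (1 + (Polynomial.X : Polynomial ℝ) • M.map Polynomial.C)).divX.divX
  have h2 : (fun t : ℝ => (ContinuousLinearMap.id ℝ V + t • f).det) =
      fun t => 1 + M.trace * t + p.eval t * t ^ 2 := by
    ext t
    rw [← Matrix.det_one_add_smul, ContinuousLinearMap.det, ← LinearMap.det_toMatrix b]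
    congr 1
    simp [M]
  have h3 : HasDerivAt (fun t : ℝ => 1 + M.trace * t + p.eval t * t ^ 2) M.trace 0 := by
    have := (((hasDerivAt_id (0 : ℝ)).const_mul M.trace).const_add 1).add
      ((p.hasDerivAt 0).mul (hasDerivAt_pow 2 (0 : ℝ)))
    simp only [mul_one, Nat.cast_ofNat, Nat.add_one_sub_one, pow_one, mul_zero, ne_eq,
      OfNat.ofNat_ne_zero, not_false_eq_true, zero_pow, add_zero] at this
    exact this
  rw [h2] at h1
  rw [h1.unique h3, LinearMap.trace_eq_matrix_trace ℝ b]

/-- For vanishing trace the first-order term of the determinant disappears. -/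
theorem exists_abs_det_id_add_sub_one_le {ε : ℝ} (hε : 0 < ε) : ∃ δ > 0, ∀ f : V →L[ℝ] V,
    LinearMap.trace ℝ V f = 0 → ‖f‖ ≤ δ →
      |(ContinuousLinearMap.id ℝ V + f).det - 1| ≤ ε * ‖f‖ := by
  obtain ⟨D, hD, h⟩ := hasFDerivAt_det_id_add (V := V)
  have h1 := (hasFDerivAt_iff_isLittleO_nhds_zero.1 h).def hε
  obtain ⟨δ, hδ, h2⟩ := Metric.eventually_nhds_iff_ball.1 h1
  refine ⟨δ / 2, by positivity, fun f hf hfδ => ?_⟩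
  have h3 := h2 f (by rw [mem_ball_zero_iff]; linarith)
  simpa [hD, hf, ContinuousLinearMap.det] using h3

variable [MeasurableSpace V] [BorelSpace V] {μ : Measure V} [μ.IsAddHaarMeasure]

/-- The change of variables `x ↦ x + h F x` changes integrals by `o(h)` if `F` is
divergence-free. -/
theorem exists_abs_integral_comp_id_add_smul_sub_le {F : V → V} (hF : ContDiff ℝ 1 F)
    (hFc : HasCompactSupport F) (hdiv : ∀ x, LinearMap.trace ℝ V (fderiv ℝ F x) = 0)
    {G : V → ℝ} (hG : Continuous G) (hGc : HasCompactSupport G) {ε : ℝ} (hε : 0 < ε) :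
    ∃ δ > 0, ∀ h : ℝ, |h| ≤ δ → |∫ x, G (x + h • F x) ∂μ - ∫ x, G x ∂μ| ≤ ε * |h| := by
  obtain ⟨K, hK⟩ := hF.lipschitzWith_of_hasCompactSupport hFc one_ne_zero
  obtain ⟨M, hM⟩ := hF.continuous.bounded_above_of_compact_support hFc
  obtain ⟨B, hB⟩ := hG.bounded_above_of_compact_support hGc
  obtain ⟨R, hR⟩ := hGc.isCompact.isBounded.subset_closedBall (0 : V)
  have hM0 : 0 ≤ M := (norm_nonneg _).trans (hM 0)
  have hB0 : 0 ≤ B := (norm_nonneg _).trans (hB 0)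
  set v := μ.real (closedBall (0 : V) (R + M))
  -- `K` bounds the derivative of `F`, `B` bounds `G`, and `v` is the volume of a ball outside which
  -- the integrands vanish. Their product is what the error gets multiplied by; the `+ 1` avoids
  -- division by zero.
  obtain ⟨δ, hδ, hdet⟩ := exists_abs_det_id_add_sub_one_le (V := V)
    (ε := ε / ((K + 1) * (B + 1) * (v + 1))) (by positivity)
  refine ⟨min (min 1 (δ / (K + 1))) (1 / (2 * (K + 1))), by positivity, fun h hh => ?_⟩
  have hh1 : |h| ≤ 1 := hh.trans ((min_le_left _ _).trans (min_le_left _ _))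
  have hh2 : |h| * (K + 1) ≤ δ := by
    rw [← le_div_iff₀ (by positivity)]
    exact hh.trans ((min_le_left _ _).trans (min_le_right _ _))
  have hh3 : |h| * (K + 1) ≤ 1 / 2 := by
    rw [← le_div_iff₀ (by positivity)]
    refine hh.trans ((min_le_right _ _).trans (le_of_eq ?_))
    field_simp
  set ψ : V → V := fun x => x + h • F x
  have hψd : ∀ x, HasFDerivAt ψ (ContinuousLinearMap.id ℝ V + h • fderiv ℝ F x) x := fun x =>
    (hasFDerivAt_id x).fun_add (((hF.differentiable one_ne_zero) x).hasFDerivAt.fun_const_smul h)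
  -- Since `|h| * K < 1`, the map `ψ` is a small Lipschitz perturbation of the identity, hence a
  -- bijection of `V`, and the change of variables applies on the whole space.
  have hap : ApproximatesLinearOn ψ ((ContinuousLinearEquiv.refl ℝ V : V ≃L[ℝ] V) : V →L[ℝ] V)
      univ (‖h‖₊ * K) := by
    intro x _ y _
    have : ψ x - ψ y - ((ContinuousLinearEquiv.refl ℝ V : V ≃L[ℝ] V) : V →L[ℝ] V) (x - y) =
        h • (F x - F y) := by
      simp only [ψ, ContinuousLinearEquiv.coe_refl, ContinuousLinearMap.id_apply]
      module
    rw [this, norm_smul]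
    push_cast
    rw [mul_assoc]
    have := hK.norm_sub_le x y
    gcongr
  have hc : Subsingleton V ∨ ‖h‖₊ * K <
      ‖(((ContinuousLinearEquiv.refl ℝ V : V ≃L[ℝ] V).symm : V ≃L[ℝ] V) : V →L[ℝ] V)‖₊⁻¹ := by
    rcases subsingleton_or_nontrivial V with hV | hV
    · exact Or.inl hV
    · right
      have h1 : ‖(((ContinuousLinearEquiv.refl ℝ V : V ≃L[ℝ] V).symm : V ≃L[ℝ] V) :
          V →L[ℝ] V)‖₊ = 1 := by
        rw [← NNReal.coe_inj]
        exact ContinuousLinearMap.norm_id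
      rw [h1, inv_one, ← NNReal.coe_lt_coe]
      push_cast
      rw [Real.norm_eq_abs]
      nlinarith [abs_nonneg h, K.2]
  have hinj : InjOn ψ univ := hap.injOn hc
  have hsurj : ψ '' univ = univ := by
    rw [image_univ]
    exact (hap.surjective hc).range_eq
  have hcv := integral_image_eq_integral_abs_det_fderiv_smul μ MeasurableSet.univ
    (fun x _ => (hψd x).hasFDerivWithinAt) hinj G
  rw [hsurj, Measure.restrict_univ] at hcv
  have hψc : Continuous ψ := by
    have := hF.continuous
    fun_prop
  have hfd : ∀ x, ‖fderiv ℝ F x‖ ≤ K := fun x => norm_fderiv_le_of_lipschitz ℝ hK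
  have hdet' : ∀ x, |1 - abs (ContinuousLinearMap.id ℝ V + h • fderiv ℝ F x).det| ≤
      ε / ((B + 1) * (v + 1)) * |h| := fun x => by
    have hn : ‖h • fderiv ℝ F x‖ ≤ |h| * (K + 1) := by
      rw [norm_smul, Real.norm_eq_abs]
      have := hfd x
      gcongr
      linarith
    have := hdet (h • fderiv ℝ F x) (by simp [hdiv x]) (hn.trans hh2)
    rw [abs_sub_comm]
    calc _ ≤ |(ContinuousLinearMap.id ℝ V + h • fderiv ℝ F x).det - 1| := by
          simpa using abs_abs_sub_abs_le (ContinuousLinearMap.id ℝ V + h • fderiv ℝ F x).det 1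
      _ ≤ _ := this
      _ ≤ ε / ((K + 1) * (B + 1) * (v + 1)) * (|h| * (K + 1)) := by gcongr
      _ = _ := by field_simp
  have hsupp : ∀ x, x ∉ closedBall (0 : V) (R + M) → G (ψ x) = 0 := fun x hx => by
    by_contra hne
    have h1 := hR (subset_tsupport _ hne)
    rw [mem_closedBall_zero_iff] at h1 hx
    apply hx
    have h2 : ‖h • F x‖ ≤ M := by
      rw [norm_smul, Real.norm_eq_abs]
      exact (mul_le_of_le_one_left (norm_nonneg _) hh1).trans (hM x)
    have h3 : x = ψ x - h • F x := by simp [ψ]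
    rw [h3]
    exact (norm_sub_le _ _).trans (add_le_add h1 h2)
  have hcsψ : HasCompactSupport fun x => G (ψ x) :=
    HasCompactSupport.intro (isCompact_closedBall (0 : V) (R + M)) hsupp
  have hi1 : Integrable (fun x => G (ψ x)) μ :=
    (hG.comp hψc).integrable_of_hasCompactSupport hcsψ
  have hdc : Continuous fun x => |(ContinuousLinearMap.id ℝ V + h • fderiv ℝ F x).det| := by
    have h1 := hF.continuous_fderiv one_ne_zero
    exact continuous_abs.comp (ContinuousLinearMap.continuous_det.comp (by fun_prop))
  have hi2 : Integrable (fun x =>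
      |(ContinuousLinearMap.id ℝ V + h • fderiv ℝ F x).det| • G (ψ x)) μ :=
    (hdc.smul (hG.comp hψc)).integrable_of_hasCompactSupport hcsψ.smul_left
  rw [hcv, ← integral_sub hi1 hi2]
  have hset : ∫ x, (G (ψ x) - |(ContinuousLinearMap.id ℝ V + h • fderiv ℝ F x).det| • G (ψ x)) ∂μ
      = ∫ x in closedBall (0 : V) (R + M),
        (G (ψ x) - |(ContinuousLinearMap.id ℝ V + h • fderiv ℝ F x).det| • G (ψ x)) ∂μ := by
    rw [setIntegral_eq_integral_of_forall_compl_eq_zero]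
    intro x hx
    rw [hsupp x hx, smul_zero, sub_zero]
  rw [hset]
  have := norm_setIntegral_le_of_norm_le_const (μ := μ) (s := closedBall (0 : V) (R + M))
    (f := fun x => G (ψ x) - |(ContinuousLinearMap.id ℝ V + h • fderiv ℝ F x).det| • G (ψ x))
    (C := ε / ((B + 1) * (v + 1)) * |h| * (B + 1))
    (isCompact_closedBall (0 : V) (R + M)).measure_lt_top (fun x _ => by
      have h1 : G (ψ x) - |(ContinuousLinearMap.id ℝ V + h • fderiv ℝ F x).det| • G (ψ x) =
        (1 - |(ContinuousLinearMap.id ℝ V + h • fderiv ℝ F x).det|) * G (ψ x) := by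
          rw [smul_eq_mul]; ring
      rw [h1, norm_mul]
      exact mul_le_mul (hdet' x) ((hB _).trans (by linarith)) (norm_nonneg _) (by positivity))
  rw [← Real.norm_eq_abs]
  refine this.trans ?_
  have : ε / ((B + 1) * (v + 1)) * |h| * (B + 1) * v = ε * |h| * (v / (v + 1)) := by
    field_simp
  rw [this]
  refine mul_le_of_le_one_right (by positivity) ?_
  rw [div_le_one (by positivity)]
  linarith

end Liouville

/-! ### From Euler steps to Liouville's theorem. -/

section Liouville

variable {V : Type*} [NormedAddCommGroup V] [NormedSpace ℝ V]

/-- `φ` is the flow of the vector field `F`. -/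
structure IsFlowOf (F : V → V) (φ : ℝ → V → V) : Prop where
  zero : ∀ x, φ 0 x = x
  deriv : ∀ x t, HasDerivAt (fun t => φ t x) (F (φ t x)) t
  add : ∀ s t x, φ (t + s) x = φ t (φ s x)

theorem TameField.isFlowOf [CompleteSpace V] {F : V → V} {E : V → ℝ} {k : ℝ → ℝ}
    (hF : TameField F E k) : IsFlowOf F hF.flow :=
  ⟨hF.flow_zero, hF.hasDerivAt_flow, hF.flow_add⟩

namespace IsFlowOf

variable {F : V → V} {φ : ℝ → V → V}

theorem comp_neg (h : IsFlowOf F φ) (t : ℝ) (x : V) : φ t (φ (-t) x) = x := by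
  rw [← h.add, add_neg_cancel, h.zero]

theorem norm_sub_le (h : IsFlowOf F φ) {M : ℝ} (hM : ∀ x, ‖F x‖ ≤ M) (t : ℝ) (x : V) :
    ‖φ t x - x‖ ≤ M * |t| := by
  have := convex_univ.norm_image_sub_le_of_norm_hasDerivWithin_le (f := fun t => φ t x)
    (fun t _ => (h.deriv x t).hasDerivWithinAt) (fun t _ => hM (φ t x)) (mem_univ 0) (mem_univ t)
  simpa [h.zero] using this

/-- The flow differs from one Euler step by `O(t²)`: the derivative of `φ s x - s • F x` is `F (φ s
x) - F x`, which is at most `K * M * |s|`. -/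
theorem norm_sub_sub_le (h : IsFlowOf F φ) {M : ℝ} (hM : ∀ x, ‖F x‖ ≤ M) {K : ℝ≥0}
    (hK : LipschitzWith K F) (t : ℝ) (x : V) :
    ‖φ t x - (x + t • F x)‖ ≤ K * M * |t| * |t| := by
  have hd : ∀ s, HasDerivAt (fun s => φ s x - s • F x) (F (φ s x) - F x) s := fun s => by
    simpa using (h.deriv x s).fun_sub ((hasDerivAt_id s).smul_const (F x))
  have := (convex_uIcc 0 t).norm_image_sub_le_of_norm_hasDerivWithin_le
    (f := fun s => φ s x - s • F x) (C := K * M * |t|)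
    (fun s _ => (hd s).hasDerivWithinAt) (fun s hs => by
      have h1 : |s| ≤ |t| := by
        have := abs_sub_left_of_mem_uIcc hs
        simpa using this
      have h2 := (norm_nonneg _).trans (hM x)
      calc ‖F (φ s x) - F x‖ ≤ K * ‖φ s x - x‖ := hK.norm_sub_le _ _
        _ ≤ K * (M * |s|) := by
          gcongr
          exact h.norm_sub_le hM s x
        _ ≤ K * (M * |t|) := by gcongr
        _ = _ := by ring) left_mem_uIcc right_mem_uIcc
  rw [h.zero, zero_smul, sub_zero, sub_zero, Real.norm_eq_abs] at this
  convert this using 2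
  abel

theorem lipschitzWith (h : IsFlowOf F φ) {K : ℝ≥0} (hK : LipschitzWith K F) (t : ℝ) :
    LipschitzWith (Real.exp (K * |t|)).toNNReal (φ t) := by
  refine LipschitzWith.of_dist_le_mul fun x y => ?_
  have := norm_le_gronwallBound_abs (K := K) (ε := 0) (T := |t| + 1)
    (fun t _ => (h.deriv x t).fun_sub (h.deriv y t))
    (fun t ht => by simpa using hK.norm_sub_le (φ t x) (φ t y)) (abs_lt.1 (lt_add_one |t|))
  rw [h.zero, h.zero, gronwallBound_ε0] at this
  rwa [dist_eq_norm, dist_eq_norm, Real.coe_toNNReal _ (Real.exp_nonneg _), mul_comm]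

variable [FiniteDimensional ℝ V] [MeasurableSpace V] [BorelSpace V] {μ : Measure V}
  [μ.IsAddHaarMeasure]

/-- By the group law it suffices to differentiate at time `0` with `G = g ∘ φ t` in place of `g`.
Replacing the flow by an Euler step costs `O(s²)`, and an Euler step of a divergence-free field
changes the integral by `o(s)`. -/
theorem hasDerivAt_integral_comp (h : IsFlowOf F φ) (hF : ContDiff ℝ 1 F)
    (hFc : HasCompactSupport F) (hdiv : ∀ x, LinearMap.trace ℝ V (fderiv ℝ F x) = 0)
    {g : V → ℝ} {C : ℝ≥0} (hg : LipschitzWith C g) (hgc : HasCompactSupport g) (t : ℝ) :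
    HasDerivAt (fun t => ∫ x, g (φ t x) ∂μ) 0 t := by
  obtain ⟨K, hK⟩ := hF.lipschitzWith_of_hasCompactSupport hFc one_ne_zero
  obtain ⟨M, hM⟩ := hF.continuous.bounded_above_of_compact_support hFc
  have hM0 : 0 ≤ M := (norm_nonneg _).trans (hM 0)
  obtain ⟨R, hR⟩ := hgc.isCompact.isBounded.subset_closedBall (0 : V)
  have hsupp : ∀ t x, x ∉ closedBall (0 : V) (R + M * |t|) → g (φ t x) = 0 := fun t x hx => by
    by_contra hne
    have h1 := hR (subset_tsupport _ hne)
    rw [mem_closedBall_zero_iff] at h1 hx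
    apply hx
    have h3 : x = φ t x - (φ t x - x) := by simp
    rw [h3]
    exact (_root_.norm_sub_le _ _).trans (add_le_add h1 (h.norm_sub_le hM t x))
  set G : V → ℝ := fun x => g (φ t x)
  have hGL := hg.comp (h.lipschitzWith hK t)
  set C' := C * (Real.exp (K * |t|)).toNNReal
  have hGc : HasCompactSupport G :=
    HasCompactSupport.intro (isCompact_closedBall (0 : V) (R + M * |t|)) (hsupp t)
  have hadd : ∀ s x, g (φ (t + s) x) = G (φ s x) := fun s x => by rw [h.add]
  -- For `|s| ≤ 1`, neither the flow nor the Euler step moves a point by more than `M`, so both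
  -- integrands vanish outside `B`.
  set B := closedBall (0 : V) (R + M * |t| + M)
  set v := μ.real B
  have hGB : ∀ x y : V, ‖y - x‖ ≤ M → x ∉ B → G y = 0 := fun x y hxy hx => by
    refine hsupp t y fun hy => hx ?_
    rw [mem_closedBall_zero_iff] at hy ⊢
    have h3 : x = y - (y - x) := by simp
    rw [h3]
    exact (_root_.norm_sub_le _ _).trans (add_le_add hy hxy)
  rw [hasDerivAt_iff_isLittleO_nhds_zero, Asymptotics.isLittleO_iff]
  intro ε hε
  obtain ⟨δ, hδ, hI⟩ := exists_abs_integral_comp_id_add_smul_sub_le (μ := μ) hF hFc hdiv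
    (G := G) hGL.continuous hGc (half_pos hε)
  set δ' := min (min δ 1) (ε / (2 * (C' * (K * M) * v + 1)))
  have hδ' : 0 < δ' := by positivity
  filter_upwards [Metric.closedBall_mem_nhds (0 : ℝ) hδ'] with s hs
  rw [mem_closedBall_zero_iff, Real.norm_eq_abs] at hs
  have hs1 : |s| ≤ δ := hs.trans ((min_le_left _ _).trans (min_le_left _ _))
  have hs2 : |s| ≤ 1 := hs.trans ((min_le_left _ _).trans (min_le_right _ _))
  have hs3 : |s| * (2 * (C' * (K * M) * v + 1)) ≤ ε := by
    rw [← le_div_iff₀ (by positivity)]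
    exact hs.trans (min_le_right _ _)
  simp only [smul_zero, sub_zero, hadd]
  have hφc : Continuous (φ s) := (h.lipschitzWith hK s).continuous
  have hFcont := hF.continuous
  have hn : ∀ x, ‖s • F x‖ ≤ M := fun x => by
    rw [norm_smul, Real.norm_eq_abs]
    exact (mul_le_of_le_one_left (norm_nonneg _) hs2).trans (hM x)
  have hz1 : ∀ x, x ∉ B → G (φ s x) = 0 := fun x hx =>
    hGB x _ ((h.norm_sub_le hM s x).trans (mul_le_of_le_one_right hM0 hs2)) hx
  have hz2 : ∀ x, x ∉ B → G (x + s • F x) = 0 := fun x hx =>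
    hGB x _ (by simpa using hn x) hx
  have hBc : IsCompact B := isCompact_closedBall _ _
  have hi1 : Integrable (fun x => G (φ s x)) μ :=
    (hGL.continuous.comp hφc).integrable_of_hasCompactSupport (HasCompactSupport.intro hBc hz1)
  have hi2 : Integrable (fun x => G (x + s • F x)) μ :=
    Continuous.integrable_of_hasCompactSupport
      (hGL.continuous.comp (by fun_prop)) (HasCompactSupport.intro hBc hz2)
  have h1 : |∫ x, G (φ s x) ∂μ - ∫ x, G (x + s • F x) ∂μ| ≤ C' * (K * M * |s| * |s|) * v := by
    rw [← integral_sub hi1 hi2]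
    have hset : ∫ x, (G (φ s x) - G (x + s • F x)) ∂μ =
        ∫ x in B, (G (φ s x) - G (x + s • F x)) ∂μ := by
      rw [setIntegral_eq_integral_of_forall_compl_eq_zero]
      intro x hx
      rw [hz1 x hx, hz2 x hx, sub_zero]
    rw [hset, ← Real.norm_eq_abs]
    refine norm_setIntegral_le_of_norm_le_const hBc.measure_lt_top fun x _ => ?_
    refine (hGL.norm_sub_le _ _).trans ?_
    gcongr
    exact h.norm_sub_sub_le hM hK s x
  have h2 := hI s hs1
  have hG0 : ∫ x, g (φ t x) ∂μ = ∫ x, G x ∂μ := rfl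
  rw [hG0, Real.norm_eq_abs, Real.norm_eq_abs]
  have h3 := abs_sub_le (∫ x, G (φ s x) ∂μ) (∫ x, G (x + s • F x) ∂μ) (∫ x, G x ∂μ)
  have h4 : C' * (K * M * |s| * |s|) * v ≤ ε / 2 * |s| := by
    have : (C' * (K * M * |s| * |s|) * v : ℝ) = |s| * (C' * (K * M) * v) * |s| := by ring
    rw [this]
    gcongr
    nlinarith [abs_nonneg s]
  linarith

theorem integral_comp (h : IsFlowOf F φ) (hF : ContDiff ℝ 1 F)
    (hFc : HasCompactSupport F) (hdiv : ∀ x, LinearMap.trace ℝ V (fderiv ℝ F x) = 0)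
    {g : V → ℝ} {C : ℝ≥0} (hg : LipschitzWith C g) (hgc : HasCompactSupport g) (t : ℝ) :
    ∫ x, g (φ t x) ∂μ = ∫ x, g x ∂μ := by
  have hd := fun t => h.hasDerivAt_integral_comp (μ := μ) hF hFc hdiv hg hgc t
  have := is_const_of_deriv_eq_zero (fun t => (hd t).differentiableAt) (fun t => (hd t).deriv) t 0
  simpa [h.zero] using this

/-- The thickened indicators of `S` are Lipschitz with compact support, so the flow preserves their
integrals; let the thickness tend to `0`. The inequality suffices, as time reversal supplies the
opposite one. -/
theorem measure_le_preimage_of_isCompact (h : IsFlowOf F φ) (hF : ContDiff ℝ 1 F)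
    (hFc : HasCompactSupport F) (hdiv : ∀ x, LinearMap.trace ℝ V (fderiv ℝ F x) = 0)
    (t : ℝ) {S : Set V} (hS : IsCompact S) : μ S ≤ μ (φ t ⁻¹' S) := by
  obtain ⟨K, hK⟩ := hF.lipschitzWith_of_hasCompactSupport hFc one_ne_zero
  obtain ⟨M, hM⟩ := hF.continuous.bounded_above_of_compact_support hFc
  have hcont : Continuous (φ t) := (h.lipschitzWith hK t).continuous
  have hbdd : ∀ A : Set V, Bornology.IsBounded A → Bornology.IsBounded (φ t ⁻¹' A) := by
    intro A hA
    obtain ⟨R, hR⟩ := hA.subset_closedBall (0 : V)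
    refine (isBounded_closedBall (x := (0 : V)) (r := R + M * |t|)).subset fun x hx => ?_
    have h1 := hR hx
    rw [mem_closedBall_zero_iff] at h1 ⊢
    have h3 : x = φ t x - (φ t x - x) := by simp
    rw [h3]
    exact (_root_.norm_sub_le _ _).trans (add_le_add h1 (h.norm_sub_le hM t x))
  have hlim : Tendsto (fun r => (μ.map (φ t)) (cthickening r S)) (𝓝[>] 0) (𝓝 (μ (φ t ⁻¹' S))) := by
    have := tendsto_measure_cthickening_of_isClosed (μ := μ.map (φ t)) (s := S)
      ⟨1, one_pos, by
        rw [Measure.map_apply hcont.measurable isClosed_cthickening.measurableSet]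
        exact (hbdd _ hS.isBounded.cthickening).measure_lt_top.ne⟩ hS.isClosed
    rw [Measure.map_apply hcont.measurable hS.isClosed.measurableSet] at this
    exact this.mono_left nhdsWithin_le_nhds
  refine ge_of_tendsto hlim ?_
  filter_upwards [self_mem_nhdsWithin] with r (hr : 0 < r)
  rw [Measure.map_apply hcont.measurable isClosed_cthickening.measurableSet]
  set g : V → ℝ := fun x => thickenedIndicator hr S x
  have hgL : LipschitzWith r.toNNReal⁻¹ g := fun x y => lipschitzWith_thickenedIndicator hr S x y
  have hg1 : ∀ x, g x ≤ 1 := fun x => thickenedIndicator_le_one hr S x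
  have hg0 : ∀ x, x ∉ cthickening r S → g x = 0 := fun x hx => by
    have := thickenedIndicator_zero hr S fun hx' => hx (thickening_subset_cthickening _ _ hx')
    exact congrArg NNReal.toReal this
  have hgS : ∀ x ∈ S, g x = 1 := fun x hx => congrArg NNReal.toReal (thickenedIndicator_one hr S hx)
  have hcc : IsCompact (cthickening r S) := hS.cthickening
  have hgc : HasCompactSupport g := HasCompactSupport.intro hcc hg0
  have hint := h.integral_comp (μ := μ) hF hFc hdiv hgL hgc t
  have hpc : IsCompact (φ t ⁻¹' cthickening r S) :=
    isCompact_of_isClosed_isBounded (isClosed_cthickening.preimage hcont) (hbdd _ hcc.isBounded)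
  have hind : ∀ A : Set V, IsCompact A → Integrable (A.indicator (1 : V → ℝ)) μ := fun A hA =>
    (integrable_indicator_iff hA.isClosed.measurableSet).2
      (integrableOn_const hA.measure_lt_top.ne)
  have h1 : μ.real S ≤ ∫ x, g x ∂μ := by
    rw [← integral_indicator_one hS.isClosed.measurableSet]
    refine integral_mono (hind S hS) (hgL.continuous.integrable_of_hasCompactSupport hgc)
      fun x => ?_
    by_cases hx : x ∈ S
    · simp [hx, hgS]
    · simp [hx, g]
  have h2 : ∫ x, g (φ t x) ∂μ ≤ μ.real (φ t ⁻¹' cthickening r S) := by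
    rw [← integral_indicator_one hpc.isClosed.measurableSet]
    refine integral_mono_of_nonneg (ae_of_all _ fun x => by simp [g]) (hind _ hpc)
      (ae_of_all _ fun x => ?_)
    by_cases hx : φ t x ∈ cthickening r S
    · simpa [hx] using hg1 _
    · simp [hx, hg0 _ hx]
  have h3 : μ.real S ≤ μ.real (φ t ⁻¹' cthickening r S) := by linarith
  exact (ENNReal.toReal_le_toReal hS.measure_lt_top.ne hpc.measure_lt_top.ne).1 h3

/-- Inner regularity extends the inequality from compact to measurable sets; applying it to the
preimage at time `-t` reverses it. -/
theorem measurePreserving_of_hasCompactSupport (h : IsFlowOf F φ) (hF : ContDiff ℝ 1 F)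
    (hFc : HasCompactSupport F) (hdiv : ∀ x, LinearMap.trace ℝ V (fderiv ℝ F x) = 0)
    (t : ℝ) : MeasurePreserving (φ t) μ μ := by
  obtain ⟨K, hK⟩ := hF.lipschitzWith_of_hasCompactSupport hFc one_ne_zero
  have hcont : ∀ t, Continuous (φ t) := fun t => (h.lipschitzWith hK t).continuous
  have hle : ∀ t A, MeasurableSet A → μ A ≤ μ (φ t ⁻¹' A) := fun t A hA => by
    rw [hA.measure_eq_iSup_isCompact]
    refine iSup_le fun S => iSup_le fun hSA => iSup_le fun hS => ?_
    exact (h.measure_le_preimage_of_isCompact hF hFc hdiv t hS).trans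
      (measure_mono (preimage_mono hSA))
  refine ⟨(hcont t).measurable, Measure.ext fun A hA => ?_⟩
  rw [Measure.map_apply (hcont t).measurable hA]
  refine le_antisymm ?_ (hle t A hA)
  have := hle (-t) _ ((hcont t).measurable hA)
  rwa [← preimage_comp, show φ t ∘ φ (-t) = id from funext (h.comp_neg t), preimage_id] at this

end IsFlowOf

/-- Liouville's theorem: the flow of a divergence-free vector field with a coercive conserved energy
preserves the Haar measure. -/
theorem TameField.measurePreserving_flow [FiniteDimensional ℝ V] [CompleteSpace V]
    [MeasurableSpace V] [BorelSpace V] {μ : Measure V} [μ.IsAddHaarMeasure] {F : V → V} {E : V → ℝ} {k : ℝ → ℝ}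
    (hT : TameField F E k) (hk : ∀ R, ∃ K, ∀ x, ‖x‖ ≤ R → k (E x) ≤ K)
    (hF : ContDiff ℝ 1 F) (hE : ContDiff ℝ 1 E)
    (hEc : ∀ R, Bornology.IsBounded {x | E x ≤ R})
    (hdiv : ∀ x, LinearMap.trace ℝ V (fderiv ℝ F x) = 0) (t : ℝ) :
    MeasurePreserving (hT.flow t) μ μ := by
  have hcont : Continuous (hT.flow t) := hT.continuous_flow hk t
  have key : ∀ R : ℝ, ∀ A, MeasurableSet A →
      μ (hT.flow t ⁻¹' A ∩ {x | E x < R}) = μ (A ∩ {x | E x < R}) := by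
    intro R A hA
    -- A cutoff that depends on the energy alone: coercivity makes `χ • F` compactly supported, `χ`
    -- is constant along `F` so the divergence stays zero, and `χ = 1` on `{E ≤ R}` leaves the
    -- trajectories there unchanged.
    set χ : V → ℝ := fun x => Real.smoothTransition (R + 1 - E x)
    have hχ : ContDiff ℝ 1 χ := Real.smoothTransition.contDiff.comp (contDiff_const.sub hE)
    set F' : V → V := fun x => χ x • F x
    have hF' : ContDiff ℝ 1 F' := hχ.smul hF
    have hc : HasCompactSupport F' := by
      refine HasCompactSupport.intro (K := {x | E x ≤ R + 1})
        (isCompact_of_isClosed_isBounded (isClosed_le hE.continuous continuous_const) (hEc _))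
        fun x hx => ?_
      have : χ x = 0 := Real.smoothTransition.zero_of_nonpos (by
        simp only [mem_ofPred_eq, not_le] at hx
        linarith)
      simp [F', this]
    obtain ⟨K, hK⟩ := hF'.lipschitzWith_of_hasCompactSupport hc one_ne_zero
    have hEF : ∀ x, fderiv ℝ E x (F x) = 0 := fun x => by
      obtain ⟨E', h1, h2⟩ := hT.energy x
      rw [h1.fderiv, h2]
    have hχF : ∀ x, fderiv ℝ χ x (F x) = 0 := fun x => by
      have h1 : HasFDerivAt E (fderiv ℝ E x) x := (hE.differentiable one_ne_zero x).hasFDerivAt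
      have h2 : HasDerivAt Real.smoothTransition _ (R + 1 - E x) :=
        ((Real.smoothTransition.contDiff (n := 1)).differentiable one_ne_zero _).hasDerivAt
      have h3 := h2.comp_hasFDerivAt x (h1.const_sub (R + 1))
      have h4 : fderiv ℝ χ x = _ := h3.fderiv
      rw [h4]
      simp [hEF]
    have hdiv' : ∀ x, LinearMap.trace ℝ V (fderiv ℝ F' x) = 0 := fun x => by
      have h1 := ((hχ.differentiable one_ne_zero x).hasFDerivAt).fun_smul
        ((hF.differentiable one_ne_zero x).hasFDerivAt)
      have h4 : fderiv ℝ F' x = _ := h1.fderiv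
      rw [h4]
      have h5 : LinearMap.trace ℝ V ((fderiv ℝ χ x).smulRight (F x) : V →L[ℝ] V) =
          fderiv ℝ χ x (F x) := by
        exact LinearMap.trace_smulRight _ _
      simp only [ContinuousLinearMap.toLinearMap_add, ContinuousLinearMap.toLinearMap_smul, map_add, map_smul,
        hdiv, h5, hχF]
      simp
    have hT' : TameField F' E fun _ => K := by
      refine ⟨fun _ => ⟨K, hK.lipschitzOnWith⟩, fun x => ?_, fun x => ?_⟩
      · obtain ⟨E', h1, h2⟩ := hT.energy x
        exact ⟨E', h1, by simp [F', h2]⟩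
      · have := hK.norm_sub_le x 0
        simpa [F', hT.map_zero] using this
    have hmp := hT'.isFlowOf.measurePreserving_of_hasCompactSupport (μ := μ) hF' hc hdiv' t
    have hlt : MeasurableSet {x | E x < R} := measurableSet_lt hE.continuous.measurable measurable_const
    have heq : ∀ x, E x < R → hT.flow t x = hT'.flow t x := fun x hx => by
      have h1 : ∀ s, HasDerivAt (fun s => hT.flow s x) (F' (hT.flow s x)) s := fun s => by
        have h2 : χ (hT.flow s x) = 1 := Real.smoothTransition.one_of_one_le (by
          rw [hT.energy_flow]
          linarith)
        simpa [F', h2] using hT.hasDerivAt_flow x s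
      have := hT'.eq_flow h1 t
      rwa [hT.flow_zero] at this
    rw [← hmp.measure_preimage (hA.inter hlt).nullMeasurableSet]
    congr 1
    ext x
    simp only [mem_inter_iff, mem_preimage, mem_ofPred_eq, hT'.energy_flow]
    constructor
    · rintro ⟨h1, h2⟩
      exact ⟨heq x h2 ▸ h1, h2⟩
    · rintro ⟨h1, h2⟩
      exact ⟨(heq x h2).symm ▸ h1, h2⟩
  refine ⟨hcont.measurable, Measure.ext fun A hA => ?_⟩
  rw [Measure.map_apply hcont.measurable hA]
  -- The invariant sets `{E < n}` exhaust the space, so monotone limits remove the restriction to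
  -- `{E < R}`.
  have hU : ∀ B : Set V, B = ⋃ n : ℕ, B ∩ {x | E x < n} := fun B => by
    ext x
    simp only [mem_iUnion, mem_inter_iff, mem_ofPred_eq, exists_and_left]
    exact ⟨fun h => ⟨h, exists_nat_gt (E x)⟩, fun h => h.1⟩
  have hm : ∀ B : Set V, Monotone fun n : ℕ => B ∩ {x | E x < n} := fun B m n hmn x => by
    simp only [mem_inter_iff, mem_ofPred_eq]
    exact fun hx => ⟨hx.1, hx.2.trans_le (Nat.cast_le.2 hmn)⟩
  rw [hU A, preimage_iUnion, (hm A).measure_iUnion, Monotone.measure_iUnion]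
  · congr 1
    ext n
    rw [← key n A hA]
    congr 1
    ext x
    simp [hT.energy_flow]
  · exact fun m n hmn => preimage_mono (hm A hmn)

end Liouville

/-! ### Convolution estimates for nonnegative sequences -/

theorem ennreal_two_mul_le_add_sq (a b : ℝ≥0∞) : 2 * (a * b) ≤ a ^ 2 + b ^ 2 := by
  wlog h : a ≤ b generalizing a b
  · rw [mul_comm a, add_comm]
    exact this b a (le_of_not_ge h)
  obtain ⟨c, rfl⟩ := exists_add_of_le h
  calc 2 * (a * (a + c)) ≤ 2 * (a * (a + c)) + c ^ 2 := le_self_add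
    _ = _ := by ring

theorem ennreal_add_sq_le (a b : ℝ≥0∞) : (a + b) ^ 2 ≤ 2 * (a ^ 2 + b ^ 2) := by
  calc (a + b) ^ 2 = a ^ 2 + b ^ 2 + 2 * (a * b) := by ring
    _ ≤ a ^ 2 + b ^ 2 + (a ^ 2 + b ^ 2) := by
      gcongr
      exact ennreal_two_mul_le_add_sq a b
    _ = _ := by ring

theorem tsum_int_sub_left {M : Type*} [AddCommMonoid M] [TopologicalSpace M] (n : ℤ) (f : ℤ → M) :
    ∑' k, f (n - k) = ∑' k, f k :=
  (Equiv.subLeft n).tsum_eq f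

theorem tsum_int_sub_right {M : Type*} [AddCommMonoid M] [TopologicalSpace M] (n : ℤ) (f : ℤ → M) :
    ∑' k, f (k - n) = ∑' k, f k :=
  (Equiv.subRight n).tsum_eq f

/-- Young's inequality `ℓ¹ * ℓ² ⊆ ℓ²`. -/
theorem tsum_sq_convolution_le (a b : ℤ → ℝ≥0∞) :
    ∑' n, (∑' k, a k * b (n - k)) ^ 2 ≤ (∑' k, a k) ^ 2 * ∑' k, b k ^ 2 := by
  -- The square is a double sum, and `2xy ≤ x² + y²` replaces Cauchy–Schwarz, so no square roots
  -- occur.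
  have h1 : ∀ n, 2 * (∑' k, a k * b (n - k)) ^ 2 ≤
      ∑' k, ∑' l, a k * a l * (b (n - k) ^ 2 + b (n - l) ^ 2) := fun n => by
    rw [sq, ← ENNReal.tsum_mul_right, ← ENNReal.tsum_mul_left]
    refine ENNReal.tsum_le_tsum fun k => ?_
    rw [← ENNReal.tsum_mul_left, ← ENNReal.tsum_mul_left]
    refine ENNReal.tsum_le_tsum fun l => ?_
    calc 2 * (a k * b (n - k) * (a l * b (n - l)))
        = a k * a l * (2 * (b (n - k) * b (n - l))) := by ring
      _ ≤ _ := by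
        gcongr
        exact ennreal_two_mul_le_add_sq _ _
  have h2 : 2 * ∑' n, (∑' k, a k * b (n - k)) ^ 2 ≤ 2 * ((∑' k, a k) ^ 2 * ∑' k, b k ^ 2) := by
    rw [← ENNReal.tsum_mul_left]
    refine (ENNReal.tsum_le_tsum h1).trans (le_of_eq ?_)
    rw [ENNReal.tsum_comm]
    have h3 : ∀ k, ∑' n, ∑' l, a k * a l * (b (n - k) ^ 2 + b (n - l) ^ 2) =
        a k * ((∑' l, a l) * (2 * ∑' m, b m ^ 2)) := fun k => by
      rw [ENNReal.tsum_comm, ← ENNReal.tsum_mul_right, ← ENNReal.tsum_mul_left]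
      congr 1
      ext l
      rw [ENNReal.tsum_mul_left, ENNReal.tsum_add, tsum_int_sub_right k fun m => b m ^ 2,
        tsum_int_sub_right l fun m => b m ^ 2]
      ring
    simp_rw [h3]
    rw [ENNReal.tsum_mul_right]
    ring
  exact (ENNReal.mul_le_mul_iff_right two_ne_zero ENNReal.ofNat_ne_top).1 h2

/-- The weight `|n| ^ σ`. -/
noncomputable def wt (σ : ℝ) (n : ℤ) : ℝ≥0∞ := ‖(n : ℝ)‖ₑ ^ σ

theorem wt_add_le {σ : ℝ} (hσ : 0 ≤ σ) (k l : ℤ) : wt σ (k + l) ≤ 2 ^ σ * (wt σ k + wt σ l) := by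
  unfold wt
  have h : ‖((k + l : ℤ) : ℝ)‖ₑ ≤ 2 * max ‖(k : ℝ)‖ₑ ‖(l : ℝ)‖ₑ := by
    push_cast
    refine (enorm_add_le _ _).trans ?_
    rw [two_mul]
    exact add_le_add (le_max_left _ _) (le_max_right _ _)
  calc _ ≤ (2 * max ‖(k : ℝ)‖ₑ ‖(l : ℝ)‖ₑ) ^ σ := ENNReal.rpow_le_rpow h hσ
    _ = 2 ^ σ * max (‖(k : ℝ)‖ₑ ^ σ) (‖(l : ℝ)‖ₑ ^ σ) := by
      rw [ENNReal.mul_rpow_of_nonneg _ _ hσ, (ENNReal.monotone_rpow_of_nonneg hσ).map_max]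
    _ ≤ _ := by
      gcongr
      exact max_le le_self_add le_add_self

theorem wt_neg (σ : ℝ) (n : ℤ) : wt σ (-n) = wt σ n := by simp [wt]

/-- The fractional Leibniz rule in terms of Fourier coefficients. -/
theorem tsum_sq_wt_convolution_le {σ : ℝ} (hσ : 0 ≤ σ) (a b : ℤ → ℝ≥0∞) :
    ∑' n, (wt σ n * ∑' k, a k * b (n - k)) ^ 2 ≤
      2 * (2 ^ σ) ^ 2 * ((∑' k, b k) ^ 2 * ∑' k, (wt σ k * a k) ^ 2 +
        (∑' k, a k) ^ 2 * ∑' k, (wt σ k * b k) ^ 2) := by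
  -- The weight at `n = k + (n - k)` falls on one of the two factors; the substitution `k ↦ n - k`
  -- brings the term where it falls on `a` into the same convolution form.
  have h1 : ∀ n, wt σ n * ∑' k, a k * b (n - k) ≤ 2 ^ σ * (∑' k, b k * (wt σ (n - k) * a (n - k)) +
      ∑' k, a k * (wt σ (n - k) * b (n - k))) := fun n => by
    rw [← tsum_int_sub_left n fun k => b k * (wt σ (n - k) * a (n - k)), ← ENNReal.tsum_add,
      ← ENNReal.tsum_mul_left, ← ENNReal.tsum_mul_left]
    refine ENNReal.tsum_le_tsum fun k => ?_
    have := wt_add_le hσ k (n - k)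
    rw [add_sub_cancel] at this
    rw [sub_sub_cancel]
    calc wt σ n * (a k * b (n - k)) ≤ 2 ^ σ * (wt σ k + wt σ (n - k)) * (a k * b (n - k)) := by
          gcongr
      _ = _ := by ring
  calc _ ≤ ∑' n, (2 ^ σ) ^ 2 * (2 * ((∑' k, b k * (wt σ (n - k) * a (n - k))) ^ 2 +
      (∑' k, a k * (wt σ (n - k) * b (n - k))) ^ 2)) := by
        refine ENNReal.tsum_le_tsum fun n => ?_
        refine (pow_le_pow_left₀ (zero_le) (h1 n) 2).trans ?_
        rw [mul_pow]
        gcongr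
        exact ennreal_add_sq_le _ _
    _ = 2 * (2 ^ σ) ^ 2 * (∑' n, (∑' k, b k * (wt σ (n - k) * a (n - k))) ^ 2 +
        ∑' n, (∑' k, a k * (wt σ (n - k) * b (n - k))) ^ 2) := by
        rw [ENNReal.tsum_mul_left, ENNReal.tsum_mul_left, ENNReal.tsum_add]
        ring
    _ ≤ _ := by
        gcongr
        · exact tsum_sq_convolution_le b fun k => wt σ k * a k
        · exact tsum_sq_convolution_le a fun k => wt σ k * b k

/-! ### Hermitian extension of sequences and convolution -/

/-- The extension of `u` to `ℤ` with `u₀ = 0` and `u₋ₙ = conj uₙ`. -/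
noncomputable def herm (u : ℕ+ → ℂ) (n : ℤ) : ℂ :=
  if 0 < n then u n.toNat.toPNat' else
    if n < 0 then (starRingEnd ℂ) (u (-n).toNat.toPNat') else 0

@[simp]
theorem herm_coe (u : ℕ+ → ℂ) (n : ℕ+) : herm u n = u n := by
  simp [herm]

@[simp]
theorem herm_neg_coe (u : ℕ+ → ℂ) (n : ℕ+) : herm u (-n) = (starRingEnd ℂ) (u n) := by
  simp [herm]

@[simp]
theorem herm_zero (u : ℕ+ → ℂ) : herm u 0 = 0 := by
  simp [herm]

theorem int_cases_pnat {p : ℤ → Prop} (h0 : p 0) (h1 : ∀ n : ℕ+, p n) (h2 : ∀ n : ℕ+, p (-n))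
    (n : ℤ) : p n := by
  obtain ⟨m, rfl | rfl⟩ := n.eq_nat_or_neg <;> rcases Nat.eq_zero_or_pos m with rfl | hm
  · exact h0
  · exact h1 ⟨m, hm⟩
  · simpa using h0
  · exact h2 ⟨m, hm⟩

theorem herm_neg (u : ℕ+ → ℂ) (n : ℤ) : herm u (-n) = (starRingEnd ℂ) (herm u n) := by
  induction n using int_cases_pnat <;> simp

theorem enorm_herm_neg (u : ℕ+ → ℂ) (n : ℤ) : ‖herm u (-n)‖ₑ = ‖herm u n‖ₑ := by
  rw [herm_neg, ← ofReal_norm, RCLike.norm_conj, ofReal_norm]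

theorem herm_add (u v : ℕ+ → ℂ) : herm (u + v) = herm u + herm v := by
  ext n
  induction n using int_cases_pnat <;> simp

theorem herm_smul (c : ℝ) (u : ℕ+ → ℂ) : herm (c • u) = c • herm u := by
  ext n
  induction n using int_cases_pnat <;> simp

theorem tsum_int_eq_two_mul {f : ℤ → ℝ≥0∞} (h0 : f 0 = 0) (hf : ∀ n, f (-n) = f n) :
    ∑' n, f n = 2 * ∑' n : ℕ+, f n := by
  rw [tsum_of_nat_of_neg_add_one ENNReal.summable ENNReal.summable,
    tsum_eq_zero_add' ENNReal.summable]
  have h1 : ∑' n : ℕ+, f n = ∑' n : ℕ, f ((n + 1 : ℕ) : ℤ) :=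
    tsum_pnat_eq_tsum_succ (f := fun n : ℕ => f n)
  have h2 : ∀ n : ℕ, f (-((n : ℤ) + 1)) = f ((n + 1 : ℕ) : ℤ) := fun n => by
    rw [hf]
    push_cast
    rfl
  simp_rw [h2]
  rw [h1, Nat.cast_zero, h0, zero_add, two_mul]

/-- Convolution of complex sequences. -/
noncomputable def conv (a b : ℤ → ℂ) (n : ℤ) : ℂ := ∑' k, a k * b (n - k)

theorem conv_comm (a b : ℤ → ℂ) (n : ℤ) : conv a b n = conv b a n := by
  unfold conv
  rw [← tsum_int_sub_left n]
  simp [mul_comm]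

theorem enorm_conv_le (a b : ℤ → ℂ) (n : ℤ) : ‖conv a b n‖ₑ ≤ ∑' k, ‖a k‖ₑ * ‖b (n - k)‖ₑ := by
  refine enorm_tsum_le_tsum_enorm.trans (le_of_eq ?_)
  simp_rw [enorm_mul]

theorem summable_conv {a b : ℤ → ℂ} (ha : ∑' k, ‖a k‖ₑ ≠ ∞) (hb : ∑' k, ‖b k‖ₑ ≠ ∞) (n : ℤ) :
    Summable fun k => a k * b (n - k) := by
  refine Summable.of_enorm (ne_top_of_le_ne_top (ENNReal.mul_ne_top ha hb) ?_)
  rw [← ENNReal.tsum_mul_right]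
  refine ENNReal.tsum_le_tsum fun k => ?_
  rw [enorm_mul]
  gcongr
  exact ENNReal.le_tsum (n - k)

theorem conv_add_left {a a' b : ℤ → ℂ} (ha : ∑' k, ‖a k‖ₑ ≠ ∞) (ha' : ∑' k, ‖a' k‖ₑ ≠ ∞)
    (hb : ∑' k, ‖b k‖ₑ ≠ ∞) (n : ℤ) : conv (a + a') b n = conv a b n + conv a' b n := by
  unfold conv
  rw [← (summable_conv ha hb n).tsum_add (summable_conv ha' hb n)]
  simp [add_mul]

theorem conv_smul_left (c : ℝ) (a b : ℤ → ℂ) (n : ℤ) : conv (c • a) b n = c • conv a b n := by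
  unfold conv
  rw [← tsum_const_smul'']
  simp [mul_assoc]

/-- The `ℓ¹` norm. -/
noncomputable def norm1 (u : ℕ+ → ℂ) : ℝ≥0∞ := ∑' n, ‖u n‖ₑ

/-- The square of the weighted `ℓ²` norm. -/
noncomputable def normSq (σ : ℝ) (u : ℕ+ → ℂ) : ℝ≥0∞ := ∑' n : ℕ+, (wt σ (n : ℕ) * ‖u n‖ₑ) ^ 2

theorem tsum_enorm_herm (u : ℕ+ → ℂ) : ∑' k, ‖herm u k‖ₑ = 2 * norm1 u := by
  rw [tsum_int_eq_two_mul (by simp) (enorm_herm_neg u)]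
  simp [norm1]

theorem tsum_sq_wt_herm (σ : ℝ) (u : ℕ+ → ℂ) :
    ∑' k, (wt σ k * ‖herm u k‖ₑ) ^ 2 = 2 * normSq σ u := by
  rw [tsum_int_eq_two_mul (by simp) (by simp [enorm_herm_neg, wt_neg])]
  simp [normSq]

/-- This is the Leibniz estimate on `ℤ`, restricted to positive frequencies on the left. On the
right, passing from `ℤ` to `n ≥ 1` doubles the `ℓ¹` norm and the squared `ℓ²` norm, whence `16 = 2 *
4 * 2`. -/
theorem normSq_conv_le {σ : ℝ} (hσ : 0 ≤ σ) (u v : ℕ+ → ℂ) :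
    normSq σ (fun n => conv (herm u) (herm v) (n : ℕ)) ≤
      16 * (2 ^ σ) ^ 2 * (norm1 v ^ 2 * normSq σ u + norm1 u ^ 2 * normSq σ v) := by
  have h1 := tsum_sq_wt_convolution_le hσ (fun k => ‖herm u k‖ₑ) fun k => ‖herm v k‖ₑ
  rw [tsum_sq_wt_herm, tsum_sq_wt_herm, tsum_enorm_herm, tsum_enorm_herm] at h1
  refine le_trans ?_ (h1.trans (le_of_eq (by ring)))
  have h2 : Function.Injective fun n : ℕ+ => ((n : ℕ) : ℤ) := fun a b h => by simpa using h
  refine le_trans ?_ (ENNReal.tsum_comp_le_tsum_of_injective h2 _)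
  refine ENNReal.tsum_le_tsum fun n => ?_
  gcongr
  exact enorm_conv_le _ _ _

/-! ### The cubic form in the energy estimate -/

theorem tsum_int_eq_two_mul_of_summable {f : ℤ → ℝ} (hs : Summable f) (h0 : f 0 = 0)
    (hf : ∀ n, f (-n) = f n) : ∑' n, f n = 2 * ∑' n : ℕ+, f n := by
  have hN : Summable fun n : ℕ => f n := hs.comp_injective Nat.cast_injective
  have hN' : Summable fun n : ℕ => f ((n + 1 : ℕ) : ℤ) :=
    hs.comp_injective fun a b h => by simpa using h
  have h2 : ∀ n : ℕ, f (-((n : ℤ) + 1)) = f ((n + 1 : ℕ) : ℤ) := fun n => by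
    rw [hf, Nat.cast_add, Nat.cast_one]
  have h1 : ∑' n : ℕ+, f n = ∑' n : ℕ, f ((n + 1 : ℕ) : ℤ) :=
    tsum_pnat_eq_tsum_succ (f := fun n : ℕ => f n)
  have hN'' : Summable fun n : ℕ => f (-((n : ℤ) + 1)) := hN'.congr fun n => (h2 n).symm
  rw [tsum_of_nat_of_neg_add_one hN hN'', tsum_eq_zero_add' (f := fun n : ℕ => f n) hN', tsum_congr h2]
  rw [h1, Nat.cast_zero, h0, zero_add, two_mul]

theorem conv_neg (u : ℕ+ → ℂ) (n : ℤ) :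
    conv (herm u) (herm u) (-n) = (starRingEnd ℂ) (conv (herm u) (herm u) n) := by
  unfold conv
  rw [Complex.conj_tsum, ← (Equiv.neg ℤ).tsum_eq]
  refine tsum_congr fun k => ?_
  rw [map_mul, ← herm_neg, ← herm_neg]
  simp only [Equiv.neg_apply]
  congr 2
  ring

theorem finite_support_herm {u : ℕ+ → ℂ} (hu : u.support.Finite) :
    (Function.support (herm u)).Finite := by
  refine ((hu.image fun n : ℕ+ => ((n : ℕ) : ℤ)).union
    (hu.image fun n : ℕ+ => -((n : ℕ) : ℤ))).subset fun n hn => ?_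
  induction n using int_cases_pnat with
  | h0 => simp at hn
  | h1 n => exact Or.inl ⟨n, by simpa using hn, rfl⟩
  | h2 n => exact Or.inr ⟨n, by simpa using hn, rfl⟩

/-- The trilinear sum `∑ m(k + l) c(-k-l) c(k) c(l)`. -/
noncomputable def tri (m : ℤ → ℝ) (c : ℤ → ℂ) : ℂ :=
  ∑' p : ℤ × ℤ, (m (p.1 + p.2) : ℂ) * (c (-(p.1 + p.2)) * c p.1 * c p.2)

theorem summable_tri {c : ℤ → ℂ} (hc : c.support.Finite) (a : ℤ × ℤ → ℂ) :
    Summable fun p : ℤ × ℤ => a p * (c (-(p.1 + p.2)) * c p.1 * c p.2) := by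
  refine summable_of_hasFiniteSupport ((hc.prod hc).subset fun p hp => ?_)
  simp only [Function.mem_support, ne_eq, mul_eq_zero, not_or] at hp
  exact ⟨hp.2.1.2, hp.2.2⟩

/-- The product `c(-k-l) c(k) c(l)` is symmetric in three frequencies with sum zero, so `m (k + l) =
-m (-k-l)` may be replaced by `-m k` or by `-m l`. Adding the three versions exhibits the
cancellation in the symbol. -/
theorem three_mul_tri {m : ℤ → ℝ} (hm : ∀ n, m (-n) = -m n) {c : ℤ → ℂ} (hc : c.support.Finite) :
    3 * tri m c = ∑' p : ℤ × ℤ,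
      ((m (p.1 + p.2) - m p.1 - m p.2 : ℝ) : ℂ) * (c (-(p.1 + p.2)) * c p.1 * c p.2) := by
  have h1 : tri m c = ∑' p : ℤ × ℤ, ((-m p.1 : ℝ) : ℂ) * (c (-(p.1 + p.2)) * c p.1 * c p.2) := by
    -- The involution exchanging the frequencies `k` and `-(k + l)`.
    let e : ℤ × ℤ ≃ ℤ × ℤ :=
      ⟨fun p => (-p.1 - p.2, p.2), fun p => (-p.1 - p.2, p.2), fun p => by simp, fun p => by simp⟩
    unfold tri
    rw [← e.tsum_eq]
    refine tsum_congr fun p => ?_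
    have h2 : -p.1 - p.2 + p.2 = -p.1 := by ring
    simp only [e, Equiv.coe_fn_mk, h2, hm, neg_neg]
    rw [show -p.1 - p.2 = -(p.1 + p.2) by ring]
    ring
  have h2 : tri m c = ∑' p : ℤ × ℤ, ((-m p.2 : ℝ) : ℂ) * (c (-(p.1 + p.2)) * c p.1 * c p.2) := by
    rw [h1, ← (Equiv.prodComm ℤ ℤ).tsum_eq]
    refine tsum_congr fun p => ?_
    simp only [Equiv.prodComm_apply, Prod.fst_swap, Prod.snd_swap, add_comm p.2 p.1]
    ring
  calc 3 * tri m c = tri m c + tri m c + tri m c := by ring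
    _ = _ := by
      nth_rw 2 [h1]
      nth_rw 2 [h2]
      unfold tri
      rw [← (summable_tri hc _).tsum_add (summable_tri hc _),
        ← ((summable_tri hc _).add (summable_tri hc _)).tsum_add (summable_tri hc _)]
      refine tsum_congr fun p => ?_
      push_cast
      ring

/-- The terms are grouped by `n = k + l`. -/
theorem tri_eq_tsum_conv (m : ℤ → ℝ) {c : ℤ → ℂ} (hc : c.support.Finite) :
    HasSum (fun n => (m n : ℂ) * (c (-n) * conv c c n)) (tri m c) := by
  let e : ℤ × ℤ ≃ ℤ × ℤ :=
    ⟨fun p => (p.2, p.1 - p.2), fun p => (p.1 + p.2, p.1), fun p => by simp, fun p => by simp⟩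
  have h := (summable_tri hc fun p => (m (p.1 + p.2) : ℂ)).hasSum
  rw [← e.hasSum_iff] at h
  refine h.prod_fiberwise fun n => ?_
  have h1 : Summable fun k => c k * c (n - k) :=
    summable_of_hasFiniteSupport (hc.subset fun k hk => left_ne_zero_of_mul hk)
  refine ((h1.hasSum.mul_left (c (-n))).mul_left (m n : ℂ)).congr_fun fun k => ?_
  have h2 : k + (n - k) = n := by ring
  simp only [e, Equiv.coe_fn_mk, Function.comp_apply, h2]
  ring

/-- `∑ m(n) Im (conj(uₙ) (u * u)ₙ)` over `n ≥ 1` as a symmetric trilinear sum. -/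
theorem tsum_mul_im_conv {m : ℤ → ℝ} (hm : ∀ n, m (-n) = -m n) {u : ℕ+ → ℂ}
    (hu : u.support.Finite) :
    2 * ∑' n : ℕ+, m n * ((starRingEnd ℂ) (u n) * conv (herm u) (herm u) (n : ℕ)).im =
      (tri m (herm u)).im := by
  have h := (tri_eq_tsum_conv m (finite_support_herm hu)).mapL Complex.imCLM
  simp only [Complex.imCLM_apply, Complex.im_ofReal_mul] at h
  rw [← h.tsum_eq, tsum_int_eq_two_mul_of_summable h.summable]
  · simp
  · simp
  · intro n
    rw [hm, conv_neg, neg_neg, herm_neg, Complex.mul_im, Complex.mul_im]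
    simp
    ring

/-- Here `c` is the smallest frequency. The sum `a^(2s+1) + b^(2s+1)` is divisible by `a + b = -c`,
so it is at most `|c|` times `2s` powers of the largest frequency. The two large frequencies are
within a factor `2`, which spreads these powers as `|a|^s |b|^s`. Finally `|c| ≤ |c|^s` because `s ≥
1`. -/
theorem abs_pow_add_pow_add_pow_le {s : ℕ} (hs : 1 ≤ s) {a b c : ℤ} (h : a + b + c = 0)
    (ha : |c| ≤ |a|) (hb : |c| ≤ |b|) :
    |a ^ (2 * s + 1) + b ^ (2 * s + 1) + c ^ (2 * s + 1)| ≤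
      ((2 * s + 1) * 2 ^ s + 1) * (|a| ^ s * |b| ^ s * |c| ^ s) := by
  have h1 : |a ^ (2 * s + 1) + b ^ (2 * s + 1)| ≤
      |c| * (2 * s + 1 : ℕ) * max |a| |b| ^ (2 * s) := by
    have := abs_pow_sub_pow_le a (-b) (2 * s + 1)
    rw [abs_neg, Odd.neg_pow ⟨s, rfl⟩, sub_neg_eq_add, sub_neg_eq_add,
      show a + b = -c by omega, abs_neg] at this
    simpa using this
  have h2 : max |a| |b| ^ (2 * s) ≤ 2 ^ s * (|a| ^ s * |b| ^ s) := by
    rw [pow_mul, ← mul_pow, ← mul_pow]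
    refine pow_le_pow_left₀ (by positivity) ?_ s
    rcases le_total |a| |b| with hab | hab
    · rw [max_eq_right hab]
      have : |b| ≤ 2 * |a| := by
        rw [show b = -(a + c) by omega, abs_neg]
        linarith [abs_add_le a c]
      nlinarith [abs_nonneg b]
    · rw [max_eq_left hab]
      have : |a| ≤ 2 * |b| := by
        rw [show a = -(b + c) by omega, abs_neg]
        linarith [abs_add_le b c]
      nlinarith [abs_nonneg a]
  have h3 : |c| ≤ |c| ^ s := by
    rcases eq_or_ne c 0 with rfl | hc
    · simp
    · exact le_self_pow₀ (Int.one_le_abs hc) (by omega)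
  have h4 : |c| ^ (2 * s + 1) ≤ |a| ^ s * |b| ^ s * |c| ^ s := by
    calc |c| ^ (2 * s + 1) = |c| ^ s * |c| ^ s * |c| := by ring
      _ ≤ _ := by gcongr
  calc _ ≤ |a ^ (2 * s + 1) + b ^ (2 * s + 1)| + |c ^ (2 * s + 1)| := abs_add_le _ _
    _ ≤ |c| ^ s * (2 * s + 1 : ℕ) * (2 ^ s * (|a| ^ s * |b| ^ s)) +
        |a| ^ s * |b| ^ s * |c| ^ s := by
      rw [abs_pow]
      refine add_le_add (h1.trans ?_) h4
      gcongr
    _ = _ := by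
      push_cast
      ring

/-- The triple `k + l, -k, -l` has sum zero and can be ordered by size. The gain is that no
frequency carries more than `s` powers. -/
theorem abs_add_pow_sub_sub_le {s : ℕ} (hs : 1 ≤ s) (k l : ℤ) :
    |(k + l) ^ (2 * s + 1) - k ^ (2 * s + 1) - l ^ (2 * s + 1)| ≤
      ((2 * s + 1) * 2 ^ s + 1) * (|k + l| ^ s * |k| ^ s * |l| ^ s) := by
  have hodd : Odd (2 * s + 1) := ⟨s, rfl⟩
  have key : ∀ a b c : ℤ, a + b + c = 0 → |a ^ (2 * s + 1) + b ^ (2 * s + 1) + c ^ (2 * s + 1)| ≤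
      ((2 * s + 1) * 2 ^ s + 1) * (|a| ^ s * |b| ^ s * |c| ^ s) := by
    intro a b c h
    rcases le_total |a| |b| with h1 | h1 <;> rcases le_total |b| |c| with h2 | h2 <;>
      rcases le_total |a| |c| with h3 | h3
    · convert abs_pow_add_pow_add_pow_le hs (a := b) (b := c) (c := a) (by omega) h1 h3 using 2 <;>
        ring
    · convert abs_pow_add_pow_add_pow_le hs (a := b) (b := c) (c := a) (by omega) h1
        (h1.trans h2) using 2 <;> ring
    · convert abs_pow_add_pow_add_pow_le hs (a := b) (b := c) (c := a) (by omega) h1 h3 using 2 <;>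
        ring
    · exact abs_pow_add_pow_add_pow_le hs h h3 h2
    · convert abs_pow_add_pow_add_pow_le hs (a := a) (b := c) (c := b) (by omega) h1 h2 using 2 <;>
        ring
    · convert abs_pow_add_pow_add_pow_le hs (a := a) (b := c) (c := b) (by omega) h1 h2 using 2 <;>
        ring
    · exact abs_pow_add_pow_add_pow_le hs h (h2.trans h1) h2
    · exact abs_pow_add_pow_add_pow_le hs h h3 h2
  have := key (k + l) (-k) (-l) (by ring)
  rwa [hodd.neg_pow, hodd.neg_pow, abs_neg, abs_neg, ← sub_eq_add_neg, ← sub_eq_add_neg] at this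

/-- If `c` is the smallest of the three frequencies in modulus, then `1 = |c|^(-2θ) |c|^θ |c|^θ`,
and the two positive powers may be moved to the larger frequencies. Frequency zero is harmless since
`p 0 = 0`, even where the negative weight is infinite. -/
theorem ennreal_trilinear_le {θ : ℝ} (hθ : 0 ≤ θ) {p : ℤ → ℝ≥0∞} (h0 : p 0 = 0) (k l : ℤ) :
    p (k + l) * p k * p l ≤
      wt (-(2 * θ)) l * p l * ((wt θ k * p k) * (wt θ (k + l) * p (k + l))) +
      wt (-(2 * θ)) k * p k * ((wt θ l * p l) * (wt θ (k + l) * p (k + l))) +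
      wt (-(2 * θ)) (k + l) * p (k + l) * ((wt θ k * p k) * (wt θ l * p l)) := by
  by_cases hk : k = 0
  · simp [hk, h0]
  by_cases hl : l = 0
  · simp [hl, h0]
  by_cases hkl : k + l = 0
  · simp [hkl, h0]
  have hw : ∀ m n : ℤ, |m| ≤ |n| → wt θ m ≤ wt θ n := fun m n h => by
    refine ENNReal.rpow_le_rpow ?_ hθ
    rw [Real.enorm_eq_ofReal_abs, Real.enorm_eq_ofReal_abs]
    exact ENNReal.ofReal_le_ofReal (by exact_mod_cast h)
  have h1 : ∀ a b c : ℤ, c ≠ 0 → |c| ≤ |a| → |c| ≤ |b| →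
      1 ≤ wt (-(2 * θ)) c * (wt θ a * wt θ b) := fun a b c hc ha hb => by
    have hc0 : ‖(c : ℝ)‖ₑ ≠ 0 := by simpa using hc
    calc 1 = wt (-(2 * θ)) c * (wt θ c * wt θ c) := by
          unfold wt
          rw [← ENNReal.rpow_add _ _ hc0 enorm_ne_top, ← ENNReal.rpow_add _ _ hc0 enorm_ne_top]
          ring_nf
          simp
      _ ≤ _ := by
        gcongr
        · exact hw _ _ ha
        · exact hw _ _ hb
  have h2 : (|l| ≤ |k| ∧ |l| ≤ |k + l|) ∨ (|k| ≤ |l| ∧ |k| ≤ |k + l|) ∨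
      (|k + l| ≤ |k| ∧ |k + l| ≤ |l|) := by omega
  rcases h2 with ⟨ha, hb⟩ | ⟨ha, hb⟩ | ⟨ha, hb⟩
  · refine le_trans ?_ (le_self_add.trans le_self_add)
    calc p (k + l) * p k * p l = 1 * (p (k + l) * p k * p l) := (one_mul _).symm
      _ ≤ wt (-(2 * θ)) l * (wt θ k * wt θ (k + l)) * (p (k + l) * p k * p l) := by
        gcongr
        exact h1 _ _ _ hl ha hb
      _ = _ := by ring
  · refine le_trans ?_ (le_add_self.trans le_self_add)
    calc p (k + l) * p k * p l = 1 * (p (k + l) * p k * p l) := (one_mul _).symm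
      _ ≤ wt (-(2 * θ)) k * (wt θ l * wt θ (k + l)) * (p (k + l) * p k * p l) := by
        gcongr
        exact h1 _ _ _ hk ha hb
      _ = _ := by ring
  · refine le_trans ?_ le_add_self
    calc p (k + l) * p k * p l = 1 * (p (k + l) * p k * p l) := (one_mul _).symm
      _ ≤ wt (-(2 * θ)) (k + l) * (wt θ k * wt θ l) * (p (k + l) * p k * p l) := by
        gcongr
        exact h1 _ _ _ hkl ha hb
      _ = _ := by ring

/-- An `ℓ¹ × ℓ² × ℓ²` bound: for fixed `l`, `e` merely reindexes the second `ℓ²` factor. -/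
theorem tsum_mul_mul_le (r q : ℤ → ℝ≥0∞) (e : ℤ → ℤ → ℤ)
    (he : ∀ l, ∑' k, q (e k l) ^ 2 = ∑' k, q k ^ 2) :
    ∑' l, ∑' k, r l * (q k * q (e k l)) ≤ (∑' l, r l) * ∑' k, q k ^ 2 := by
  rw [← ENNReal.tsum_mul_right]
  refine ENNReal.tsum_le_tsum fun l => ?_
  rw [ENNReal.tsum_mul_left]
  refine mul_le_mul' le_rfl ?_
  rw [← ENNReal.mul_le_mul_iff_right two_ne_zero ENNReal.ofNat_ne_top, ← ENNReal.tsum_mul_left]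
  calc _ ≤ ∑' k, (q k ^ 2 + q (e k l) ^ 2) :=
        ENNReal.tsum_le_tsum fun k => ennreal_two_mul_le_add_sq _ _
    _ = _ := by rw [ENNReal.tsum_add, he, two_mul]

/-- The constant `∑ n ≥ 1, n ^ (-6 θ)`. -/
noncomputable def zetaConst (θ : ℝ) : ℝ≥0∞ := ∑' n : ℕ+, wt (-(6 * θ)) (n : ℕ)

/-- Write `|n|^(-2θ) = |n|^(-3θ) |n|^θ` and use `xy ≤ x² + y²`. The sum of `n^(-6θ)` is finite for
`θ > 1/6`, the origin of that threshold. -/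
theorem tsum_wt_mul_le {θ : ℝ} {p : ℤ → ℝ≥0∞} (h0 : p 0 = 0) :
    ∑' n, wt (-(2 * θ)) n * p n ≤ 2 * zetaConst θ + ∑' n, (wt θ n * p n) ^ 2 := by
  have h1 : 2 * zetaConst θ = ∑' n : ℤ, if n = 0 then 0 else wt (-(6 * θ)) n := by
    rw [tsum_int_eq_two_mul (by simp) (by simp [wt_neg])]
    simp [zetaConst]
  rw [h1, ← ENNReal.tsum_add]
  refine ENNReal.tsum_le_tsum fun n => ?_
  by_cases hn : n = 0
  · simp [hn, h0]
  have hn0 : ‖(n : ℝ)‖ₑ ≠ 0 := by simpa using hn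
  rw [if_neg hn]
  have h2 : wt (-(2 * θ)) n = wt (-(3 * θ)) n * wt θ n := by
    unfold wt
    rw [← ENNReal.rpow_add _ _ hn0 enorm_ne_top]
    ring_nf
  have h3 : wt (-(6 * θ)) n = wt (-(3 * θ)) n ^ 2 := by
    unfold wt
    rw [sq, ← ENNReal.rpow_add _ _ hn0 enorm_ne_top]
    ring_nf
  rw [h2, h3, mul_assoc]
  exact (le_mul_of_one_le_left (zero_le) one_le_two).trans (ennreal_two_mul_le_add_sq _ _)

/-- The smallest frequency is summed in `ℓ¹` and the other two in weighted `ℓ²`. -/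
theorem tsum_trilinear_le {θ : ℝ} (hθ : 0 ≤ θ) {p : ℤ → ℝ≥0∞} (h0 : p 0 = 0) :
    ∑' q : ℤ × ℤ, p (q.1 + q.2) * p q.1 * p q.2 ≤
      3 * (2 * zetaConst θ + ∑' n, (wt θ n * p n) ^ 2) * ∑' n, (wt θ n * p n) ^ 2 := by
  set r : ℤ → ℝ≥0∞ := fun n => wt (-(2 * θ)) n * p n
  set q : ℤ → ℝ≥0∞ := fun n => wt θ n * p n
  have hB : (∑' l, r l) * ∑' k, q k ^ 2 ≤ (2 * zetaConst θ + ∑' n, q n ^ 2) * ∑' n, q n ^ 2 := by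
    gcongr
    exact tsum_wt_mul_le h0
  rw [ENNReal.tsum_prod (f := fun k l => p (k + l) * p k * p l)]
  calc _ ≤ ∑' k, ∑' l, (r l * (q k * q (k + l)) + r k * (q l * q (k + l)) +
        r (k + l) * (q k * q l)) :=
        ENNReal.tsum_le_tsum fun k => ENNReal.tsum_le_tsum fun l => ennreal_trilinear_le hθ h0 k l
    -- In the third sum the variable becomes `n = k + l`, the frequency that now carries `r`.
    _ = ∑' l, ∑' k, r l * (q k * q (k + l)) + ∑' k, ∑' l, r k * (q l * q (k + l)) +
        ∑' n, ∑' l, r n * (q l * q (n - l)) := by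
      simp_rw [ENNReal.tsum_add]
      refine congrArg₂ _ (congrArg₂ _ ENNReal.tsum_comm rfl) ?_
      · rw [ENNReal.tsum_comm (f := fun n l => r n * (q l * q (n - l))), ENNReal.tsum_comm]
        refine tsum_congr fun l => ?_
        rw [← tsum_int_sub_right l]
        refine tsum_congr fun n => ?_
        rw [sub_add_cancel, mul_comm (q l)]
    _ ≤ (2 * zetaConst θ + ∑' n, q n ^ 2) * ∑' n, q n ^ 2 +
        (2 * zetaConst θ + ∑' n, q n ^ 2) * ∑' n, q n ^ 2 +
        (2 * zetaConst θ + ∑' n, q n ^ 2) * ∑' n, q n ^ 2 := by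
      refine add_le_add (add_le_add ?_ ?_) ?_ <;> refine le_trans ?_ hB
      · refine tsum_mul_mul_le r q (fun k l => k + l) fun l => ?_
        simpa using tsum_int_sub_right (-l) fun n => q n ^ 2
      · refine tsum_mul_mul_le r q (fun l k => k + l) fun l => ?_
        simpa [add_comm] using tsum_int_sub_right (-l) fun n => q n ^ 2
      · exact tsum_mul_mul_le r q (fun l n => n - l) fun n => tsum_int_sub_left n fun n => q n ^ 2
    _ = _ := by ring

/-- For `m n = n` the symmetrised symbol `(k + l) - k - l` vanishes. This is conservation of the
energy. -/
theorem tsum_pow_one_mul_im_conv {u : ℕ+ → ℂ} (hu : u.support.Finite) :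
    ∑' n : ℕ+, ((n : ℕ) : ℝ) * ((starRingEnd ℂ) (u n) * conv (herm u) (herm u) (n : ℕ)).im = 0 := by
  have h1 := tsum_mul_im_conv (m := fun n => (n : ℝ)) (by simp) hu
  have h2 := three_mul_tri (m := fun n => (n : ℝ)) (by simp) (finite_support_herm hu)
  have h3 : tri (fun n => (n : ℝ)) (herm u) = 0 := by
    simpa using h2
  rw [h3] at h1
  simpa using h1

theorem wt_natCast (s : ℕ) (n : ℤ) : wt s n = ‖(n : ℝ)‖ₑ ^ s := by
  simp [wt]

/-- The central nonlinear estimate: the symmetrised symbol puts `s` powers on each factor, and the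
trilinear bound is applied to `p n = |n|^s |û(n)|`. -/
theorem ofReal_abs_tsum_pow_mul_im_conv_le {s : ℕ} (hs : 1 ≤ s) {θ : ℝ} (hθ : 0 ≤ θ) :
    ∃ C : ℝ≥0, ∀ u : ℕ+ → ℂ, u.support.Finite →
      ENNReal.ofReal |∑' n : ℕ+, ((n : ℕ) : ℝ) ^ (2 * s + 1) *
        ((starRingEnd ℂ) (u n) * conv (herm u) (herm u) (n : ℕ)).im| ≤
      C * ((zetaConst θ + normSq (s + θ) u) * normSq (s + θ) u) := by
  -- The first factor comes from the symbol bound, and `12 = 3 * 2 * 2` from the trilinear bound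
  -- with both of its factors doubled by passing to `ℤ`.
  refine ⟨((2 * s + 1) * 2 ^ s + 1) * 12, fun u hu => ?_⟩
  set m : ℤ → ℝ := fun n => (n : ℝ) ^ (2 * s + 1)
  have hm : ∀ n, m (-n) = -m n := fun n => by
    simp only [m, Int.cast_neg]
    exact Odd.neg_pow ⟨s, rfl⟩ _
  have h1 := tsum_mul_im_conv hm hu
  have h2 := three_mul_tri hm (finite_support_herm hu)
  set S := ∑' n : ℕ+, m n * ((starRingEnd ℂ) (u n) * conv (herm u) (herm u) (n : ℕ)).im
  have hS : ∑' n : ℕ+, ((n : ℕ) : ℝ) ^ (2 * s + 1) *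
        ((starRingEnd ℂ) (u n) * conv (herm u) (herm u) (n : ℕ)).im = S := by simp [S, m]
  rw [hS]
  set p : ℤ → ℝ≥0∞ := fun n => wt s n * ‖herm u n‖ₑ
  have hq : ∑' n, (wt θ n * p n) ^ 2 = 2 * normSq (s + θ) u := by
    rw [← tsum_sq_wt_herm]
    refine tsum_congr fun n => ?_
    by_cases hn : n = 0
    · simp [hn, p]
    have hn0 : ‖(n : ℝ)‖ₑ ≠ 0 := by simpa using hn
    simp only [p]
    rw [← mul_assoc]
    unfold wt
    rw [← ENNReal.rpow_add _ _ hn0 enorm_ne_top, add_comm]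
  have h3 : ENNReal.ofReal |S| ≤ ‖3 * tri m (herm u)‖ₑ := by
    rw [← ofReal_norm]
    refine ENNReal.ofReal_le_ofReal ?_
    rw [norm_mul, Complex.norm_ofNat]
    have := Complex.abs_im_le_norm (tri m (herm u))
    rw [← h1, abs_mul, abs_two] at this
    linarith [abs_nonneg S]
  refine h3.trans ?_
  rw [h2]
  refine enorm_tsum_le_tsum_enorm.trans ?_
  calc _ ≤ ∑' q : ℤ × ℤ, (((2 * s + 1) * 2 ^ s + 1 : ℕ) : ℝ≥0∞) *
        (p (q.1 + q.2) * p q.1 * p q.2) := by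
        refine ENNReal.tsum_le_tsum fun q => ?_
        rw [enorm_mul, enorm_mul, enorm_mul, enorm_herm_neg]
        have h4 : ‖((m (q.1 + q.2) - m q.1 - m q.2 : ℝ) : ℂ)‖ₑ ≤
            (((2 * s + 1) * 2 ^ s + 1 : ℕ) : ℝ≥0∞) * (wt s (q.1 + q.2) * wt s q.1 * wt s q.2) := by
          have h5 := abs_add_pow_sub_sub_le hs q.1 q.2
          have h6 : |m (q.1 + q.2) - m q.1 - m q.2| ≤ (((2 * s + 1) * 2 ^ s + 1 : ℕ) : ℝ) *
              (|((q.1 + q.2 : ℤ) : ℝ)| ^ s * |(q.1 : ℝ)| ^ s * |(q.2 : ℝ)| ^ s) := by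
            simp only [m]
            exact_mod_cast h5
          rw [← ofReal_norm, Complex.norm_real, Real.norm_eq_abs]
          refine (ENNReal.ofReal_le_ofReal h6).trans (le_of_eq ?_)
          rw [wt_natCast, wt_natCast, wt_natCast, Real.enorm_eq_ofReal_abs,
            Real.enorm_eq_ofReal_abs, Real.enorm_eq_ofReal_abs, ENNReal.ofReal_mul (by positivity),
            ENNReal.ofReal_mul (by positivity), ENNReal.ofReal_mul (by positivity),
            ENNReal.ofReal_pow (abs_nonneg _), ENNReal.ofReal_pow (abs_nonneg _),
            ENNReal.ofReal_pow (abs_nonneg _), ENNReal.ofReal_natCast]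
        calc _ ≤ (((2 * s + 1) * 2 ^ s + 1 : ℕ) : ℝ≥0∞) *
              (wt s (q.1 + q.2) * wt s q.1 * wt s q.2) *
              (‖herm u (q.1 + q.2)‖ₑ * ‖herm u q.1‖ₑ * ‖herm u q.2‖ₑ) := by gcongr
          _ = _ := by
            simp only [p]
            ring
    _ ≤ (((2 * s + 1) * 2 ^ s + 1 : ℕ) : ℝ≥0∞) *
        (3 * (2 * zetaConst θ + 2 * normSq (s + θ) u) * (2 * normSq (s + θ) u)) := by
      rw [ENNReal.tsum_mul_left, ← hq]
      gcongr
      exact tsum_trilinear_le hθ (by simp [p])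
    _ = _ := by
      push_cast
      ring

/-! ### The vector field of the equation in weighted Fourier coordinates -/

/-- The Hilbert space of square summable sequences. A function `f` in `H^s` corresponds to
`n ↦ n ^ s f̂(n)`. -/
abbrev Seq : Type := lp (fun _ : ℕ+ => ℂ) 2

theorem memℓp_two_of_tsum_enorm {f : ℕ+ → ℂ} (h : ∑' n, ‖f n‖ₑ ^ 2 ≠ ∞) : Memℓp f 2 := by
  refine memℓp_gen ?_
  have := ENNReal.summable_toReal h
  refine this.congr fun n => ?_
  simp

theorem Seq.enorm_sq (x : Seq) : ‖x‖ₑ ^ 2 = ∑' n, ‖x n‖ₑ ^ 2 := by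
  have h1 := lp.norm_rpow_eq_tsum (p := 2) (by norm_num) x
  have h2 := (lp.memℓp x).summable (by norm_num)
  simp only [ENNReal.toReal_ofNat, Real.rpow_ofNat] at h1 h2
  rw [← ofReal_norm, ← ENNReal.ofReal_pow (norm_nonneg _), h1,
    ENNReal.ofReal_tsum_of_nonneg (fun n => by positivity) h2]
  refine tsum_congr fun n => ?_
  rw [ENNReal.ofReal_pow (norm_nonneg _), ofReal_norm]

theorem enorm_le_of_sq_le {X : Type*} [SeminormedAddGroup X] {x : X} {a : ℝ≥0∞}
    (h : ‖x‖ₑ ^ 2 ≤ a ^ 2) : ‖x‖ₑ ≤ a :=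
  (ENNReal.pow_le_pow_left_iff two_ne_zero).1 h

/-- Multiplication of the coordinates by a bounded sequence. -/
noncomputable def Seq.diag (w : ℕ+ → ℂ) (C : ℝ) (hw : ∀ n, ‖w n‖ ≤ C) : Seq →L[ℝ] Seq :=
  have hC : 0 ≤ C := (norm_nonneg _).trans (hw 1)
  have hb : ∀ x : Seq, ∑' n, ‖w n * x n‖ₑ ^ 2 ≤ (ENNReal.ofReal C * ‖x‖ₑ) ^ 2 := fun x => by
    rw [mul_pow, Seq.enorm_sq, ← ENNReal.tsum_mul_left]
    refine ENNReal.tsum_le_tsum fun n => ?_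
    rw [enorm_mul, mul_pow]
    gcongr
    rw [← ofReal_norm]
    exact ENNReal.ofReal_le_ofReal (hw n)
  LinearMap.mkContinuous
    { toFun x := ⟨fun n => w n * x n, memℓp_two_of_tsum_enorm
        (ne_top_of_le_ne_top (ENNReal.pow_ne_top
          (ENNReal.mul_ne_top ENNReal.ofReal_ne_top enorm_ne_top)) (hb x))⟩
      map_add' x y := by
        ext n
        exact mul_add _ _ _
      map_smul' c x := by
        ext n
        exact mul_smul_comm c _ _ } C fun x => by
    have h1 := hb x
    rw [← ENNReal.ofReal_le_ofReal_iff (by positivity), ENNReal.ofReal_mul hC, ofReal_norm,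
      ofReal_norm]
    refine enorm_le_of_sq_le ?_
    rw [Seq.enorm_sq]
    exact h1

@[simp]
theorem Seq.diag_apply (w : ℕ+ → ℂ) (C : ℝ) (hw : ∀ n, ‖w n‖ ≤ C) (x : Seq) (n : ℕ+) :
    Seq.diag w C hw x n = w n * x n := rfl

/-- The Fourier coefficients, with positive frequencies, of the function with coordinates `x`. -/
noncomputable def coefs (s : ℕ) (x : ℕ+ → ℂ) (n : ℕ+) : ℂ := (((n : ℕ) : ℂ) ^ s)⁻¹ * x n

theorem pnat_pow_ne_zero (s : ℕ) (n : ℕ+) : ((n : ℕ) : ℂ) ^ s ≠ 0 :=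
  pow_ne_zero _ (Nat.cast_ne_zero.2 n.ne_zero)

theorem mul_coefs (s : ℕ) (x : ℕ+ → ℂ) (n : ℕ+) : ((n : ℕ) : ℂ) ^ s * coefs s x n = x n := by
  rw [coefs, mul_inv_cancel_left₀ (pnat_pow_ne_zero s n)]

theorem coefs_add (s : ℕ) (x y : ℕ+ → ℂ) : coefs s (x + y) = coefs s x + coefs s y := by
  ext n
  exact mul_add _ _ _

theorem coefs_smul (s : ℕ) (c : ℝ) (x : ℕ+ → ℂ) : coefs s (c • x) = c • coefs s x := by
  ext n
  exact mul_smul_comm c _ _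

theorem enorm_natCast_complex (n : ℕ) : ‖(n : ℂ)‖ₑ = n := by
  rw [← ofReal_norm, Complex.norm_natCast, ENNReal.ofReal_natCast]

theorem enorm_natCast_real (n : ℕ) : ‖(n : ℝ)‖ₑ = n := by
  rw [← ofReal_norm, Real.norm_natCast, ENNReal.ofReal_natCast]

theorem wt_pnat (σ : ℝ) (n : ℕ+) : wt σ (n : ℕ) = ((n : ℕ) : ℝ≥0∞) ^ σ := by
  rw [wt, Int.cast_natCast, enorm_natCast_real]

theorem pnat_ennreal_ne_zero (n : ℕ+) : ((n : ℕ) : ℝ≥0∞) ≠ 0 := by simp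

theorem wt_add (σ τ : ℝ) (n : ℕ+) : wt (σ + τ) (n : ℕ) = wt σ (n : ℕ) * wt τ (n : ℕ) := by
  rw [wt_pnat, wt_pnat, wt_pnat, ENNReal.rpow_add _ _ (pnat_ennreal_ne_zero n)
    (ENNReal.natCast_ne_top _)]

theorem wt_mul_enorm_coefs (s : ℕ) (x : ℕ+ → ℂ) (n : ℕ+) :
    wt s (n : ℕ) * ‖coefs s x n‖ₑ = ‖x n‖ₑ := by
  conv_rhs => rw [← mul_coefs s x n]
  rw [enorm_mul, enorm_pow, enorm_natCast_complex, wt_pnat, ENNReal.rpow_natCast]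

theorem normSq_coefs (s : ℕ) (x : Seq) : normSq s (coefs s x) = ‖x‖ₑ ^ 2 := by
  rw [Seq.enorm_sq, normSq]
  simp_rw [wt_mul_enorm_coefs]

theorem normSq_coefs_add (s : ℕ) (θ : ℝ) (x : ℕ+ → ℂ) :
    normSq (s + θ) (coefs s x) = ∑' n : ℕ+, (wt θ (n : ℕ) * ‖x n‖ₑ) ^ 2 := by
  refine tsum_congr fun n => ?_
  rw [add_comm (s : ℝ), wt_add, mul_assoc, wt_mul_enorm_coefs]

theorem tsum_wt_ne_top {σ : ℝ} (hσ : σ < -1) : ∑' n : ℕ+, wt σ (n : ℕ) ≠ ∞ := by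
  have h1 : Summable fun n : ℕ => (n : ℝ) ^ σ := Real.summable_nat_rpow.2 hσ
  have h2 := h1.comp_injective PNat.coe_injective
  have h3 := h2.tsum_ofReal_ne_top
  refine ne_of_eq_of_ne (tsum_congr fun n => ?_) h3
  rw [wt_pnat, Function.comp_apply, ← ENNReal.ofReal_rpow_of_pos (by simp),
    ENNReal.ofReal_natCast]

/-- `H^s` embeds into the functions with summable Fourier coefficients. -/
theorem exists_norm1_coefs_le {s : ℕ} (hs : 1 ≤ s) :
    ∃ Z : ℝ≥0, ∀ x : Seq, norm1 (coefs s x) ≤ Z * ‖x‖ₑ := by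
  have hm : Memℓp (fun n : ℕ+ => (((n : ℕ) : ℂ) ^ s)⁻¹) 2 := by
    refine memℓp_two_of_tsum_enorm (ne_top_of_le_ne_top
      (tsum_wt_ne_top (σ := -2) (by norm_num)) (ENNReal.tsum_le_tsum fun n => ?_))
    rw [wt_pnat, enorm_inv (pnat_pow_ne_zero s n), enorm_pow, enorm_natCast_complex,
      ENNReal.rpow_neg, ENNReal.rpow_ofNat, ← ENNReal.inv_pow, ← pow_mul, ENNReal.inv_le_inv]
    exact pow_le_pow_right₀ (by exact_mod_cast (one_le : 1 ≤ n)) (by omega)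
  set z : Seq := ⟨_, hm⟩
  refine ⟨‖z‖₊, fun x => ?_⟩
  obtain ⟨h1, h2⟩ := lp.tsum_mul_le_mul_norm (p := 2) (q := 2)
    (by simpa using Real.HolderConjugate.two_two) z x
  have h3 : norm1 (coefs s x) = ENNReal.ofReal (∑' n, ‖z n‖ * ‖x n‖) := by
    rw [ENNReal.ofReal_tsum_of_nonneg (fun n => by positivity) h1, norm1]
    refine tsum_congr fun n => ?_
    rw [ENNReal.ofReal_mul (norm_nonneg _), ofReal_norm, ofReal_norm, coefs, enorm_mul]
  rw [h3]
  refine (ENNReal.ofReal_le_ofReal h2).trans (le_of_eq ?_)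
  rw [ENNReal.ofReal_mul (norm_nonneg _), ofReal_norm, ofReal_norm]
  rfl

/-- The coordinates of the product of two functions. -/
noncomputable def prodCoord (s : ℕ) (x y : ℕ+ → ℂ) (n : ℕ+) : ℂ :=
  ((n : ℕ) : ℂ) ^ s * conv (herm (coefs s x)) (herm (coefs s y)) (n : ℕ)

theorem coefs_prodCoord (s : ℕ) (x y : ℕ+ → ℂ) (n : ℕ+) :
    coefs s (prodCoord s x y) n = conv (herm (coefs s x)) (herm (coefs s y)) (n : ℕ) := by
  rw [coefs, prodCoord, inv_mul_cancel_left₀ (pnat_pow_ne_zero s n)]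

theorem prodCoord_comm (s : ℕ) (x y : ℕ+ → ℂ) : prodCoord s x y = prodCoord s y x := by
  ext n
  rw [prodCoord, conv_comm, prodCoord]

theorem normSq_prodCoord_le (s : ℕ) {σ : ℝ} (hσ : 0 ≤ σ) (x y : ℕ+ → ℂ) :
    normSq σ (coefs s (prodCoord s x y)) ≤ 16 * (2 ^ σ) ^ 2 *
      (norm1 (coefs s y) ^ 2 * normSq σ (coefs s x) +
        norm1 (coefs s x) ^ 2 * normSq σ (coefs s y)) := by
  rw [show coefs s (prodCoord s x y) = fun n : ℕ+ =>
    conv (herm (coefs s x)) (herm (coefs s y)) (n : ℕ) from funext (coefs_prodCoord s x y)]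
  exact normSq_conv_le hσ _ _

/-- The algebra property of `H^s`: the fractional Leibniz rule with the other factor in `ℓ¹`. The
constant uses `32 ≤ 6²`. -/
theorem exists_prodCoord_le {s : ℕ} (hs : 1 ≤ s) : ∃ A : ℝ≥0, ∀ x y : Seq,
    ∑' n, ‖prodCoord s x y n‖ₑ ^ 2 ≤ (A * ‖x‖ₑ * ‖y‖ₑ) ^ 2 := by
  obtain ⟨Z, hZ⟩ := exists_norm1_coefs_le hs
  refine ⟨6 * 2 ^ s * Z, fun x y => ?_⟩
  have h1 := normSq_prodCoord_le s (Nat.cast_nonneg s) x y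
  rw [normSq_coefs, normSq_coefs] at h1
  have h2 : ∑' n, ‖prodCoord s x y n‖ₑ ^ 2 = normSq s (coefs s (prodCoord s x y)) := by
    rw [normSq]
    simp_rw [wt_mul_enorm_coefs]
  rw [h2]
  refine h1.trans ?_
  calc _ ≤ 16 * ((2 : ℝ≥0∞) ^ (s : ℝ)) ^ 2 *
        ((Z * ‖y‖ₑ) ^ 2 * ‖x‖ₑ ^ 2 + (Z * ‖x‖ₑ) ^ 2 * ‖y‖ₑ ^ 2) := by
        gcongr
        · exact hZ y
        · exact hZ x
    _ = 32 * (2 ^ s * Z * ‖x‖ₑ * ‖y‖ₑ) ^ 2 := by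
      rw [ENNReal.rpow_natCast]
      ring
    _ ≤ 36 * (2 ^ s * Z * ‖x‖ₑ * ‖y‖ₑ) ^ 2 := by
      gcongr
      norm_num
    _ = _ := by
      push_cast
      ring

theorem tsum_enorm_herm_coefs_ne_top {s : ℕ} (hs : 1 ≤ s) (x : Seq) :
    ∑' k, ‖herm (coefs s x) k‖ₑ ≠ ∞ := by
  obtain ⟨Z, hZ⟩ := exists_norm1_coefs_le hs
  rw [tsum_enorm_herm]
  exact ENNReal.mul_ne_top ENNReal.ofNat_ne_top
    (ne_top_of_le_ne_top (ENNReal.mul_ne_top ENNReal.coe_ne_top enorm_ne_top) (hZ x))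

theorem prodCoord_add_left {s : ℕ} (hs : 1 ≤ s) (x x' y : Seq) :
    prodCoord s (x + x' : Seq) y = prodCoord s x y + prodCoord s x' y := by
  ext n
  rw [Pi.add_apply, prodCoord, lp.coeFn_add, coefs_add, herm_add,
    conv_add_left (tsum_enorm_herm_coefs_ne_top hs x) (tsum_enorm_herm_coefs_ne_top hs x')
      (tsum_enorm_herm_coefs_ne_top hs y), mul_add]
  rfl

theorem prodCoord_smul_left {s : ℕ} (c : ℝ) (x y : Seq) :
    prodCoord s (c • x : Seq) y = c • prodCoord s x y := by
  ext n
  rw [Pi.smul_apply, prodCoord, lp.coeFn_smul, coefs_smul, herm_smul, conv_smul_left,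
    mul_smul_comm]
  rfl

theorem memℓp_prodCoord {s : ℕ} (hs : 1 ≤ s) (x y : Seq) : Memℓp (prodCoord s x y) 2 := by
  obtain ⟨A, hA⟩ := exists_prodCoord_le hs
  exact memℓp_two_of_tsum_enorm (ne_top_of_le_ne_top (ENNReal.pow_ne_top (ENNReal.mul_ne_top
    (ENNReal.mul_ne_top ENNReal.coe_ne_top enorm_ne_top) enorm_ne_top)) (hA x y))

/-- A bounded bilinear map makes the vector field a continuous polynomial, hence `C¹` and Lipschitz
on balls. -/
theorem exists_bilinear {s : ℕ} (hs : 1 ≤ s) : ∃ Q : Seq →L[ℝ] Seq →L[ℝ] Seq,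
    ∀ x y n, Q x y n = prodCoord s x y n := by
  obtain ⟨A, hA⟩ := exists_prodCoord_le hs
  refine ⟨LinearMap.mkContinuous₂ (LinearMap.mk₂ ℝ
    (fun x y : Seq => (⟨prodCoord s x y, memℓp_prodCoord hs x y⟩ : Seq)) (fun x x' y => ?_)
    (fun c x y => ?_) (fun x y y' => ?_) fun c x y => ?_) A fun x y => ?_, fun x y n => rfl⟩
  · exact Subtype.ext (prodCoord_add_left hs x x' y)
  · exact Subtype.ext (prodCoord_smul_left c x y)
  · refine Subtype.ext ?_
    change prodCoord s x (y + y' : Seq) = prodCoord s x y + prodCoord s x y'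
    rw [prodCoord_comm, prodCoord_add_left hs, prodCoord_comm s y, prodCoord_comm s y']
  · refine Subtype.ext ?_
    change prodCoord s x (c • y : Seq) = c • prodCoord s x y
    rw [prodCoord_comm, prodCoord_smul_left, prodCoord_comm s y]
  · have h1 : ‖(⟨prodCoord s x y, memℓp_prodCoord hs x y⟩ : Seq)‖ₑ ≤ A * ‖x‖ₑ * ‖y‖ₑ :=
      enorm_le_of_sq_le (by
        rw [Seq.enorm_sq]
        exact hA x y)
    have h2 : ENNReal.ofReal (A * ‖x‖ * ‖y‖) = A * ‖x‖ₑ * ‖y‖ₑ := by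
      rw [ENNReal.ofReal_mul (by positivity), ENNReal.ofReal_mul A.coe_nonneg, ofReal_norm, ofReal_norm,
        ENNReal.ofReal_coe_nnreal]
    rw [← h2, ← ofReal_norm, ENNReal.ofReal_le_ofReal_iff (by positivity)] at h1
    exact h1

/-- The admissible parameters of the equation and of the measure. -/
structure Params where
  γ : ℝ
  s : ℕ
  hγ : 4 / 3 < γ
  hs : γ / 2 ≤ s

/-! ### The equation as an ODE on `ℓ²`: conserved energy and growth bounds. -/

namespace Params

variable (P : Params)

theorem one_le_s : 1 ≤ P.s := by
  have h1 := P.hγ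
  have h2 := P.hs
  by_contra h
  have h3 : P.s = 0 := by omega
  rw [h3] at h2
  norm_num at h2
  linarith

/-- The symbol of `-∂ₓ (1 + |D|^γ)⁻¹`. -/
noncomputable def lam (n : ℕ+) : ℂ := -(Complex.I * (n : ℕ)) / ((1 + ((n : ℕ) : ℝ) ^ P.γ : ℝ) : ℂ)

/-- As `γ ≥ 1`, the smoothing `(1 + n^γ)⁻¹` absorbs the derivative, so no derivative is lost. -/
theorem norm_lam_le (n : ℕ+) : ‖P.lam n‖ ≤ 1 := by
  have h1 : (1 : ℝ) ≤ (n : ℕ) := by exact_mod_cast (one_le : 1 ≤ n)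
  have h2 : ((n : ℕ) : ℝ) ≤ ((n : ℕ) : ℝ) ^ P.γ := by
    have := Real.rpow_le_rpow_of_exponent_le h1 (by linarith [P.hγ] : (1 : ℝ) ≤ P.γ)
    rwa [Real.rpow_one] at this
  rw [lam, norm_div, norm_neg, norm_mul, Complex.norm_I, Complex.norm_natCast, Complex.norm_real,
    Real.norm_of_nonneg (by positivity), one_mul, div_le_one (by positivity)]
  linarith

/-- The bilinear map describing the product of two functions. -/
noncomputable def bilin : Seq →L[ℝ] Seq →L[ℝ] Seq := (exists_bilinear P.one_le_s).choose

theorem bilin_apply (x y : Seq) (n : ℕ+) : P.bilin x y n = prodCoord P.s x y n :=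
  (exists_bilinear P.one_le_s).choose_spec x y n

/-- The operator `-∂ₓ (1 + |D|^γ)⁻¹`. -/
noncomputable def lamOp : Seq →L[ℝ] Seq := Seq.diag P.lam 1 P.norm_lam_le

/-- The vector field `u ↦ -∂ₓ (1 + |D|^γ)⁻¹ (u + u²)`. -/
noncomputable def field (x : Seq) : Seq := P.lamOp (x + P.bilin x x)

theorem field_apply (x : Seq) (n : ℕ+) :
    P.field x n = P.lam n * (x n + prodCoord P.s x x n) := by
  rw [← bilin_apply]
  rfl

theorem contDiff_field : ContDiff ℝ 1 P.field :=
  P.lamOp.contDiff.comp (contDiff_id.add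
    (P.bilin.isBoundedBilinearMap.contDiff.comp (contDiff_id.prodMk contDiff_id)))

theorem hasFDerivAt_field (x : Seq) :
    HasFDerivAt P.field
      (P.lamOp ∘L (ContinuousLinearMap.id ℝ Seq + (P.bilin x + P.bilin.flip x))) x := by
  have h1 := P.bilin.hasFDerivAt_of_bilinear (hasFDerivAt_id x) (hasFDerivAt_id x)
  have h2 := P.lamOp.hasFDerivAt.comp x ((hasFDerivAt_id x).add h1)
  refine h2.congr_fderiv ?_
  ext h : 1
  simp

theorem bilin_comm (x y : Seq) : P.bilin x y = P.bilin y x :=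
  lp.ext (funext fun n => by rw [bilin_apply, bilin_apply, prodCoord_comm])

theorem lipschitzOnWith_field (R : ℝ) : ∃ L : ℝ≥0, LipschitzOnWith L P.field (closedBall 0 R) := by
  rcases lt_or_ge R 0 with hR | hR
  · refine ⟨0, ?_⟩
    rw [closedBall_eq_empty.2 hR]
    exact lipschitzOnWith_empty _ _
  refine ⟨‖P.lamOp‖₊ * (1 + 2 * ‖P.bilin‖₊ * R.toNNReal), LipschitzOnWith.of_dist_le_mul
    fun x hx y hy => ?_⟩
  rw [mem_closedBall_zero_iff] at hx hy
  have h1 : P.field x - P.field y = P.lamOp ((x - y) + (P.bilin x (x - y) + P.bilin (x - y) y)) := by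
    rw [field, field, ← map_sub]
    congr 1
    simp only [map_sub, sub_apply]
    abel
  rw [dist_eq_norm, dist_eq_norm, h1]
  push_cast
  rw [Real.coe_toNNReal _ hR, mul_assoc]
  refine (P.lamOp.le_opNorm _).trans ?_
  gcongr
  have h2 : ‖P.bilin x (x - y)‖ ≤ ‖P.bilin‖ * R * ‖x - y‖ :=
    (P.bilin.le_opNorm₂ _ _).trans (by gcongr)
  have h3 : ‖P.bilin (x - y) y‖ ≤ ‖P.bilin‖ * ‖x - y‖ * R :=
    (P.bilin.le_opNorm₂ _ _).trans (by gcongr)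
  refine (norm_add_le _ _).trans ?_
  have := norm_add_le (P.bilin x (x - y)) (P.bilin (x - y) y)
  linarith

/-- The projection onto the frequencies in `I`. -/
noncomputable def _root_.BBM.Seq.proj (I : Finset ℕ+) : Seq →L[ℝ] Seq :=
  Seq.diag (fun n => if n ∈ I then 1 else 0) 1 fun n => by split_ifs <;> simp

theorem _root_.BBM.Seq.proj_apply (I : Finset ℕ+) (x : Seq) (n : ℕ+) :
    Seq.proj I x n = if n ∈ I then x n else 0 := by
  simp [Seq.proj]

theorem _root_.BBM.Seq.proj_proj (I : Finset ℕ+) (x : Seq) :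
    Seq.proj I (Seq.proj I x) = Seq.proj I x :=
  lp.ext (funext fun n => by simp only [Seq.proj_apply]; split_ifs <;> rfl)

theorem _root_.BBM.Seq.norm_le_of_enorm_le {x y : Seq} (h : ∀ n, ‖x n‖ₑ ≤ ‖y n‖ₑ) :
    ‖x‖ ≤ ‖y‖ := by
  have h1 : ‖x‖ₑ ≤ ‖y‖ₑ := enorm_le_of_sq_le (by
    rw [Seq.enorm_sq, Seq.enorm_sq]
    exact ENNReal.tsum_le_tsum fun n => pow_le_pow_left₀ zero_le (h n) 2)
  exact (enorm_le_iff_norm_le).1 h1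

theorem _root_.BBM.Seq.norm_proj_le (I : Finset ℕ+) (x : Seq) : ‖Seq.proj I x‖ ≤ ‖x‖ :=
  Seq.norm_le_of_enorm_le fun n => by
    rw [Seq.proj_apply]
    split_ifs <;> simp

theorem _root_.BBM.Seq.proj_diag (I : Finset ℕ+) (w : ℕ+ → ℂ) (C : ℝ) (hw : ∀ n, ‖w n‖ ≤ C)
    (x : Seq) : Seq.proj I (Seq.diag w C hw x) = Seq.diag w C hw (Seq.proj I x) :=
  lp.ext (funext fun n => by
    simp only [Seq.proj_apply, Seq.diag_apply]
    split_ifs <;> simp)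

theorem _root_.BBM.Seq.finite_support_proj (I : Finset ℕ+) (x : Seq) :
    (Function.support (Seq.proj I x : ℕ+ → ℂ)).Finite :=
  I.finite_toSet.subset fun n hn => by
    by_contra h
    exact hn ((Seq.proj_apply I x n).trans (if_neg (by simpa using h)))

theorem _root_.BBM.Seq.tendsto_proj (x : Seq) :
    Tendsto (fun I => Seq.proj I x) atTop (𝓝 x) := by
  refine (lp.hasSum_single (by norm_num) x).congr fun I => ?_
  ext n
  rw [lp.coeFn_sum, Finset.sum_apply, Seq.proj_apply]
  simp only [lp.single_apply, Pi.single_apply]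
  simp

/-- The energy is of order `γ / 2 ≤ s`, hence it is finite and continuous on `H^s`. -/
theorem norm_sqrt_div_le (n : ℕ+) :
    ‖((√(1 + ((n : ℕ) : ℝ) ^ P.γ) / ((n : ℕ) : ℝ) ^ P.s : ℝ) : ℂ)‖ ≤ 2 := by
  have h1 : (1 : ℝ) ≤ (n : ℕ) := by exact_mod_cast (one_le : 1 ≤ n)
  rw [Complex.norm_real, Real.norm_of_nonneg (by positivity), div_le_iff₀ (by positivity),
    Real.sqrt_le_left (by positivity), mul_pow]
  have h2 : ((n : ℕ) : ℝ) ^ P.γ ≤ (((n : ℕ) : ℝ) ^ P.s) ^ 2 := by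
    rw [← pow_mul, ← Real.rpow_natCast]
    refine Real.rpow_le_rpow_of_exponent_le h1 ?_
    push_cast
    linarith [P.hs]
  have h3 : (1 : ℝ) ≤ (((n : ℕ) : ℝ) ^ P.s) ^ 2 := one_le_pow₀ (one_le_pow₀ h1)
  linarith

/-- The diagonal operator with `‖energyOp x‖ ^ 2 = ∑ n ≥ 1, (1 + n ^ γ) |û(n)| ^ 2`. -/
noncomputable def energyOp : Seq →L[ℝ] Seq := Seq.diag _ 2 P.norm_sqrt_div_le

/-- The conserved energy. -/
noncomputable def energy (x : Seq) : ℝ := ‖P.energyOp x‖ ^ 2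

theorem energyOp_apply (x : Seq) (n : ℕ+) :
    P.energyOp x n = (√(1 + ((n : ℕ) : ℝ) ^ P.γ) : ℂ) * coefs P.s x n := by
  rw [energyOp, Seq.diag_apply, coefs]
  push_cast
  ring

/-- The linear part of the field is rotated by the imaginary symbol and is orthogonal to `x n`, so
only the quadratic part contributes. The weight `r` is left free: `r² = (1 + n^γ) / n^(2s)` serves
the energy, `r² = 1 + n^γ` the Gaussian exponent. -/
theorem inner_diag_sq_field {x : Seq} (n : ℕ+) {r : ℝ} :
    inner ℝ ((r : ℂ) * x n) ((r : ℂ) * P.field x n) = r ^ 2 / (1 + ((n : ℕ) : ℝ) ^ P.γ) *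
      (((n : ℕ) : ℝ) ^ (2 * P.s + 1) * ((starRingEnd ℂ) (coefs P.s x n) *
        conv (herm (coefs P.s x)) (herm (coefs P.s x)) (n : ℕ)).im) := by
  have hpos : (0 : ℝ) < 1 + ((n : ℕ) : ℝ) ^ P.γ := by positivity
  set a : ℝ := 1 + ((n : ℕ) : ℝ) ^ P.γ
  set c := conv (herm (coefs P.s x)) (herm (coefs P.s x)) (n : ℕ)
  set u := coefs P.s x n
  have hx : x n = ((((n : ℕ) : ℝ) ^ P.s : ℝ) : ℂ) * u := by
    rw [← mul_coefs P.s x n]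
    push_cast
    rfl
  have hp : prodCoord P.s x x n = ((((n : ℕ) : ℝ) ^ P.s : ℝ) : ℂ) * c := by
    rw [prodCoord]
    push_cast
    rfl
  have hl : P.lam n = ((-(((n : ℕ) : ℝ) / a) : ℝ) : ℂ) * Complex.I := by
    rw [lam]
    simp only [a]
    push_cast
    ring
  rw [P.field_apply, hp, hl, hx]
  rw [pow_succ ((n : ℕ) : ℝ), mul_comm 2 P.s, pow_mul, Complex.inner]
  generalize ((n : ℕ) : ℝ) ^ P.s = N
  simp only [map_mul, Complex.conj_ofReal, Complex.mul_re, Complex.mul_im, Complex.add_re,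
    Complex.add_im, Complex.ofReal_re, Complex.ofReal_im, Complex.I_re, Complex.I_im,
    Complex.conj_re, Complex.conj_im]
  field_simp
  ring

/-- For finitely many frequencies the cubic sum vanishes by antisymmetry; density and continuity
give the rest. -/
theorem inner_energyOp_field (x : Seq) : inner ℝ (P.energyOp x) (P.energyOp (P.field x)) = 0 := by
  have hfin : ∀ I, inner ℝ (P.energyOp (Seq.proj I x)) (P.energyOp (P.field (Seq.proj I x))) = 0 := by
    intro I
    set y := Seq.proj I x
    have hy : (coefs P.s y).support.Finite :=
      (Seq.finite_support_proj I x).subset fun n hn => right_ne_zero_of_mul hn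
    rw [lp.inner_eq_tsum, ← tsum_pow_one_mul_im_conv hy]
    refine tsum_congr fun n => ?_
    have h1 : (0 : ℝ) < 1 + ((n : ℕ) : ℝ) ^ P.γ := by positivity
    have h2 : ((n : ℕ) : ℝ) ≠ 0 := by simp
    rw [energyOp, Seq.diag_apply, Seq.diag_apply, inner_diag_sq_field, div_pow,
      Real.sq_sqrt h1.le]
    field_simp
    ring
  have hc : Continuous fun x => inner ℝ (P.energyOp x) (P.energyOp (P.field x)) := by
    have := P.contDiff_field.continuous
    fun_prop
  have := (hc.tendsto x).comp (Seq.tendsto_proj x)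
  refine tendsto_nhds_unique this ?_
  simp only [Function.comp_def, hfin]
  exact tendsto_const_nhds

/-- The constant in the embedding of the energy space into functions with summable Fourier
coefficients. -/
noncomputable def zc : ℝ≥0∞ := ∑' n : ℕ+, wt (-P.γ) (n : ℕ)

theorem zc_ne_top : P.zc ≠ ∞ := tsum_wt_ne_top (by linarith [P.hγ])

/-- Split `|û(n)| = n^(-γ/2) * (n^(γ/2) |û(n)|)` and use `xy ≤ x² + y²`; the first sum converges
because `γ > 1`. -/
theorem norm1_coefs_le (x : Seq) : norm1 (coefs P.s x) ≤ P.zc + ‖P.energyOp x‖ₑ ^ 2 := by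
  rw [Seq.enorm_sq, zc, norm1, ← ENNReal.tsum_add]
  refine ENNReal.tsum_le_tsum fun n => ?_
  have h1 : wt (-P.γ) (n : ℕ) = wt (-(P.γ / 2)) (n : ℕ) ^ 2 := by
    rw [sq, ← wt_add]
    ring_nf
  have h2 : wt (-(P.γ / 2)) (n : ℕ) * wt (P.γ / 2) (n : ℕ) = 1 := by
    rw [← wt_add]
    simp [wt]
  have h3 : wt (P.γ / 2) (n : ℕ) ≤ ‖(√(1 + ((n : ℕ) : ℝ) ^ P.γ) : ℂ)‖ₑ := by
    have h4 : (0 : ℝ) < (n : ℕ) := by simp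
    rw [wt_pnat, ← ofReal_norm, Complex.norm_real, Real.norm_of_nonneg (by positivity),
      ← ENNReal.ofReal_natCast, ENNReal.ofReal_rpow_of_pos h4]
    refine ENNReal.ofReal_le_ofReal (Real.le_sqrt_of_sq_le ?_)
    rw [← Real.rpow_natCast, ← Real.rpow_mul h4.le]
    norm_num
  rw [P.energyOp_apply, h1]
  calc ‖coefs P.s x n‖ₑ = wt (-(P.γ / 2)) (n : ℕ) * (wt (P.γ / 2) (n : ℕ) * ‖coefs P.s x n‖ₑ) := by
        rw [← mul_assoc, h2, one_mul]
    _ ≤ 2 * (wt (-(P.γ / 2)) (n : ℕ) * (wt (P.γ / 2) (n : ℕ) * ‖coefs P.s x n‖ₑ)) :=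
        le_mul_of_one_le_left zero_le one_le_two
    _ ≤ _ := ennreal_two_mul_le_add_sq _ _
    _ ≤ _ := by
      rw [enorm_mul]
      gcongr

/-- The Leibniz rule keeps one factor in `H^σ` and the other in `ℓ¹`, which the energy controls. The
bound is thus linear in the `H^σ` norm, for every `σ ≥ 0`. -/
theorem normSq_field_le {σ : ℝ} (hσ : 0 ≤ σ) (x : Seq) :
    normSq σ (coefs P.s (P.field x)) ≤
      (8 * 2 ^ σ * (1 + P.zc + ‖P.energyOp x‖ₑ ^ 2)) ^ 2 * normSq σ (coefs P.s x) := by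
  set N := normSq σ (coefs P.s x)
  set n1 := norm1 (coefs P.s x)
  have h1 := normSq_prodCoord_le P.s hσ x x
  have h2 : normSq σ (coefs P.s (P.field x)) ≤
      2 * (N + normSq σ (coefs P.s (prodCoord P.s x x))) := by
    simp only [N, normSq]
    rw [← ENNReal.tsum_add, ← ENNReal.tsum_mul_left]
    refine ENNReal.tsum_le_tsum fun n => ?_
    have h3 : coefs P.s (P.field x) n =
        P.lam n * (coefs P.s x n + coefs P.s (prodCoord P.s x x) n) := by
      simp only [coefs]
      rw [P.field_apply]
      ring
    have h4 : ‖coefs P.s (P.field x) n‖ₑ ≤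
        ‖coefs P.s x n‖ₑ + ‖coefs P.s (prodCoord P.s x x) n‖ₑ := by
      rw [h3, enorm_mul]
      have : ‖P.lam n‖ₑ ≤ 1 := by
        rw [← ofReal_norm]
        exact ENNReal.ofReal_le_one.2 (P.norm_lam_le n)
      exact (mul_le_of_le_one_left zero_le this).trans (enorm_add_le _ _)
    calc _ ≤ (wt σ (n : ℕ) * (‖coefs P.s x n‖ₑ + ‖coefs P.s (prodCoord P.s x x) n‖ₑ)) ^ 2 := by
          gcongr
      _ ≤ _ := by
        rw [mul_add]
        exact ennreal_add_sq_le _ _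
  have h5 : (1 : ℝ≥0∞) ≤ (2 ^ σ) ^ 2 := by
    refine one_le_pow₀ ?_
    simpa using ENNReal.rpow_le_rpow_of_exponent_le (one_le_two : (1 : ℝ≥0∞) ≤ 2) hσ
  calc _ ≤ _ := h2
    _ ≤ 2 * (N + 16 * (2 ^ σ) ^ 2 * (n1 ^ 2 * N + n1 ^ 2 * N)) := by gcongr
    _ = (2 * 1 + 64 * (2 ^ σ) ^ 2 * n1 ^ 2) * N := by ring
    _ ≤ (64 * (2 ^ σ) ^ 2 + 64 * (2 ^ σ) ^ 2 * n1 ^ 2) * N := by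
      gcongr
      norm_num
    _ = 64 * (2 ^ σ) ^ 2 * (1 + n1 ^ 2) * N := by ring
    _ ≤ 64 * (2 ^ σ) ^ 2 * (1 + n1) ^ 2 * N := by
      gcongr
      calc 1 + n1 ^ 2 ≤ 1 + n1 ^ 2 + 2 * n1 := le_self_add
        _ = _ := by ring
    _ = (8 * 2 ^ σ * (1 + n1)) ^ 2 * N := by ring
    _ ≤ _ := by
      rw [add_assoc]
      gcongr
      exact P.norm1_coefs_le x

/-- The growth rate of the `H^σ` norm in terms of the energy. -/
noncomputable def rate (σ e : ℝ) : ℝ := 8 * 2 ^ σ * (1 + P.zc.toReal + e)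

theorem rate_mono (σ : ℝ) : Monotone (P.rate σ) := fun a b h => by
  unfold rate
  gcongr

theorem ofReal_rate {σ : ℝ} (x : Seq) : ENNReal.ofReal (P.rate σ (P.energy x)) =
    8 * 2 ^ σ * (1 + P.zc + ‖P.energyOp x‖ₑ ^ 2) := by
  have h0 : 0 ≤ P.energy x := sq_nonneg _
  rw [rate, ENNReal.ofReal_mul (by positivity), ENNReal.ofReal_mul (by positivity),
    ENNReal.ofReal_add (by positivity) h0, ENNReal.ofReal_add (by positivity) (by positivity),
    ENNReal.ofReal_toReal P.zc_ne_top, energy, ENNReal.ofReal_pow (norm_nonneg _), ofReal_norm,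
    ← ENNReal.ofReal_rpow_of_pos (by norm_num)]
  simp

theorem norm_field_le (x : Seq) : ‖P.field x‖ ≤ P.rate P.s (P.energy x) * ‖x‖ := by
  have h := P.normSq_field_le (Nat.cast_nonneg P.s) x
  rw [normSq_coefs, normSq_coefs, ← P.ofReal_rate, ← mul_pow] at h
  have h0 : 0 ≤ P.energy x := sq_nonneg _
  have h2 := enorm_le_of_sq_le h
  have h3 : 0 ≤ P.rate P.s (P.energy x) := by
    unfold rate
    positivity
  rw [← ofReal_norm, ← ofReal_norm, ← ENNReal.ofReal_mul h3,
    ENNReal.ofReal_le_ofReal_iff (by positivity)] at h2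
  exact h2

theorem hasFDerivAt_energy (x : Seq) : ∃ E' : Seq →L[ℝ] ℝ, HasFDerivAt P.energy E' x ∧
    ∀ y, E' y = 2 * inner ℝ (P.energyOp x) (P.energyOp y) := by
  have h := (P.energyOp.hasFDerivAt (x := x)).norm_sq
  exact ⟨_, h, fun y => by simp⟩

theorem contDiff_energy : ContDiff ℝ 1 P.energy := P.energyOp.contDiff.norm_sq ℝ

theorem tameField : TameField P.field P.energy (P.rate P.s) := by
  refine ⟨P.lipschitzOnWith_field, fun x => ?_, P.norm_field_le⟩
  obtain ⟨E', h1, h2⟩ := P.hasFDerivAt_energy x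
  exact ⟨E', h1, by rw [h2, P.inner_energyOp_field, mul_zero]⟩

theorem rate_energy_le (R : ℝ) : ∃ K, ∀ x, ‖x‖ ≤ R → P.rate P.s (P.energy x) ≤ K := by
  refine ⟨P.rate P.s ((‖P.energyOp‖ * R) ^ 2), fun x hx => P.rate_mono _ ?_⟩
  exact pow_le_pow_left₀ (norm_nonneg _) ((P.energyOp.le_opNorm x).trans (by gcongr)) 2

/-- The Galerkin truncation of the vector field. -/
noncomputable def galerkin (I : Finset ℕ+) (x : Seq) : Seq :=
  Seq.proj I (P.field (Seq.proj I x))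

theorem energy_proj_le (I : Finset ℕ+) (x : Seq) : P.energy (Seq.proj I x) ≤ P.energy x := by
  refine pow_le_pow_left₀ (norm_nonneg _) ?_ 2
  rw [energyOp, ← Seq.proj_diag]
  exact Seq.norm_proj_le _ _

theorem _root_.BBM.Seq.inner_proj_left (I : Finset ℕ+) (x y : Seq) :
    inner ℝ (Seq.proj I x) y = inner ℝ x (Seq.proj I y) := by
  rw [lp.inner_eq_tsum, lp.inner_eq_tsum]
  refine tsum_congr fun n => ?_
  rw [Seq.proj_apply, Seq.proj_apply]
  split_ifs <;> simp

/-- The projection is a self-adjoint contraction that commutes with the diagonal `energyOp`. Moving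
it onto the other factor of the inner product reduces conservation to that of the full field at the
projected point. -/
theorem tameField_galerkin (I : Finset ℕ+) :
    TameField (P.galerkin I) P.energy (P.rate P.s) := by
  refine ⟨fun R => ?_, fun x => ?_, fun x => ?_⟩
  · obtain ⟨L, hL⟩ := P.lipschitzOnWith_field R
    refine ⟨L, LipschitzOnWith.of_dist_le_mul fun x hx y hy => ?_⟩
    rw [mem_closedBall_zero_iff] at hx hy
    rw [dist_eq_norm, dist_eq_norm, galerkin, galerkin, ← map_sub]
    have hx' : Seq.proj I x ∈ closedBall 0 R := by
      rw [mem_closedBall_zero_iff]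
      exact (Seq.norm_proj_le I x).trans hx
    have hy' : Seq.proj I y ∈ closedBall 0 R := by
      rw [mem_closedBall_zero_iff]
      exact (Seq.norm_proj_le I y).trans hy
    refine (Seq.norm_proj_le _ _).trans ((hL.norm_sub_le hx' hy').trans ?_)
    rw [← map_sub]
    gcongr
    exact Seq.norm_proj_le _ _
  · obtain ⟨E', h1, h2⟩ := P.hasFDerivAt_energy x
    refine ⟨E', h1, ?_⟩
    rw [h2, galerkin, energyOp, ← Seq.proj_diag, ← Seq.inner_proj_left, Seq.proj_diag]
    have := P.inner_energyOp_field (Seq.proj I x)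
    rw [energyOp] at this
    rw [this, mul_zero]
  · refine (Seq.norm_proj_le _ _).trans ((P.norm_field_le _).trans ?_)
    have h0 : 0 ≤ P.energy x := sq_nonneg _
    have h3 : 0 ≤ P.rate P.s (P.energy x) := by
      unfold rate
      positivity
    exact mul_le_mul (P.rate_mono _ (P.energy_proj_le I x)) (Seq.norm_proj_le I x)
      (norm_nonneg _) h3

end Params

/-! ### Finite truncations and Sobolev weights. -/

namespace Seq

theorem norm_trunc_le (w : ℕ+ → ℝ) (I : Finset ℕ+) (n : ℕ+) :
    ‖if n ∈ I then (w n : ℂ) else 0‖ ≤ ∑ k ∈ I, ‖w k‖ := by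
  split_ifs with h
  · rw [Complex.norm_real]
    exact Finset.single_le_sum (f := fun k => ‖w k‖) (fun k _ => norm_nonneg _) h
  · rw [norm_zero]
    positivity

/-- The projection onto the frequencies in `I`, with weights. -/
noncomputable def trunc (w : ℕ+ → ℝ) (I : Finset ℕ+) : Seq →L[ℝ] Seq :=
  Seq.diag _ _ (norm_trunc_le w I)

theorem trunc_apply (w : ℕ+ → ℝ) (I : Finset ℕ+) (x : Seq) (n : ℕ+) :
    trunc w I x n = (if n ∈ I then (w n : ℂ) else 0) * x n := by
  rw [trunc, Seq.diag_apply]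

theorem trunc_proj (w : ℕ+ → ℝ) (I : Finset ℕ+) (x : Seq) :
    trunc w I (proj I x) = trunc w I x :=
  lp.ext (funext fun n => by
    rw [trunc_apply, trunc_apply, proj_apply]
    split_ifs <;> simp)

theorem norm_trunc_sq (w : ℕ+ → ℝ) (I : Finset ℕ+) (x : Seq) :
    ‖trunc w I x‖ ^ 2 = ∑ n ∈ I, w n ^ 2 * ‖x n‖ ^ 2 := by
  have h := lp.norm_rpow_eq_tsum (p := 2) (by norm_num) (trunc w I x)
  simp only [ENNReal.toReal_ofNat, Real.rpow_ofNat] at h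
  rw [h, tsum_eq_sum (s := I) fun n hn => by rw [trunc_apply, if_neg hn]; simp]
  refine Finset.sum_congr rfl fun n hn => ?_
  rw [trunc_apply, if_pos hn, norm_mul, Complex.norm_real, mul_pow, Real.norm_eq_abs, sq_abs]

theorem enorm_trunc_rpow_sq_le (s : ℕ) (θ : ℝ) (I : Finset ℕ+) (x : Seq) :
    ‖trunc (fun n => ((n : ℕ) : ℝ) ^ θ) I x‖ₑ ^ 2 ≤ normSq (s + θ) (coefs s x) := by
  rw [Seq.enorm_sq, normSq_coefs_add]
  refine ENNReal.tsum_le_tsum fun n => ?_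
  gcongr
  rw [trunc_apply, enorm_mul]
  gcongr
  split_ifs
  · rw [wt_pnat, ← ofReal_norm, Complex.norm_real, Real.norm_of_nonneg (by positivity),
      ← ENNReal.ofReal_natCast, ENNReal.ofReal_rpow_of_pos (by simp)]
  · simp

/-- On the frequencies in `I` the `H^(s+θ)` norm is the norm of a bounded linear image, so it can be
followed along a differentiable curve. -/
theorem enorm_trunc_rpow_sq (s : ℕ) (θ : ℝ) {I : Finset ℕ+} {x : Seq} (hx : proj I x = x) :
    ‖trunc (fun n => ((n : ℕ) : ℝ) ^ θ) I x‖ₑ ^ 2 = normSq (s + θ) (coefs s x) := by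
  rw [Seq.enorm_sq, normSq_coefs_add]
  refine tsum_congr fun n => ?_
  congr 1
  rw [trunc_apply, enorm_mul]
  have hx : proj I x n = x n := by rw [hx]
  rw [proj_apply] at hx
  split_ifs with h
  · rw [wt_pnat, ← ofReal_norm, Complex.norm_real, Real.norm_of_nonneg (by positivity),
      ← ENNReal.ofReal_natCast, ENNReal.ofReal_rpow_of_pos (by simp)]
  · rw [if_neg h] at hx
    simp [← hx]

theorem normSq_coefs_proj_le (s : ℕ) (θ : ℝ) (I : Finset ℕ+) (x : Seq) :
    normSq (s + θ) (coefs s (proj I x)) ≤ normSq (s + θ) (coefs s x) := by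
  rw [normSq_coefs_add, normSq_coefs_add]
  refine ENNReal.tsum_le_tsum fun n => ?_
  gcongr
  rw [proj_apply]
  split_ifs <;> simp

theorem enorm_sq_le_normSq (s : ℕ) {θ : ℝ} (hθ : 0 ≤ θ) (x : Seq) :
    ‖x‖ₑ ^ 2 ≤ normSq (s + θ) (coefs s x) := by
  rw [Seq.enorm_sq, normSq_coefs_add]
  refine ENNReal.tsum_le_tsum fun n => ?_
  gcongr
  refine le_mul_of_one_le_left zero_le ?_
  rw [wt_pnat]
  simpa using ENNReal.rpow_le_rpow_of_exponent_le
    (by exact_mod_cast (one_le : 1 ≤ n) : (1 : ℝ≥0∞) ≤ (n : ℕ)) hθ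

/-- The frequencies `1, …, N + 1`. -/
def freqs (N : ℕ) : Finset ℕ+ := Finset.Icc 1 N.succPNat

theorem tendsto_freqs : Tendsto freqs atTop atTop := by
  refine tendsto_atTop_finset_of_monotone (fun a b h => ?_) fun n => ⟨n, ?_⟩
  · exact Finset.Icc_subset_Icc le_rfl (Nat.succPNat_le_succPNat.2 h)
  · rw [freqs, Finset.mem_Icc]
    refine ⟨one_le, ?_⟩
    rw [← PNat.coe_le_coe, Nat.succPNat_coe]
    omega

theorem norm_sub_proj_le (s : ℕ) {θ : ℝ} (hθ : 0 ≤ θ) (N : ℕ) {x : Seq} {K : ℝ} (hK : 0 ≤ K)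
    (hx : normSq (s + θ) (coefs s x) ≤ ENNReal.ofReal K ^ 2) :
    ‖x - proj (freqs N) x‖ ≤ ((N + 1 : ℕ) : ℝ) ^ (-θ) * K := by
  have h : ‖x - proj (freqs N) x‖ₑ ≤ ENNReal.ofReal (((N + 1 : ℕ) : ℝ) ^ (-θ)) * ENNReal.ofReal K := by
    refine enorm_le_of_sq_le ?_
    rw [mul_pow]
    refine le_trans ?_ (mul_le_mul' le_rfl hx)
    rw [Seq.enorm_sq, normSq_coefs_add, ← ENNReal.tsum_mul_left]
    refine ENNReal.tsum_le_tsum fun n => ?_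
    rw [← mul_pow]
    gcongr
    rw [lp.coeFn_sub, Pi.sub_apply, proj_apply]
    split_ifs with h
    · simp
    · rw [sub_zero, ← mul_assoc]
      refine le_mul_of_one_le_left zero_le ?_
      have h1 : N + 1 ≤ (n : ℕ) := by
        by_contra h2
        refine h ?_
        rw [freqs, Finset.mem_Icc]
        refine ⟨one_le, ?_⟩
        rw [← PNat.coe_le_coe, Nat.succPNat_coe]
        omega
      rw [wt_pnat, ← ENNReal.ofReal_natCast, ENNReal.ofReal_rpow_of_pos (by simp),
        ← ENNReal.ofReal_mul (by positivity), ENNReal.one_le_ofReal, Real.rpow_neg (by positivity),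
        ← div_eq_inv_mul, one_le_div (by positivity)]
      exact Real.rpow_le_rpow (by positivity) (by exact_mod_cast h1) hθ
  rw [← ENNReal.ofReal_mul (by positivity), ← ofReal_norm,
    ENNReal.ofReal_le_ofReal_iff (by positivity)] at h
  exact h

end Seq

/-! ### Galerkin flows: regularity, energy estimate, convergence. -/

namespace Params

variable (P : Params)

/-- The Galerkin flow. -/
noncomputable def gflow (I : Finset ℕ+) : ℝ → Seq → Seq := (P.tameField_galerkin I).flow

/-- The flow of the equation. -/
noncomputable def flow : ℝ → Seq → Seq := P.tameField.flow

theorem hasDerivAt_gflow (I : Finset ℕ+) (x : Seq) (t : ℝ) :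
    HasDerivAt (fun t => P.gflow I t x) (P.galerkin I (P.gflow I t x)) t :=
  (P.tameField_galerkin I).hasDerivAt_flow x t

theorem gflow_zero (I : Finset ℕ+) (x : Seq) : P.gflow I 0 x = x :=
  (P.tameField_galerkin I).flow_zero x

theorem galerkin_proj (I : Finset ℕ+) (x : Seq) :
    P.galerkin I (Seq.proj I x) = P.galerkin I x := by
  rw [galerkin, galerkin, Seq.proj_proj]

theorem proj_galerkin (I : Finset ℕ+) (x : Seq) :
    Seq.proj I (P.galerkin I x) = P.galerkin I x := by
  rw [galerkin, Seq.proj_proj]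

/-- The projected curve solves the same equation, so uniqueness applies. -/
theorem proj_gflow {I : Finset ℕ+} {x : Seq} (hx : Seq.proj I x = x) (t : ℝ) :
    Seq.proj I (P.gflow I t x) = P.gflow I t x := by
  have h : ∀ t, HasDerivAt (fun t => Seq.proj I (P.gflow I t x))
      (P.galerkin I (Seq.proj I (P.gflow I t x))) t := fun t => by
    rw [P.galerkin_proj, ← P.proj_galerkin]
    exact (Seq.proj I).hasFDerivAt.comp_hasDerivAt t (P.hasDerivAt_gflow I x t)
  have := (P.tameField_galerkin I).eq_flow h t
  simp only [P.gflow_zero, hx] at this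
  exact this

theorem rate_nonneg {σ e : ℝ} (he : 0 ≤ e) : 0 ≤ P.rate σ e := by
  unfold rate
  positivity

theorem energy_nonneg (x : Seq) : 0 ≤ P.energy x := sq_nonneg _

theorem normSq_field_le_rate {σ : ℝ} (hσ : 0 ≤ σ) (x : Seq) :
    normSq σ (coefs P.s (P.field x)) ≤
      ENNReal.ofReal (P.rate σ (P.energy x)) ^ 2 * normSq σ (coefs P.s x) := by
  rw [P.ofReal_rate]
  exact P.normSq_field_le hσ x

/-- Grönwall for the `H^(s+θ)` norm, with the rate frozen by the conserved energy. The constant does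
not depend on `I`. -/
theorem normSq_gflow_le {θ : ℝ} (hθ : 0 ≤ θ) {I : Finset ℕ+} {x : Seq} (hx : Seq.proj I x = x)
    (t : ℝ) : normSq (P.s + θ) (coefs P.s (P.gflow I t x)) ≤
      ENNReal.ofReal (Real.exp (P.rate (P.s + θ) (P.energy x) * |t|)) ^ 2 *
        normSq (P.s + θ) (coefs P.s x) := by
  set D := Seq.trunc (fun n => ((n : ℕ) : ℝ) ^ θ) I
  set k := P.rate (P.s + θ) (P.energy x)
  have hk : 0 ≤ k := P.rate_nonneg (P.energy_nonneg x)
  have hd : ∀ t, HasDerivAt (fun t => D (P.gflow I t x)) (D (P.galerkin I (P.gflow I t x))) t :=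
    fun t => D.hasFDerivAt.comp_hasDerivAt t (P.hasDerivAt_gflow I x t)
  have hb : ∀ t, ‖D (P.galerkin I (P.gflow I t x))‖ ≤ k * ‖D (P.gflow I t x)‖ + 0 := fun t => by
    have hv := P.proj_gflow hx t
    have hE : P.energy (P.gflow I t x) = P.energy x := (P.tameField_galerkin I).energy_flow t x
    have h1 : ‖D (P.galerkin I (P.gflow I t x))‖ₑ ≤ ENNReal.ofReal k * ‖D (P.gflow I t x)‖ₑ := by
      refine enorm_le_of_sq_le ?_
      rw [mul_pow, Seq.enorm_trunc_rpow_sq P.s θ hv, galerkin, Seq.trunc_proj, hv]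
      refine (Seq.enorm_trunc_rpow_sq_le P.s θ I _).trans ?_
      have := P.normSq_field_le_rate (σ := P.s + θ) (by positivity) (P.gflow I t x)
      rwa [hE] at this
    rwa [← ofReal_norm, ← ofReal_norm, ← ENNReal.ofReal_mul hk,
      ENNReal.ofReal_le_ofReal_iff (by positivity), ← add_zero (k * _)] at h1
  have h2 := norm_le_gronwallBound_abs (T := |t| + 1) (fun t _ => hd t) (fun t _ => hb t)
    (abs_lt.1 (lt_add_one _))
  simp only [P.gflow_zero] at h2
  rw [gronwallBound_ε0, mul_comm, ← ENNReal.ofReal_le_ofReal_iff (by positivity),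
    ENNReal.ofReal_mul (by positivity), ofReal_norm, ofReal_norm] at h2
  rw [← Seq.enorm_trunc_rpow_sq P.s θ hx, ← Seq.enorm_trunc_rpow_sq P.s θ (P.proj_gflow hx t),
    ← mul_pow]
  gcongr

/-- The quadratic form in the exponent of the Gaussian density. -/
noncomputable def weight (I : Finset ℕ+) (x : Seq) : ℝ :=
  ∑ n ∈ I, ((n : ℕ) : ℝ) ^ P.γ * ‖x n‖ ^ 2

/-- Adding `‖x‖²` changes the weight `n^γ` into `1 + n^γ`, the denominator in the field. -/
theorem norm_trunc_sqrt_sq (I : Finset ℕ+) {x : Seq} (hx : Seq.proj I x = x) :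
    ‖Seq.trunc (fun n => √(1 + ((n : ℕ) : ℝ) ^ P.γ)) I x‖ ^ 2 = ‖x‖ ^ 2 + P.weight I x := by
  have h : ‖x‖ ^ 2 = ∑ n ∈ I, ‖x n‖ ^ 2 := by
    have h := lp.norm_rpow_eq_tsum (p := 2) (by norm_num) x
    simp only [ENNReal.toReal_ofNat, Real.rpow_ofNat] at h
    rw [h, tsum_eq_sum (s := I) fun n hn => ?_]
    have hx : Seq.proj I x n = x n := by rw [hx]
    rw [Seq.proj_apply, if_neg hn] at hx
    simp [← hx]
  rw [Seq.norm_trunc_sq, h, weight, ← Finset.sum_add_distrib]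
  refine Finset.sum_congr rfl fun n _ => ?_
  rw [Real.sq_sqrt (by positivity)]
  ring

/-- The weight `1 + n^γ` cancels the denominator of the symbol exactly, leaving the polynomial
symbol `n^(2s+1)`. -/
theorem inner_trunc_galerkin {I : Finset ℕ+} {x : Seq} (hx : Seq.proj I x = x) :
    inner ℝ (Seq.trunc (fun n => √(1 + ((n : ℕ) : ℝ) ^ P.γ)) I x)
      (Seq.trunc (fun n => √(1 + ((n : ℕ) : ℝ) ^ P.γ)) I (P.galerkin I x)) =
    ∑' n : ℕ+, ((n : ℕ) : ℝ) ^ (2 * P.s + 1) * ((starRingEnd ℂ) (coefs P.s x n) *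
        conv (herm (coefs P.s x)) (herm (coefs P.s x)) (n : ℕ)).im := by
  rw [lp.inner_eq_tsum, galerkin, hx, Seq.trunc_proj]
  refine tsum_congr fun n => ?_
  have h1 : (0 : ℝ) < 1 + ((n : ℕ) : ℝ) ^ P.γ := by positivity
  rw [Seq.trunc_apply, Seq.trunc_apply]
  split_ifs with h
  · rw [inner_diag_sq_field, Real.sq_sqrt h1.le, div_self h1.ne', one_mul]
  · have hx : Seq.proj I x n = x n := by rw [hx]
    rw [Seq.proj_apply, if_neg h] at hx
    simp [coefs, ← hx]

/-- The energy estimate behind quasi-invariance. The derivative of `‖x‖² + weight` is the cubic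
form, bounded through the propagated `H^(s+θ)` norm; `C` is independent of `I`. -/
theorem exists_weight_gflow_le {θ : ℝ} (hθ : 1 / 6 < θ) (K : ℝ≥0) (T : ℝ) :
    ∃ C : ℝ, ∀ (I : Finset ℕ+) (x : Seq), Seq.proj I x = x → normSq (P.s + θ) (coefs P.s x) ≤ K →
      ∀ t, |t| ≤ T → P.weight I (P.gflow I t x) ≤ P.weight I x + C := by
  have hθ0 : 0 ≤ θ := by linarith
  obtain ⟨A, hA⟩ := ofReal_abs_tsum_pow_mul_im_conv_le P.one_le_s hθ0
  have hz : zetaConst θ ≠ ∞ := tsum_wt_ne_top (by linarith)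
  set k := P.rate (P.s + θ) (‖P.energyOp‖ ^ 2 * K)
  set M : ℝ≥0∞ := ENNReal.ofReal (Real.exp (k * (T + 1))) ^ 2 * K
  have hM : M ≠ ∞ := ENNReal.mul_ne_top (ENNReal.pow_ne_top ENNReal.ofReal_ne_top)
    ENNReal.coe_ne_top
  set B : ℝ≥0∞ := A * ((zetaConst θ + M) * M)
  have hB : B ≠ ∞ := ENNReal.mul_ne_top ENNReal.coe_ne_top
    (ENNReal.mul_ne_top (ENNReal.add_ne_top.2 ⟨hz, hM⟩) hM)
  -- `2 * B * T` integrates the derivative bound up to time `T`; `K` bounds the initial `‖x‖²`, and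
  -- the final one is dropped by sign.
  refine ⟨2 * B.toReal * T + K, fun I x hx hK t ht => ?_⟩
  have hT : 0 ≤ T := (abs_nonneg t).trans ht
  have hxK : ‖x‖ ^ 2 ≤ K := by
    have := (Seq.enorm_sq_le_normSq P.s hθ0 x).trans hK
    rwa [← ofReal_norm, ← ENNReal.ofReal_pow (norm_nonneg _), ← ENNReal.ofReal_coe_nnreal,
      ENNReal.ofReal_le_ofReal_iff K.coe_nonneg] at this
  have hE : P.energy x ≤ ‖P.energyOp‖ ^ 2 * K := by
    calc P.energy x ≤ (‖P.energyOp‖ * ‖x‖) ^ 2 :=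
          pow_le_pow_left₀ (norm_nonneg _) (P.energyOp.le_opNorm x) 2
      _ = ‖P.energyOp‖ ^ 2 * ‖x‖ ^ 2 := mul_pow _ _ _
      _ ≤ _ := by gcongr
  set D := Seq.trunc (fun n => √(1 + ((n : ℕ) : ℝ) ^ P.γ)) I
  have hd : ∀ t, HasDerivAt (fun t => ‖D (P.gflow I t x)‖ ^ 2 - ‖D x‖ ^ 2)
      (2 * inner ℝ (D (P.gflow I t x)) (D (P.galerkin I (P.gflow I t x)))) t := fun t =>
    ((D.hasFDerivAt.comp_hasDerivAt t (P.hasDerivAt_gflow I x t)).norm_sq).sub_const _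
  have hb : ∀ t ∈ Ioo (-(T + 1)) (T + 1),
      ‖2 * inner ℝ (D (P.gflow I t x)) (D (P.galerkin I (P.gflow I t x)))‖ ≤
        0 * ‖‖D (P.gflow I t x)‖ ^ 2 - ‖D x‖ ^ 2‖ + 2 * B.toReal := fun t ht => by
    have hv := P.proj_gflow hx t
    have hN : normSq (P.s + θ) (coefs P.s (P.gflow I t x)) ≤ M := by
      refine (P.normSq_gflow_le hθ0 hx t).trans ?_
      have h1 : P.rate (P.s + θ) (P.energy x) ≤ k := P.rate_mono _ hE
      have h2 := P.rate_nonneg (σ := P.s + θ) (P.energy_nonneg x)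
      have h3 : |t| ≤ T + 1 := (abs_lt.2 ht).le
      have h4 := h2.trans h1
      change _ ≤ ENNReal.ofReal (Real.exp (k * (T + 1))) ^ 2 * K
      gcongr
    rw [P.inner_trunc_galerkin hv, zero_mul, zero_add, norm_mul, Real.norm_ofNat]
    gcongr
    rw [Real.norm_eq_abs, ← ENNReal.ofReal_le_ofReal_iff ENNReal.toReal_nonneg,
      ENNReal.ofReal_toReal hB]
    have hfin : (coefs P.s (P.gflow I t x)).support.Finite := by
      rw [← hv]
      exact (Seq.finite_support_proj I _).subset fun n hn => right_ne_zero_of_mul hn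
    refine (hA _ hfin).trans ?_
    change _ ≤ A * ((zetaConst θ + M) * M)
    gcongr
  have h2 := norm_le_gronwallBound_abs (fun t _ => hd t) hb
    (abs_lt.1 (ht.trans_lt (lt_add_one T)))
  simp only [P.gflow_zero, sub_self, norm_zero] at h2
  simp only [gronwallBound_K0, zero_add, Real.norm_eq_abs] at h2
  have h3 := (le_abs_self _).trans h2
  rw [P.norm_trunc_sqrt_sq I (P.proj_gflow hx t), P.norm_trunc_sqrt_sq I hx] at h3
  have h4 : 2 * B.toReal * |t| ≤ 2 * B.toReal * T := by gcongr
  have h5 := sq_nonneg ‖P.gflow I t x‖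
  linarith

/-- The Galerkin curve solves the full equation up to the frequencies of `P.field (y N t)` cut off
by the projection. The uniform `H^(s+θ)` bound makes this error `O(N^(-θ))`, and Grönwall compares
the curves. -/
theorem tendsto_gflow {θ : ℝ} (hθ : 0 < θ) {x : Seq} (hx : normSq (P.s + θ) (coefs P.s x) ≠ ∞)
    (t : ℝ) : Tendsto (fun N => P.gflow (Seq.freqs N) t (Seq.proj (Seq.freqs N) x)) atTop
      (𝓝 (P.flow t x)) := by
  set T := |t| + 1
  set R := ‖x‖ * Real.exp (P.rate P.s (P.energy x) * T)
  obtain ⟨L, hL⟩ := P.lipschitzOnWith_field R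
  set k := P.rate (P.s + θ) (P.energy x)
  have hk : 0 ≤ k := P.rate_nonneg (P.energy_nonneg x)
  have hk' := P.rate_nonneg (σ := P.s) (P.energy_nonneg x)
  set A : ℝ≥0∞ := normSq (P.s + θ) (coefs P.s x)
  obtain ⟨a, ha0, ha⟩ : ∃ a : ℝ, 0 ≤ a ∧ A ≤ ENNReal.ofReal a ^ 2 := by
    refine ⟨√A.toReal, by positivity, ?_⟩
    rw [← ENNReal.ofReal_pow (by positivity), Real.sq_sqrt (by positivity),
      ENNReal.ofReal_toReal hx]
  set K : ℝ := k * (Real.exp (k * T) * a)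
  have hK : 0 ≤ K := by positivity
  set y : ℕ → ℝ → Seq := fun N t => P.gflow (Seq.freqs N) t (Seq.proj (Seq.freqs N) x)
  have hyp : ∀ N t, Seq.proj (Seq.freqs N) (y N t) = y N t := fun N t =>
    P.proj_gflow (Seq.proj_proj _ _) t
  have hyE : ∀ N t, P.energy (y N t) ≤ P.energy x := fun N t =>
    ((P.tameField_galerkin _).energy_flow t _).le.trans (P.energy_proj_le _ _)
  have hyR : ∀ N, ∀ t ∈ Ioo (-T) T, y N t ∈ closedBall 0 R := fun N t ht => by
    rw [mem_closedBall_zero_iff]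
    refine ((P.tameField_galerkin _).norm_flow_le t _).trans ?_
    have h1 := P.rate_nonneg (σ := P.s) (P.energy_nonneg (Seq.proj (Seq.freqs N) x))
    have h2 := P.rate_mono P.s (P.energy_proj_le (Seq.freqs N) x)
    have h3 : |t| ≤ T := (abs_lt.2 ht).le
    have h4 := Seq.norm_proj_le (Seq.freqs N) x
    change _ ≤ ‖x‖ * Real.exp (P.rate P.s (P.energy x) * T)
    gcongr
  have hfR : ∀ t ∈ Ioo (-T) T, P.flow t x ∈ closedBall 0 R := fun t ht => by
    rw [mem_closedBall_zero_iff]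
    refine (P.tameField.norm_flow_le t _).trans ?_
    have h3 : |t| ≤ T := (abs_lt.2 ht).le
    change _ ≤ ‖x‖ * Real.exp (P.rate P.s (P.energy x) * T)
    gcongr
  have hd : ∀ N t, HasDerivAt (fun t => y N t - P.flow t x)
      (P.galerkin (Seq.freqs N) (y N t) - P.field (P.flow t x)) t := fun N t =>
    (P.hasDerivAt_gflow _ _ t).sub (P.tameField.hasDerivAt_flow x t)
  have hb : ∀ N, ∀ t ∈ Ioo (-T) T, ‖P.galerkin (Seq.freqs N) (y N t) - P.field (P.flow t x)‖ ≤
      (L + 1 : ℝ) * ‖y N t - P.flow t x‖ + ((N + 1 : ℕ) : ℝ) ^ (-θ) * K := fun N t ht => by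
    have h1 := hL.norm_sub_le (hyR N t ht) (hfR t ht)
    have h2 : ‖P.field (y N t) - Seq.proj (Seq.freqs N) (P.field (y N t))‖ ≤
        ((N + 1 : ℕ) : ℝ) ^ (-θ) * K := by
      refine Seq.norm_sub_proj_le P.s hθ.le N hK ?_
      refine (P.normSq_field_le_rate (by positivity) _).trans ?_
      refine (mul_le_mul' le_rfl (P.normSq_gflow_le hθ.le (Seq.proj_proj _ _) t)).trans ?_
      rw [ENNReal.ofReal_mul hk, ENNReal.ofReal_mul (by positivity), mul_pow, mul_pow]
      have h3 : |t| ≤ T := (abs_lt.2 ht).le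
      have h4 := P.rate_mono (P.s + θ) (hyE N t)
      have h5 := P.rate_mono (P.s + θ) (P.energy_proj_le (Seq.freqs N) x)
      have h6 := (Seq.normSq_coefs_proj_le P.s θ (Seq.freqs N) x).trans ha
      gcongr
    rw [galerkin, hyp]
    calc _ = ‖(P.field (y N t) - P.field (P.flow t x)) -
          (P.field (y N t) - Seq.proj (Seq.freqs N) (P.field (y N t)))‖ := by
          congr 1
          abel
      _ ≤ _ := norm_sub_le _ _
      _ ≤ _ := by
        have := norm_nonneg (y N t - P.flow t x)
        linarith
  have hg : ∀ N, ‖y N t - P.flow t x‖ ≤ gronwallBound ‖Seq.proj (Seq.freqs N) x - x‖ (L + 1)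
      (((N + 1 : ℕ) : ℝ) ^ (-θ) * K) |t| := fun N => by
    have := norm_le_gronwallBound_abs (fun t _ => hd N t) (hb N) (abs_lt.1 (lt_add_one |t|))
    simpa only [y, P.gflow_zero, flow, TameField.flow_zero] using this
  rw [tendsto_iff_norm_sub_tendsto_zero]
  refine squeeze_zero (fun _ => norm_nonneg _) hg ?_
  have hL0 : (L + 1 : ℝ) ≠ 0 := by positivity
  simp only [gronwallBound_of_K_ne_0 hL0]
  have h1 : Tendsto (fun N => ‖Seq.proj (Seq.freqs N) x - x‖) atTop (𝓝 0) :=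
    tendsto_iff_norm_sub_tendsto_zero.1 ((Seq.tendsto_proj x).comp Seq.tendsto_freqs)
  have h2 : Tendsto (fun N : ℕ => ((N + 1 : ℕ) : ℝ) ^ (-θ)) atTop (𝓝 0) :=
    ((tendsto_rpow_neg_atTop hθ).comp tendsto_natCast_atTop_atTop).comp (tendsto_add_atTop_nat 1)
  have h3 := (h1.mul_const (Real.exp ((L + 1) * |t|))).add
    (((h2.mul_const K).div_const (L + 1 : ℝ)).mul_const (Real.exp ((L + 1) * |t|) - 1))
  simpa using h3

end Params

/-! ### Real coordinates and vanishing divergence of the Galerkin field. -/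

theorem conv_herm_single (s : ℕ) (n : ℕ+) (z : ℂ) (b : ℕ+ → ℂ) :
    conv (herm (coefs s (Pi.single n z))) (herm b) (n : ℕ) =
      (starRingEnd ℂ) (coefs s (Pi.single n z) n) * herm b (2 * (n : ℕ)) := by
  have hne : (-((n : ℕ) : ℤ)) ≠ (n : ℕ) := by
    have := n.pos
    omega
  have h0 : ∀ k : ℕ+, k ≠ n → coefs s (Pi.single n z) k = 0 := fun k hk => by
    simp [coefs, Pi.single_eq_of_ne hk]
  unfold conv
  rw [tsum_eq_sum (s := {((n : ℕ) : ℤ), -((n : ℕ) : ℤ)}) fun k hk => ?_]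
  -- Mode `n` meets the zero mean, so only mode `-n` survives, paired with frequency `2n`.
  · rw [Finset.sum_pair hne.symm, sub_self, herm_zero, mul_zero, zero_add, herm_neg_coe]
    congr 2
    ring
  · simp only [Finset.mem_insert, Finset.mem_singleton, not_or] at hk
    induction k using int_cases_pnat with
    | h0 => simp
    | h1 k =>
      rw [herm_coe, h0 k, zero_mul]
      rintro rfl
      exact hk.1 rfl
    | h2 k =>
      rw [herm_neg_coe, h0 k, map_zero, zero_mul]
      rintro rfl
      exact hk.2 rfl

/-- Real coordinates for the frequencies in `I`. -/
abbrev Coord (I : Finset ℕ+) : Type := I → ℝ × ℝ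

namespace Params

variable (P : Params)

/-- The standard deviation of the real and imaginary parts of the coordinates. -/
noncomputable def amp (n : ℕ+) : ℝ := (((n : ℕ) : ℝ) ^ (P.γ / 2))⁻¹ / √2

theorem amp_pos (n : ℕ+) : 0 < P.amp n := by
  have : (0 : ℝ) < (n : ℕ) := by simp
  unfold amp
  positivity

theorem rpow_mul_amp_sq (n : ℕ+) : ((n : ℕ) : ℝ) ^ P.γ * P.amp n ^ 2 = 1 / 2 := by
  have : (0 : ℝ) < (n : ℕ) := by simp
  have h : ((n : ℕ) : ℝ) ^ P.γ = (((n : ℕ) : ℝ) ^ (P.γ / 2)) ^ 2 := by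
    rw [← Real.rpow_natCast, ← Real.rpow_mul this.le]
    norm_num
  rw [h, amp, div_pow, inv_pow, Real.sq_sqrt (by norm_num)]
  field_simp

theorem memℓp_embed (I : Finset ℕ+) (y : Coord I) :
    Memℓp (fun n => if h : n ∈ I then
      (P.amp n : ℂ) * ((y ⟨n, h⟩).1 + Complex.I * (y ⟨n, h⟩).2) else 0) 2 := by
  refine memℓp_gen (summable_of_ne_finset_zero (s := I) fun n hn => ?_)
  rw [dif_neg hn]
  simp

/-- The functions with frequencies in `I`, in terms of their real coordinates. -/
noncomputable def embed (I : Finset ℕ+) : Coord I →L[ℝ] Seq :=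
  LinearMap.toContinuousLinearMap
    { toFun := fun y => ⟨_, P.memℓp_embed I y⟩
      map_add' := fun y y' => by
        ext n
        simp only [lp.coeFn_add, Pi.add_apply]
        split_ifs
        · simp
          ring
        · simp
      map_smul' := fun c y => by
        ext n
        simp only [lp.coeFn_smul, Pi.smul_apply]
        split_ifs
        · simp
          ring
        · simp }

theorem embed_apply {I : Finset ℕ+} (y : Coord I) (n : ℕ+) :
    P.embed I y n = if h : n ∈ I then
      (P.amp n : ℂ) * ((y ⟨n, h⟩).1 + Complex.I * (y ⟨n, h⟩).2) else 0 := rfl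

/-- The real coordinates of a function for the frequencies in `I`. -/
noncomputable def coord (I : Finset ℕ+) : Seq →L[ℝ] Coord I :=
  ContinuousLinearMap.pi fun n => (P.amp n)⁻¹ •
    ((Complex.reCLM ∘L lp.evalCLM ℝ (fun _ : ℕ+ => ℂ) 2 n).prod
      (Complex.imCLM ∘L lp.evalCLM ℝ (fun _ : ℕ+ => ℂ) 2 n))

theorem coord_apply {I : Finset ℕ+} (x : Seq) (n : I) :
    P.coord I x n = ((P.amp n)⁻¹ * (x n).re, (P.amp n)⁻¹ * (x n).im) := rfl

theorem coord_embed {I : Finset ℕ+} (y : Coord I) : P.coord I (P.embed I y) = y := by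
  ext n
  · have := P.amp_pos n
    rw [coord_apply, embed_apply, dif_pos n.2]
    simp [this.ne']
  · have := P.amp_pos n
    rw [coord_apply, embed_apply, dif_pos n.2]
    simp [this.ne']

theorem embed_coord {I : Finset ℕ+} (x : Seq) : P.embed I (P.coord I x) = Seq.proj I x := by
  refine lp.ext (funext fun n => ?_)
  rw [Seq.proj_apply, embed_apply]
  split_ifs with h
  · have : (P.amp n : ℂ) ≠ 0 := by exact_mod_cast (P.amp_pos n).ne'
    rw [coord_apply]
    push_cast
    conv_rhs => rw [← Complex.re_add_im (x n)]
    field_simp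
  · rfl

theorem proj_embed {I : Finset ℕ+} (y : Coord I) : Seq.proj I (P.embed I y) = P.embed I y := by
  rw [← P.embed_coord, P.coord_embed]

theorem coord_proj {I : Finset ℕ+} (x : Seq) : P.coord I (Seq.proj I x) = P.coord I x := by
  rw [← P.embed_coord, P.coord_embed]

theorem weight_embed {I : Finset ℕ+} (y : Coord I) :
    P.weight I (P.embed I y) = ∑ n, ((y n).1 ^ 2 + (y n).2 ^ 2) / 2 := by
  rw [weight, ← Finset.sum_coe_sort]
  refine Finset.sum_congr rfl fun n _ => ?_
  have h : ‖((y n).1 + Complex.I * (y n).2 : ℂ)‖ ^ 2 = (y n).1 ^ 2 + (y n).2 ^ 2 := by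
    rw [Complex.sq_norm, Complex.normSq_apply]
    simp
    ring
  rw [embed_apply, dif_pos n.2, norm_mul, Complex.norm_real, mul_pow, Real.norm_eq_abs, sq_abs,
    ← mul_assoc, P.rpow_mul_amp_sq, h]
  ring

/-- The Galerkin vector field in real coordinates. -/
noncomputable def coordField (I : Finset ℕ+) (y : Coord I) : Coord I :=
  P.coord I (P.field (P.embed I y))

theorem embed_coordField {I : Finset ℕ+} (y : Coord I) :
    P.embed I (P.coordField I y) = P.galerkin I (P.embed I y) := by
  rw [coordField, P.embed_coord, galerkin, P.proj_embed]

theorem tameField_coordField (I : Finset ℕ+) : TameField (P.coordField I)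
    (fun y => P.energy (P.embed I y)) (fun e => ‖P.coord I‖ * P.rate P.s e * ‖P.embed I‖) := by
  refine ⟨fun R => ?_, fun y => ?_, fun y => ?_⟩
  · rcases lt_or_ge R 0 with hR | hR
    · refine ⟨0, ?_⟩
      rw [closedBall_eq_empty.2 hR]
      exact lipschitzOnWith_empty _ _
    obtain ⟨L, hL⟩ := P.lipschitzOnWith_field (‖P.embed I‖ * R)
    refine ⟨_, (P.coord I).lipschitz.comp_lipschitzOnWith
      (hL.comp (P.embed I).lipschitz.lipschitzOnWith fun y hy => ?_)⟩
    rw [mem_closedBall_zero_iff] at hy ⊢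
    exact ((P.embed I).le_opNorm y).trans (by gcongr)
  · obtain ⟨E', h1, h2⟩ := (P.tameField_galerkin I).energy (P.embed I y)
    refine ⟨E' ∘L P.embed I, h1.comp y (P.embed I).hasFDerivAt, ?_⟩
    rw [ContinuousLinearMap.comp_apply, P.embed_coordField, h2]
  · have h0 := P.rate_nonneg (σ := P.s) (P.energy_nonneg (P.embed I y))
    calc ‖P.coordField I y‖ ≤ ‖P.coord I‖ * ‖P.field (P.embed I y)‖ := (P.coord I).le_opNorm _
      _ ≤ ‖P.coord I‖ * (P.rate P.s (P.energy (P.embed I y)) * (‖P.embed I‖ * ‖y‖)) := by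
        gcongr
        refine (P.norm_field_le _).trans ?_
        gcongr
        exact (P.embed I).le_opNorm y
      _ = _ := by ring

theorem isBounded_energy_embed_le (I : Finset ℕ+) (R : ℝ) :
    Bornology.IsBounded {y | P.energy (P.embed I y) ≤ R} := by
  -- On the frequencies in `I`, `D` inverts `energyOp`, so bounded energy bounds `y`.
  set D := Seq.trunc (fun n => ((n : ℕ) : ℝ) ^ P.s / √(1 + ((n : ℕ) : ℝ) ^ P.γ)) I
  have hD : ∀ x, D (P.energyOp x) = Seq.proj I x := fun x => lp.ext (funext fun n => by
    rw [Seq.trunc_apply, Seq.proj_apply, P.energyOp_apply]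
    split_ifs
    · have h1 : (√(1 + ((n : ℕ) : ℝ) ^ P.γ) : ℂ) ≠ 0 := by
        have : 0 < √(1 + ((n : ℕ) : ℝ) ^ P.γ) := by positivity
        exact_mod_cast this.ne'
      have h2 := mul_coefs P.s x n
      push_cast
      rw [← h2]
      field_simp
    · rw [zero_mul])
  refine isBounded_iff_forall_norm_le.2 ⟨‖P.coord I‖ * (‖D‖ * √R), fun y hy => ?_⟩
  have h1 : y = P.coord I (D (P.energyOp (P.embed I y))) := by
    rw [hD, P.proj_embed, P.coord_embed]
  have h2 : ‖P.energyOp (P.embed I y)‖ ≤ √R := Real.le_sqrt_of_sq_le hy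
  calc ‖y‖ = ‖P.coord I (D (P.energyOp (P.embed I y)))‖ := by rw [← h1]
    _ ≤ _ := (P.coord I).le_opNorm _
    _ ≤ ‖P.coord I‖ * (‖D‖ * ‖P.energyOp (P.embed I y)‖) := by
      gcongr
      exact D.le_opNorm _
    _ ≤ _ := by gcongr

theorem hasFDerivAt_coordField {I : Finset ℕ+} (y : Coord I) :
    HasFDerivAt (P.coordField I) (P.coord I ∘L (P.lamOp ∘L (ContinuousLinearMap.id ℝ Seq +
      (P.bilin (P.embed I y) + P.bilin.flip (P.embed I y)))) ∘L P.embed I) y :=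
  (P.coord I).hasFDerivAt.comp y ((P.hasFDerivAt_field _).comp y (P.embed I).hasFDerivAt)

/-- This is the diagonal block at mode `n` of the linearised field: a complex-linear part `λ z` and
an antilinear part. -/
theorem lamOp_bilin_single (x : Seq) (n : ℕ+) {h : Seq} {z : ℂ} (hz : (h : ℕ+ → ℂ) = Pi.single n z) :
    P.lamOp (h + (P.bilin x h + P.bilin h x)) n =
      P.lam n * (z + 2 * ((starRingEnd ℂ) z * herm (coefs P.s x) (2 * (n : ℕ)))) := by
  have h1 : P.bilin h x n = (starRingEnd ℂ) z * herm (coefs P.s x) (2 * (n : ℕ)) := by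
    have h2 : ((n : ℕ) : ℂ) ^ P.s ≠ 0 := pnat_pow_ne_zero P.s n
    rw [P.bilin_apply, prodCoord, hz, conv_herm_single, coefs, Pi.single_eq_same, map_mul,
      map_inv₀, map_pow, map_natCast]
    field_simp
  rw [P.bilin_comm x h, lamOp, Seq.diag_apply]
  congr 1
  rw [lp.coeFn_add, lp.coeFn_add, Pi.add_apply, Pi.add_apply, h1, hz, Pi.single_eq_same]
  ring

theorem embed_single {I : Finset ℕ+} (n : I) (a : ℝ × ℝ) :
    (P.embed I (Pi.single n a) : ℕ+ → ℂ) =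
      Pi.single (n : ℕ+) ((P.amp n : ℂ) * (a.1 + Complex.I * a.2)) := by
  ext m
  rw [embed_apply]
  by_cases h : m = n
  · subst h
    rw [dif_pos n.2, Pi.single_eq_same, Pi.single_eq_same]
  · rw [Pi.single_eq_of_ne h]
    split_ifs with h1
    · rw [Pi.single_eq_of_ne (fun h2 => h (congrArg Subtype.val h2))]
      simp
    · rfl

/-- The block at mode `n` has the form `z ↦ λ z + b conj z`. Antilinear maps of `ℂ` have real trace
zero, and multiplication by `λ` has real trace `2 Re λ = 0`. -/
theorem trace_fderiv_coordField {I : Finset ℕ+} (y : Coord I) :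
    LinearMap.trace ℝ (Coord I) (fderiv ℝ (P.coordField I) y) = 0 := by
  classical
  rw [(P.hasFDerivAt_coordField y).fderiv,
    LinearMap.trace_eq_matrix_trace ℝ (Pi.basis fun _ : I => Module.Basis.finTwoProd ℝ),
    Matrix.trace, Fintype.sum_sigma]
  refine Finset.sum_eq_zero fun n _ => ?_
  obtain ⟨c, hl⟩ : ∃ c : ℝ, P.lam n = (c : ℂ) * Complex.I := by
    refine ⟨-(((n : ℕ+) : ℕ) / (1 + (((n : ℕ+) : ℕ) : ℝ) ^ P.γ)), ?_⟩
    rw [lam]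
    push_cast
    ring
  simp only [Matrix.diag_apply, LinearMap.toMatrix_apply, Pi.basis_apply, Pi.basis_repr,
    Fin.sum_univ_two, Module.Basis.finTwoProd_zero, Module.Basis.finTwoProd_one,
    Module.Basis.coe_finTwoProd_repr, Matrix.cons_val_zero, Matrix.cons_val_one]
  change (P.coord I (P.lamOp (P.embed I _ + (P.bilin _ (P.embed I _) + P.bilin (P.embed I _) _))) n).1
    + (P.coord I (P.lamOp (P.embed I _ + (P.bilin _ (P.embed I _) +
      P.bilin (P.embed I _) _))) n).2 = 0
  rw [coord_apply, coord_apply, P.lamOp_bilin_single _ _ (P.embed_single n _),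
    P.lamOp_bilin_single _ _ (P.embed_single n _), hl]
  simp

/-- The conjugated Galerkin flow solves the coordinate ODE, to which Liouville's theorem applies
with the energy as coercive invariant. -/
theorem measurePreserving_coord_gflow (I : Finset ℕ+) (t : ℝ) :
    MeasurePreserving (fun y => P.coord I (P.gflow I t (P.embed I y)))
      (volume : Measure (Coord I)) volume := by
  have hT := P.tameField_coordField I
  have h : hT.flow t = fun y => P.coord I (P.gflow I t (P.embed I y)) := by
    ext1 y
    have h1 : ∀ t, HasDerivAt (fun t => P.coord I (P.gflow I t (P.embed I y)))
        (P.coordField I (P.coord I (P.gflow I t (P.embed I y)))) t := fun t => by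
      have h2 := P.proj_gflow (P.proj_embed y) t
      rw [coordField, P.embed_coord, h2]
      have h3 := (P.coord I).hasFDerivAt.comp_hasDerivAt t (P.hasDerivAt_gflow I (P.embed I y) t)
      rwa [galerkin, h2, P.coord_proj] at h3
    have h4 := hT.eq_flow h1 t
    simp only [P.gflow_zero, P.coord_embed] at h4
    exact h4.symm
  rw [← h]
  refine hT.measurePreserving_flow (fun R => ?_) ?_ ?_ (P.isBounded_energy_embed_le I)
    P.trace_fderiv_coordField t
  · obtain ⟨K, hK⟩ := P.rate_energy_le (‖P.embed I‖ * R)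
    refine ⟨‖P.coord I‖ * K * ‖P.embed I‖, fun y hy => ?_⟩
    have := hK (P.embed I y) (((P.embed I).le_opNorm y).trans (by gcongr))
    gcongr
  · exact (P.coord I).contDiff.comp (P.contDiff_field.comp (P.embed I).contDiff)
  · exact P.contDiff_energy.comp (P.embed I).contDiff

end Params

/-! ### The Gaussian measure on finitely many modes and its transport. -/

theorem pi_withDensity_ofReal {ι : Type*} [Fintype ι] {E : ι → Type*}
    [∀ i, MeasurableSpace (E i)] (μ : ∀ i, Measure (E i)) [∀ i, SigmaFinite (μ i)]
    {p : ∀ i, E i → ℝ} (h0 : ∀ i x, 0 ≤ p i x) (hp : ∀ i, Integrable (p i) (μ i)) :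
    Measure.pi (fun i => (μ i).withDensity fun x => ENNReal.ofReal (p i x)) =
      (Measure.pi μ).withDensity fun y => ENNReal.ofReal (∏ i, p i (y i)) := by
  have hfin : ∀ i, IsFiniteMeasure ((μ i).withDensity fun x => ENNReal.ofReal (p i x)) := fun i =>
    isFiniteMeasure_withDensity_ofReal (hp i).2
  refine Measure.pi_eq fun s hs => ?_
  rw [withDensity_apply _ (MeasurableSet.univ_pi hs), Measure.restrict_pi_pi,
    ← ofReal_integral_eq_lintegral_ofReal
      (Integrable.fintype_prod_dep fun i => (hp i).restrict)
      (ae_of_all _ fun y => Finset.prod_nonneg fun i _ => h0 i _),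
    integral_fintype_prod_eq_prod, ENNReal.ofReal_prod_of_nonneg fun i _ => integral_nonneg (h0 i)]
  refine Finset.prod_congr rfl fun i _ => ?_
  rw [withDensity_apply _ (hs i), ofReal_integral_eq_lintegral_ofReal (hp i).restrict
    (ae_of_all _ (h0 i))]

/-- The law of finitely many independent pairs of standard Gaussians. -/
noncomputable def coordGaussian (I : Finset ℕ+) : Measure (Coord I) :=
  Measure.pi fun _ => (gaussianReal 0 1).prod (gaussianReal 0 1)

theorem map_restrict_prob (I : Finset ℕ+) : prob.map I.restrict = coordGaussian I :=
  Measure.infinitePi_map_restrict _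

theorem exists_coordGaussian_eq (I : Finset ℕ+) : ∃ κ : ℝ, 0 ≤ κ ∧
    coordGaussian I = (volume : Measure (Coord I)).withDensity fun y =>
      ENNReal.ofReal (κ * Real.exp (-∑ n, ((y n).1 ^ 2 + (y n).2 ^ 2) / 2)) := by
  set p : ℝ × ℝ → ℝ := fun z => gaussianPDFReal 0 1 z.1 * gaussianPDFReal 0 1 z.2
  have hp : (gaussianReal 0 1).prod (gaussianReal 0 1) =
      (volume : Measure (ℝ × ℝ)).withDensity fun z => ENNReal.ofReal (p z) := by
    rw [gaussianReal_of_var_ne_zero 0 one_ne_zero, prod_withDensity (measurable_gaussianPDF _ _)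
      (measurable_gaussianPDF _ _)]
    refine congrArg _ (funext fun z => ?_)
    rw [gaussianPDF, gaussianPDF, ← ENNReal.ofReal_mul (gaussianPDFReal_nonneg _ _ _)]
  have hi : Integrable p :=
    (integrable_gaussianPDFReal 0 1).mul_prod (integrable_gaussianPDFReal 0 1)
  refine ⟨∏ _n : I, (√(2 * Real.pi))⁻¹ ^ 2, by positivity, ?_⟩
  rw [coordGaussian, hp, pi_withDensity_ofReal (fun _ => volume) (fun _ z => mul_nonneg
    (gaussianPDFReal_nonneg _ _ _) (gaussianPDFReal_nonneg _ _ _)) fun _ => hi]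
  refine congrArg _ (funext fun y => congrArg _ ?_)
  rw [← Finset.sum_neg_distrib, Real.exp_sum, ← Finset.prod_mul_distrib]
  refine Finset.prod_congr rfl fun n _ => ?_
  have h : Real.exp (-(((y n).1 ^ 2 + (y n).2 ^ 2) / 2)) =
      Real.exp (-(y n).1 ^ 2 / 2) * Real.exp (-(y n).2 ^ 2 / 2) := by
    rw [← Real.exp_add]
    ring_nf
  simp only [gaussianPDFReal, NNReal.coe_one, mul_one, sub_zero]
  rw [h]
  ring

namespace Params

variable (P : Params)

/-- The density of the image of the Gaussian measure under the Galerkin flow at time `t`. -/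
noncomputable def density (I : Finset ℕ+) (t : ℝ) (y : Coord I) : ℝ≥0∞ :=
  ENNReal.ofReal (Real.exp (P.weight I (P.embed I y) -
    P.weight I (P.gflow I (-t) (P.embed I y))))

theorem continuous_gflow (I : Finset ℕ+) (t : ℝ) : Continuous (P.gflow I t) :=
  (P.tameField_galerkin I).continuous_flow P.rate_energy_le t

theorem continuous_flow (t : ℝ) : Continuous (P.flow t) :=
  P.tameField.continuous_flow P.rate_energy_le t

theorem continuous_weight (I : Finset ℕ+) : Continuous (P.weight I) := by
  unfold weight
  refine continuous_finsetSum _ fun n _ => continuous_const.mul (Continuous.pow ?_ 2)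
  exact (lp.evalCLM ℝ (fun _ : ℕ+ => ℂ) 2 n).continuous.norm

theorem continuous_density (I : Finset ℕ+) (t : ℝ) : Continuous (P.density I t) := by
  have h1 := P.continuous_weight I
  have h2 := P.continuous_gflow I (-t)
  unfold density
  refine ENNReal.continuous_ofReal.comp (Real.continuous_exp.comp ?_)
  fun_prop

/-- With `ρ` the Gaussian density, Lebesgue invariance turns `∫ g(φ t y) ρ(y)` into `∫ g(y) ρ(φ (-t)
y)`, and `ρ (φ (-t) y) / ρ y` is `density`. -/
theorem lintegral_gflow_embed {I : Finset ℕ+} (t : ℝ) {g : Seq → ℝ≥0∞} (hg : Continuous g) :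
    ∫⁻ y, g (P.gflow I t (P.embed I y)) ∂coordGaussian I =
      ∫⁻ y, g (P.embed I y) * P.density I t y ∂coordGaussian I := by
  obtain ⟨κ, hκ, h⟩ := exists_coordGaussian_eq I
  set φ : ℝ → Coord I → Coord I := fun t y => P.coord I (P.gflow I t (P.embed I y))
  have hφ : ∀ t y, P.embed I (φ t y) = P.gflow I t (P.embed I y) := fun t y => by
    rw [P.embed_coord, P.proj_gflow (P.proj_embed y)]
  have hφφ : ∀ y, φ (-t) (φ t y) = y := fun y => by
    have h1 : P.gflow I (-t) (P.gflow I t (P.embed I y)) = P.embed I y :=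
      (P.tameField_galerkin I).flow_neg_flow t _
    change P.coord I (P.gflow I (-t) (P.embed I (φ t y))) = y
    rw [hφ, h1, P.coord_embed]
  set ρ : Coord I → ℝ≥0∞ := fun y => ENNReal.ofReal (κ * Real.exp (-P.weight I (P.embed I y)))
  have hρ : coordGaussian I = (volume : Measure (Coord I)).withDensity ρ := by
    rw [h]
    simp only [ρ, P.weight_embed]
  have hρc : Continuous ρ := by
    have := P.continuous_weight I
    refine ENNReal.continuous_ofReal.comp (continuous_const.mul (Real.continuous_exp.comp ?_))
    fun_prop
  have hgc : ∀ t, Continuous fun y => g (P.gflow I t (P.embed I y)) := fun t =>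
    hg.comp ((P.continuous_gflow I t).comp (P.embed I).continuous)
  have hρφ : ∀ y, ρ (φ (-t) y) = ρ y * P.density I t y := fun y => by
    simp only [ρ, density, hφ]
    rw [← ENNReal.ofReal_mul (by positivity), mul_assoc, ← Real.exp_add]
    ring_nf
  have hφc : ∀ t, Continuous (φ t) := fun t =>
    (P.coord I).continuous.comp ((P.continuous_gflow I t).comp (P.embed I).continuous)
  have hgm : Measurable fun y => g (P.embed I y) := (hg.comp (P.embed I).continuous).measurable
  rw [hρ, lintegral_withDensity_eq_lintegral_mul _ hρc.measurable (hgc t).measurable,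
    lintegral_withDensity_eq_lintegral_mul _ hρc.measurable
      (g := fun y => g (P.embed I y) * P.density I t y) (hgm.mul (P.continuous_density I t).measurable)]
  have h2 := (P.measurePreserving_coord_gflow I t).lintegral_comp
    (f := fun y => ρ (φ (-t) y) * g (P.embed I y))
    ((hρc.comp (hφc (-t))).measurable.mul hgm)
  calc _ = ∫⁻ y, ρ (φ (-t) (φ t y)) * g (P.embed I (φ t y)) := by
        refine lintegral_congr fun y => ?_
        rw [hφφ, hφ]
        rfl
    _ = _ := h2
    _ = _ := by
        refine lintegral_congr fun y => ?_
        simp only [hρφ, Pi.mul_apply]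
        ring

end Params

noncomputable instance : MeasurableSpace Seq := borel Seq

instance : BorelSpace Seq := ⟨rfl⟩

/-- A finite measure which is smaller than another one on continuous functions is smaller. -/
theorem measure_le_of_forall_lintegral_le {X : Type*} [PseudoEMetricSpace X] [MeasurableSpace X]
    [BorelSpace X] {μ ν : Measure X} [IsFiniteMeasure μ] [IsFiniteMeasure ν]
    (h : ∀ g : X → ℝ≥0∞, Continuous g → (∀ x, g x ≤ 1) → ∫⁻ x, g x ∂μ ≤ ∫⁻ x, g x ∂ν)
    {A : Set X} (hA : MeasurableSet A) : μ A ≤ ν A := by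
  -- Closed sets are limits of continuous thickened indicators; inner regularity by closed sets then
  -- covers all measurable sets.
  have hC : ∀ C, IsClosed C → μ C ≤ ν C := by
    intro C hC
    have hpos : ∀ n : ℕ, (0 : ℝ) < 1 / (n + 1) := fun n => Nat.one_div_pos_of_nat
    refine ge_of_tendsto' (tendsto_lintegral_thickenedIndicator_of_isClosed ν hC hpos
      tendsto_one_div_add_atTop_nhds_zero_nat) fun n => ?_
    refine (measure_le_lintegral_thickenedIndicator μ hC.measurableSet (hpos n)).trans (h _ ?_ ?_)
    · exact ENNReal.continuous_coe.comp (thickenedIndicator (hpos n) C).continuous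
    · intro x
      exact_mod_cast thickenedIndicator_le_one (hpos n) C x
  rw [hA.measure_eq_iSup_isClosed_of_ne_top (measure_ne_top μ A)]
  exact iSup₂_le fun C hCA => iSup_le fun h => (hC C h).trans (measure_mono hCA)

/-! ### The random series and quasi-invariance on `ℓ²`. -/

namespace Params

variable (P : Params)

/-- The coordinates of the random Fourier series. -/
noncomputable def draw (ω : Sample) (n : ℕ+) : ℂ :=
  (P.amp n : ℂ) * ((ω n).1 + Complex.I * (ω n).2)

open Classical in
/-- The random Fourier series in coordinates. -/
noncomputable def sample (ω : Sample) : Seq :=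
  if h : Memℓp (P.draw ω) 2 then ⟨P.draw ω, h⟩ else 0

theorem sample_apply {ω : Sample} (h : Memℓp (P.draw ω) 2) (n : ℕ+) :
    P.sample ω n = P.draw ω n := by
  rw [sample, dif_pos h]

theorem proj_sample {ω : Sample} (h : Memℓp (P.draw ω) 2) (I : Finset ℕ+) :
    Seq.proj I (P.sample ω) = P.embed I (I.restrict ω) :=
  lp.ext (funext fun n => by
    rw [Seq.proj_apply, P.embed_apply, P.sample_apply h]
    rfl)

theorem exists_lintegral_enorm_sq_draw : ∃ M : ℝ≥0∞, M ≠ ∞ ∧ ∀ n,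
    ∫⁻ ω, ‖P.draw ω n‖ₑ ^ 2 ∂prob ≤ wt (-P.γ) (n : ℕ) * M := by
  set q : ℝ × ℝ → ℝ := fun z => z.1 ^ 2 + z.2 ^ 2
  have hq : Integrable q ((gaussianReal 0 1).prod (gaussianReal 0 1)) := by
    have h : Integrable (fun x : ℝ => x ^ 2) (gaussianReal 0 1) :=
      (memLp_id_gaussianReal 2).integrable_sq
    exact (h.comp_fst _).add (h.comp_snd _)
  refine ⟨∫⁻ z, ENNReal.ofReal (q z) ∂(gaussianReal 0 1).prod (gaussianReal 0 1),
    hq.lintegral_lt_top.ne, fun n => ?_⟩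
  have h1 : ∀ ω, ‖P.draw ω n‖ₑ ^ 2 ≤ wt (-P.γ) (n : ℕ) * ENNReal.ofReal (q (ω n)) := fun ω => by
    have h3 : (0 : ℝ) < (n : ℕ) := by simp
    rw [wt_pnat, ← ENNReal.ofReal_natCast, ENNReal.ofReal_rpow_of_pos h3,
      ← ENNReal.ofReal_mul (by positivity), ← ofReal_norm, ← ENNReal.ofReal_pow (norm_nonneg _)]
    refine ENNReal.ofReal_le_ofReal ?_
    have h4 : ‖((ω n).1 + Complex.I * (ω n).2 : ℂ)‖ ^ 2 = q (ω n) := by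
      rw [Complex.sq_norm, Complex.normSq_apply]
      simp [q]
      ring
    have h5 := P.rpow_mul_amp_sq n
    have h6 : P.amp n ^ 2 ≤ ((n : ℕ) : ℝ) ^ (-P.γ) := by
      rw [Real.rpow_neg h3.le, ← one_div, le_div_iff₀ (by positivity), mul_comm, h5]
      norm_num
    rw [draw, norm_mul, mul_pow, h4, Complex.norm_real, Real.norm_eq_abs, sq_abs]
    have h7 : 0 ≤ q (ω n) := by positivity
    gcongr
  refine (lintegral_mono h1).trans ?_
  have hqm : Measurable fun z => ENNReal.ofReal (q z) := by fun_prop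
  have hqn : Measurable fun ω : Sample => ENNReal.ofReal (q (ω n)) :=
    hqm.comp (measurable_pi_apply n)
  rw [lintegral_const_mul _ hqn]
  refine mul_le_mul' le_rfl (le_of_eq ?_)
  exact (measurePreserving_eval_infinitePi (fun _ : ℕ+ => (gaussianReal 0 1).prod (gaussianReal 0 1))
    n).lintegral_comp hqm

theorem measurable_draw (n : ℕ+) : Measurable fun ω => P.draw ω n := by
  unfold draw
  fun_prop

/-- The expectation of the sum is at most a multiple of `∑ n^(2θ - γ)`, which converges since `2θ <
γ - 1`. -/
theorem ae_tsum_draw {θ : ℝ} (hθ : θ < (P.γ - 1) / 2) :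
    ∀ᵐ ω ∂prob, ∑' n : ℕ+, (wt θ (n : ℕ) * ‖P.draw ω n‖ₑ) ^ 2 < ∞ := by
  have hm : ∀ n : ℕ+, Measurable fun ω => (wt θ (n : ℕ) * ‖P.draw ω n‖ₑ) ^ 2 := fun n =>
    ((P.measurable_draw n).enorm.const_mul _).pow_const 2
  refine ae_lt_top (Measurable.tsum hm) ?_
  obtain ⟨M, hM, h⟩ := P.exists_lintegral_enorm_sq_draw
  rw [lintegral_tsum fun n => (hm n).aemeasurable]
  refine ne_top_of_le_ne_top (ENNReal.mul_ne_top (tsum_wt_ne_top (σ := 2 * θ - P.γ) (by linarith))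
    hM) ?_
  rw [← ENNReal.tsum_mul_right]
  refine ENNReal.tsum_le_tsum fun n => ?_
  simp only [mul_pow]
  rw [lintegral_const_mul _ ((P.measurable_draw n).enorm.pow_const 2)]
  refine (mul_le_mul' le_rfl (h n)).trans (le_of_eq ?_)
  rw [← mul_assoc, sq, ← wt_add, ← wt_add]
  ring_nf

theorem ae_memℓp_draw {θ : ℝ} (hθ0 : 0 ≤ θ) (hθ : θ < (P.γ - 1) / 2) :
    ∀ᵐ ω ∂prob, Memℓp (P.draw ω) 2 ∧ normSq (P.s + θ) (coefs P.s (P.sample ω)) ≠ ∞ := by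
  filter_upwards [P.ae_tsum_draw hθ] with ω hω
  have h : Memℓp (P.draw ω) 2 := by
    refine memℓp_two_of_tsum_enorm (ne_top_of_le_ne_top hω.ne (ENNReal.tsum_le_tsum fun n => ?_))
    gcongr
    refine le_mul_of_one_le_left zero_le ?_
    rw [wt_pnat]
    simpa using ENNReal.rpow_le_rpow_of_exponent_le
      (by exact_mod_cast (one_le : 1 ≤ n) : (1 : ℝ≥0∞) ≤ (n : ℕ)) hθ0
  refine ⟨h, ?_⟩
  rw [normSq_coefs_add]
  simp only [P.sample_apply h]
  exact hω.ne

theorem ae_memℓp : ∀ᵐ ω ∂prob, Memℓp (P.draw ω) 2 :=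
  (P.ae_memℓp_draw le_rfl (by linarith [P.hγ])).mono fun _ h => h.1

instance : IsProbabilityMeasure prob := by
  unfold prob
  infer_instance

theorem measurable_embed_restrict (I : Finset ℕ+) :
    Measurable fun ω : Sample => P.embed I (I.restrict ω) :=
  (P.embed I).continuous.measurable.comp (Finset.measurable_restrict I)

/-- The sample is almost surely the limit of its finite projections, which are measurable. -/
theorem aemeasurable_sample : AEMeasurable P.sample prob := by
  refine aemeasurable_of_tendsto_metrizable_ae atTop
    (fun N => (P.measurable_embed_restrict (Seq.freqs N)).aemeasurable) ?_
  filter_upwards [P.ae_memℓp] with ω hω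
  simp only [← P.proj_sample hω]
  exact (Seq.tendsto_proj _).comp Seq.tendsto_freqs

/-- The limit of the finite-dimensional change of variables. Only an inequality survives, because
the densities are passed to the limit by Fatou; positivity of `f` is what makes it useful. -/
theorem exists_lintegral_le (t : ℝ) : ∃ f : Sample → ℝ≥0∞, Measurable f ∧
    (∀ᵐ ω ∂prob, 0 < f ω) ∧ ∀ g : Seq → ℝ≥0∞, Continuous g → (∀ x, g x ≤ 1) →
      ∫⁻ ω, g (P.sample ω) * f ω ∂prob ≤ ∫⁻ ω, g (P.flow t (P.sample ω)) ∂prob := by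
  -- Nonemptiness of this interval is exactly the condition `γ > 4/3`.
  obtain ⟨θ, hθ1, hθ2⟩ : ∃ θ, 1 / 6 < θ ∧ θ < (P.γ - 1) / 2 :=
    exists_between (by linarith [P.hγ])
  have hθ0 : 0 < θ := by linarith
  have hgood := P.ae_memℓp_draw hθ0.le hθ2
  have hr : ∀ N, Measurable ((Seq.freqs N).restrict : Sample → Coord (Seq.freqs N)) := fun N =>
    Finset.measurable_restrict _
  have hdm : ∀ N, Measurable fun ω : Sample =>
      P.density (Seq.freqs N) t ((Seq.freqs N).restrict ω) := fun N =>
    (P.continuous_density _ t).measurable.comp (hr N)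
  refine ⟨fun ω => liminf (fun N => P.density (Seq.freqs N) t ((Seq.freqs N).restrict ω)) atTop,
    Measurable.liminf hdm, ?_, fun g hg hg1 => ?_⟩
  · filter_upwards [hgood] with ω ⟨h, hK⟩
    -- For a fixed sample, `C` depends only on its `H^(s+θ)` norm and on `|t|`, so every truncated
    -- density is at least `exp (-C)`.
    obtain ⟨C, hC⟩ := P.exists_weight_gflow_le hθ1
      (normSq (P.s + θ) (coefs P.s (P.sample ω))).toNNReal |t|
    refine (ENNReal.ofReal_pos.2 (Real.exp_pos (-C))).trans_le
      (le_liminf_of_le (by isBoundedDefault) (Eventually.of_forall fun N => ?_))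
    rw [density, ← P.proj_sample h]
    refine ENNReal.ofReal_le_ofReal (Real.exp_le_exp.2 ?_)
    have := hC (Seq.freqs N) _ (Seq.proj_proj _ (P.sample ω)) (by
      rw [ENNReal.coe_toNNReal hK]
      exact Seq.normSq_coefs_proj_le _ _ _ _) (-t) (abs_neg t).le
    linarith
  · have hgm := hg.measurable
    have h1 : Tendsto (fun N => ∫⁻ ω, g (P.gflow (Seq.freqs N) t
        (P.embed _ ((Seq.freqs N).restrict ω))) ∂prob) atTop
        (𝓝 (∫⁻ ω, g (P.flow t (P.sample ω)) ∂prob)) := by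
      refine tendsto_lintegral_of_dominated_convergence (fun _ => 1) (fun N => ?_)
        (fun N => ae_of_all _ fun ω => hg1 _) (by simp) ?_
      · exact hgm.comp ((P.continuous_gflow _ t).measurable.comp (P.measurable_embed_restrict _))
      · filter_upwards [hgood] with ω ⟨h, hK⟩
        simp only [← P.proj_sample h]
        exact (hg.tendsto _).comp (P.tendsto_gflow hθ0 hK t)
    have h2 : ∀ N, ∫⁻ ω, g (P.gflow (Seq.freqs N) t
        (P.embed _ ((Seq.freqs N).restrict ω))) ∂prob =
        ∫⁻ ω, g (P.embed _ ((Seq.freqs N).restrict ω)) *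
          P.density (Seq.freqs N) t ((Seq.freqs N).restrict ω) ∂prob := fun N => by
      have h3 := P.lintegral_gflow_embed (I := Seq.freqs N) t hg
      have hc := (P.embed (Seq.freqs N)).continuous
      have hm1 : Measurable fun y => g (P.gflow (Seq.freqs N) t (P.embed _ y)) :=
        hgm.comp ((P.continuous_gflow _ t).measurable.comp hc.measurable)
      have hm2 : Measurable fun y => g (P.embed _ y) * P.density (Seq.freqs N) t y :=
        (hgm.comp hc.measurable).mul (P.continuous_density _ t).measurable
      rw [← map_restrict_prob, lintegral_map hm1 (hr N), lintegral_map hm2 (hr N)] at h3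
      exact h3
    rw [← h1.liminf_eq]
    simp only [h2]
    refine le_trans (lintegral_mono_ae ?_) (lintegral_liminf_le fun N =>
      (hgm.comp (P.measurable_embed_restrict _)).mul (hdm N))
    filter_upwards [hgood] with ω ⟨h, hK⟩
    have h4 : Tendsto (fun N => g (P.embed _ ((Seq.freqs N).restrict ω))) atTop
        (𝓝 (g (P.sample ω))) := by
      simp only [← P.proj_sample h]
      exact (hg.tendsto _).comp ((Seq.tendsto_proj _).comp Seq.tendsto_freqs)
    rw [← h4.liminf_eq]
    exact ENNReal.le_liminf_mul

/-- The law of the sample under `f · prob` is dominated by the image of the Gaussian law. A null set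
for the image thus has `f`-weight zero, and `f > 0` almost surely. -/
theorem measure_preimage_eq_zero (t : ℝ) {A : Set Seq} (hA : MeasurableSet A)
    (h : prob.map P.sample (P.flow t ⁻¹' A) = 0) : prob.map P.sample A = 0 := by
  obtain ⟨f, hf, hpos, hle⟩ := P.exists_lintegral_le t
  have hfin : ∫⁻ ω, f ω ∂prob ≠ ∞ := by
    have := hle (fun _ => 1) continuous_const fun _ => le_rfl
    simp only [one_mul, lintegral_one, measure_univ] at this
    exact ne_top_of_le_ne_top ENNReal.one_ne_top this
  have hs := P.aemeasurable_sample
  have hs' : AEMeasurable P.sample (prob.withDensity f) :=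
    hs.mono_ac (withDensity_absolutelyContinuous _ _)
  have hfl : Measurable (P.flow t) := (P.continuous_flow t).measurable
  have := isFiniteMeasure_withDensity hfin
  have h1 : (prob.withDensity f).map P.sample A ≤ (prob.map P.sample).map (P.flow t) A := by
    refine measure_le_of_forall_lintegral_le (fun g hg hg1 => ?_) hA
    have hgf : Measurable fun x => g (P.flow t x) := hg.measurable.comp hfl
    rw [lintegral_map' hg.measurable.aemeasurable hs', lintegral_map hg.measurable hfl,
      lintegral_map' hgf.aemeasurable hs, lintegral_withDensity_eq_lintegral_mul₀ hf.aemeasurable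
        (g := fun ω => g (P.sample ω)) (hg.measurable.comp_aemeasurable hs)]
    refine le_trans (le_of_eq (lintegral_congr fun ω => ?_)) (hle g hg hg1)
    exact mul_comm _ _
  rw [Measure.map_apply hfl hA, h, Measure.map_apply_of_aemeasurable hs' hA] at h1
  rw [Measure.map_apply_of_aemeasurable hs hA]
  have h2 := (withDensity_apply_eq_zero' hf.aemeasurable).1 (le_antisymm h1 zero_le)
  refine measure_mono_null_ae ?_ h2
  filter_upwards [hpos] with ω hω h3
  exact ⟨hω.ne', h3⟩

/-- The previous lemma gives the opposite absolute continuity; it is used at time `-t` for the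
preimage of `A`. -/
theorem quasiMeasurePreserving_flow (t : ℝ) :
    Measure.QuasiMeasurePreserving (P.flow t) (prob.map P.sample) (prob.map P.sample) := by
  refine ⟨(P.continuous_flow t).measurable, Measure.AbsolutelyContinuous.mk fun A hA h => ?_⟩
  have hfl : ∀ t, Measurable (P.flow t) := fun t => (P.continuous_flow t).measurable
  rw [Measure.map_apply (hfl t) hA]
  refine P.measure_preimage_eq_zero (-t) (hfl t hA) ?_
  rw [← preimage_comp]
  have : P.flow t ∘ P.flow (-t) = id := funext fun x => P.tameField.flow_flow_neg t x
  rwa [this, preimage_id]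

end Params

/-! ### Transfer from `ℓ²` to the Sobolev space. -/

theorem norm_coefs_le (s : ℕ) (x : ℕ+ → ℂ) (n : ℕ+) :
    ((n : ℕ) : ℝ) ^ s * ‖coefs s x n‖ = ‖x n‖ := by
  rw [← mul_coefs s x n, norm_mul, norm_pow, Complex.norm_natCast]

theorem summable_sobolev_herm (s : ℕ) (x : Seq) :
    Summable fun n : ℤ => (1 + |(n : ℝ)|) ^ (2 * s) * ‖herm (coefs s x) n‖ ^ 2 := by
  set f : ℤ → ℝ := fun n => (1 + |(n : ℝ)|) ^ (2 * s) * ‖herm (coefs s x) n‖ ^ 2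
  have hf0 : ∀ n, 0 ≤ f n := fun n => by positivity
  have h : ∑' n, ENNReal.ofReal (f n) ≠ ∞ := by
    rw [tsum_int_eq_two_mul (by simp [f]) fun n => by simp [f, herm_neg]]
    refine ENNReal.mul_ne_top ENNReal.ofNat_ne_top (ne_top_of_le_ne_top (b := 4 ^ s * ‖x‖ₑ ^ 2)
      (ENNReal.mul_ne_top (by simp) (ENNReal.pow_ne_top enorm_ne_top)) ?_)
    rw [Seq.enorm_sq, ← ENNReal.tsum_mul_left]
    refine ENNReal.tsum_le_tsum fun n => ?_
    rw [← ofReal_norm, ← ENNReal.ofReal_pow (norm_nonneg _),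
      show (4 : ℝ≥0∞) ^ s = ENNReal.ofReal (4 ^ s) by simp [ENNReal.ofReal_pow],
      ← ENNReal.ofReal_mul (by positivity)]
    refine ENNReal.ofReal_le_ofReal ?_
    have h1 : (1 : ℝ) ≤ (n : ℕ) := by exact_mod_cast (one_le : 1 ≤ n)
    simp only [f, herm_coe]
    rw [← norm_coefs_le s x n, mul_pow, ← mul_assoc, ← pow_mul, mul_comm s 2,
      show (4 : ℝ) ^ s = 2 ^ (2 * s) by rw [pow_mul]; norm_num, ← mul_pow]
    gcongr
    rw [Int.cast_natCast, Nat.abs_cast]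
    linarith
  have := ENNReal.summable_toReal h
  simpa only [ENNReal.toReal_ofReal (hf0 _)] using this

theorem fourierCoeff_conj (f : Torus → ℂ) (n : ℤ) :
    fourierCoeff (fun x => (starRingEnd ℂ) (f x)) n = (starRingEnd ℂ) (fourierCoeff f (-n)) := by
  unfold fourierCoeff
  rw [← integral_conj]
  congr 1
  ext x
  rw [smul_eq_mul, smul_eq_mul, map_mul, ← fourier_neg, neg_neg]

theorem fourierCoeff_mul_fourier (f : Torus → ℂ) (n k : ℤ) :
    fourierCoeff (fun x => f x * fourier n x) k = fourierCoeff f (k - n) := by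
  unfold fourierCoeff
  congr 1
  ext x
  change fourier (-k) x * (f x * fourier n x) = fourier (-(k - n)) x * f x
  rw [mul_comm (f x), ← mul_assoc, ← fourier_add]
  congr 2
  ring_nf

theorem memLp_coe (f : L2) :
    MemLp (fun x => ((f x : ℝ) : ℂ)) 2 (AddCircle.haarAddCircle : Measure Torus) :=
  (Lp.memLp f).ofReal

/-- The Fourier coefficients of the square of a real-valued function. -/
theorem coeff_sq (f : L2) (n : ℤ) :
    coeff (fun x => f x ^ 2) n = conv (coeff f) (coeff f) n := by
  have hB := memLp_coe f
  -- The `n`-th coefficient of `f²` is the inner product of `f e_n` with `f`; Parseval turns it into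
  -- a convolution.
  have hA : MemLp (fun x => ((f x : ℝ) : ℂ) * fourier n x) 2
      (AddCircle.haarAddCircle : Measure Torus) := by
    refine hB.of_le (hB.1.mul (map_continuous (fourier n)).aestronglyMeasurable)
      (ae_of_all _ fun x => ?_)
    rw [norm_mul, fourier_apply, Circle.norm_coe, mul_one]
  have hA' := hA.coeFn_toLp
  have hB' := hB.coeFn_toLp
  have h1 : inner ℂ (hA.toLp _) (hB.toLp _) = coeff (fun x => f x ^ 2) n := by
    rw [L2.inner_def, coeff, fourierCoeff]
    refine integral_congr_ae ?_
    filter_upwards [hA', hB'] with x h2 h3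
    rw [h2, h3, RCLike.inner_apply, map_mul, Complex.conj_ofReal, ← fourier_neg, smul_eq_mul]
    push_cast
    ring
  rw [← h1, ← fourierBasis.repr.inner_map_map, lp.inner_eq_tsum, conv]
  refine tsum_congr fun k => ?_
  rw [fourierBasis_repr, fourierBasis_repr, fourierCoeff_congr_ae hA', fourierCoeff_congr_ae hB',
    fourierCoeff_mul_fourier, RCLike.inner_apply]
  change coeff f k * (starRingEnd ℂ) (coeff f (k - n)) = _
  rw [← coeff_neg, neg_sub]

theorem coeff_toFun {s : ℕ} (f : H s) : coeff f.toFun = herm (coefs s (H.toLp s f)) := by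
  have hpos : ∀ n : ℕ+, coeff f.toFun n = coefs s (H.toLp s f) n := fun n =>
    (inv_mul_cancel_left₀ (pnat_pow_ne_zero s n) _).symm
  ext n
  induction n using int_cases_pnat with
  | h0 => exact f.2.1.trans (herm_zero _).symm
  | h1 n => rw [herm_coe, hpos]
  | h2 n => rw [herm_neg_coe, coeff_neg, hpos]

theorem H.toLp_surjective (s : ℕ) : Function.Surjective (H.toLp s) := by
  intro x
  have hsum := summable_sobolev_herm s x
  have hm : Memℓp (herm (coefs s x)) 2 := by
    refine memℓp_gen (Summable.of_nonneg_of_le (fun n => by positivity) (fun n => ?_) hsum)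
    simp only [ENNReal.toReal_ofNat, Real.rpow_ofNat]
    refine le_mul_of_one_le_left (by positivity) (one_le_pow₀ ?_)
    linarith [abs_nonneg (n : ℝ)]
  set F := (fourierBasis (T := 2 * Real.pi)).repr.symm (⟨_, hm⟩ : lp (fun _ : ℤ => ℂ) 2) with hF
  have hFc : ∀ n, fourierCoeff F n = herm (coefs s x) n := fun n => by
    rw [← fourierBasis_repr, hF, LinearIsometryEquiv.apply_symm_apply]
  -- Hermitian coefficients are unchanged by taking the real part, which gives a real-valued
  -- function without showing that `F` itself is real.
  have hre : MemLp (fun x => (F x).re) 2 (AddCircle.haarAddCircle : Measure Torus) :=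
    (Lp.memLp F).re
  have hFi : Integrable F (AddCircle.haarAddCircle : Measure Torus) :=
    (Lp.memLp F).integrable (by norm_num)
  have hco : ∀ n, coeff (hre.toLp _ : L2) n = herm (coefs s x) n := fun n => by
    rw [coeff_congr hre.coeFn_toLp, coeff]
    have h1 : (fun x => (((F x).re : ℝ) : ℂ)) =
        (1 / 2 : ℂ) • ((F : Torus → ℂ) + fun x => (starRingEnd ℂ) (F x)) := by
      ext x
      simp [Complex.add_conj]
    have hFi' : Integrable (fun x => (starRingEnd ℂ) (F x))
        (AddCircle.haarAddCircle : Measure Torus) :=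
      Complex.conjCLE.integrable_comp_iff.2 hFi
    rw [h1, fourierCoeff.const_smul, fourierCoeff.add hFi hFi', Pi.add_apply, fourierCoeff_conj,
      hFc, hFc, herm_neg, Complex.conj_conj, smul_eq_mul]
    ring
  refine ⟨⟨hre.toLp _, (hco 0).trans (herm_zero _), ?_⟩, lp.ext (funext fun n => ?_)⟩
  · simpa only [hco] using hsum
  · change ((n : ℕ) : ℂ) ^ s * coeff (hre.toLp _ : L2) n = x n
    rw [hco, herm_coe, mul_coefs]

/-- The Sobolev space in coordinates. -/
noncomputable def H.equiv (s : ℕ) : H s ≃+ Seq :=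
  AddEquiv.ofBijective (H.toLp s) ⟨H.toLp_injective s, H.toLp_surjective s⟩

theorem H.isometry_equiv (s : ℕ) : Isometry (H.equiv s) :=
  AddMonoidHomClass.isometry_of_norm _ fun _ => rfl

theorem H.continuous_equiv (s : ℕ) : Continuous (H.equiv s) := (H.isometry_equiv s).continuous

theorem H.continuous_equiv_symm (s : ℕ) : Continuous (H.equiv s).symm :=
  ((H.isometry_equiv s).right_inv (H.equiv s).apply_symm_apply).continuous

theorem coeff_eq_herm {s : ℕ} (f : H s) : coeff f.toFun = herm (coefs s (H.equiv s f)) :=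
  coeff_toFun f

theorem coeff_sq_eq_conv {s : ℕ} (f : H s) (n : ℤ) : coeff (fun x => f.toFun x ^ 2) n =
    conv (herm (coefs s (H.equiv s f))) (herm (coefs s (H.equiv s f))) n := by
  rw [← coeff_eq_herm]
  exact coeff_sq f.1 n

namespace Params

variable (P : Params)

theorem hasDerivAt_apply {x : ℝ → Seq} {x' : Seq} {t : ℝ} (h : HasDerivAt x x' t) (n : ℕ+) :
    HasDerivAt (fun t => x t n) (x' n) t :=
  (lp.evalCLM ℝ (fun _ : ℕ+ => ℂ) 2 n).hasFDerivAt.comp_hasDerivAt t h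

theorem mul_lam (n : ℕ+) :
    ((1 + ((n : ℕ) : ℝ) ^ P.γ : ℝ) : ℂ) * P.lam n = -(Complex.I * (n : ℕ)) := by
  have : ((1 + ((n : ℕ) : ℝ) ^ P.γ : ℝ) : ℂ) ≠ 0 := by
    have : 0 < 1 + ((n : ℕ) : ℝ) ^ P.γ := by positivity
    exact_mod_cast this.ne'
  rw [lam]
  field_simp

theorem mul_coefs_field (f : H P.s) (n : ℕ+) :
    ((1 + ((n : ℕ) : ℝ) ^ P.γ : ℝ) : ℂ) * coefs P.s (P.field (H.equiv P.s f)) n =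
      -(Complex.I * (n : ℕ) * coeff f.toFun (n : ℕ) +
        Complex.I * (n : ℕ) * coeff (fun x => f.toFun x ^ 2) (n : ℕ)) := by
  have h2 : ((n : ℕ) : ℂ) ^ P.s ≠ 0 := pnat_pow_ne_zero P.s n
  rw [coeff_sq_eq_conv, coeff_eq_herm, herm_coe, coefs, coefs, P.field_apply, prodCoord]
  generalize H.equiv P.s f n = a, conv (herm (coefs P.s (H.equiv P.s f))) _ _ = c
  have h3 : (((n : ℕ) : ℂ) ^ P.s)⁻¹ * (P.lam n * (a + ((n : ℕ) : ℂ) ^ P.s * c)) =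
      P.lam n * ((((n : ℕ) : ℂ) ^ P.s)⁻¹ * a + c) := by
    field_simp
  rw [h3]
  linear_combination ((((n : ℕ) : ℂ) ^ P.s)⁻¹ * a + c) * P.mul_lam n

theorem isSolution_of_hasDerivAt {u : ℝ → H P.s}
    (h : ∀ t, HasDerivAt (fun t => H.equiv P.s (u t)) (P.field (H.equiv P.s (u t))) t) :
    IsSolution P.γ u := by
  refine ⟨?_, fun n => ?_⟩
  · have h1 : Continuous fun t => H.equiv P.s (u t) :=
      continuous_iff_continuousAt.2 fun t => (h t).continuousAt
    simpa [Function.comp_def] using (H.continuous_equiv_symm P.s).comp h1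
  have hpos : ∀ (n : ℕ+) (t : ℝ), HasDerivAt
      (fun τ => ((1 + |((n : ℕ) : ℤ)| ^ P.γ : ℝ) : ℂ) * coeff (u τ).toFun (n : ℕ))
      (-(Complex.I * (n : ℕ) * coeff (u t).toFun (n : ℕ) +
        Complex.I * (n : ℕ) * coeff (fun x => (u t).toFun x ^ 2) (n : ℕ))) t := fun n t => by
    rw [← P.mul_coefs_field]
    have h1 := ((hasDerivAt_apply (h t) n).const_mul (((n : ℕ) : ℂ) ^ P.s)⁻¹).const_mul
      ((1 + ((n : ℕ) : ℝ) ^ P.γ : ℝ) : ℂ)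
    simpa [coeff_eq_herm, coefs] using h1
  induction n using int_cases_pnat with
  | h0 =>
    intro t
    simpa [coeff_eq_herm] using hasDerivAt_const t (0 : ℂ)
  | h1 n => simpa using hpos n
  -- Negative frequencies follow by conjugation, as the solution is real-valued.
  | h2 n =>
    intro t
    have h1 := Complex.conjCLE.hasFDerivAt.comp_hasDerivAt t (hpos n t)
    have h2 : ((1 + |((-((n : ℕ) : ℤ) : ℤ) : ℝ)| ^ P.γ : ℝ) : ℂ) =
        ((1 + |(((n : ℕ) : ℤ) : ℝ)| ^ P.γ : ℝ) : ℂ) := by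
      rw [Int.cast_neg, abs_neg]
    simp only [coeff_neg, h2]
    refine HasDerivAt.congr_deriv (h1.congr_of_eventuallyEq (Eventually.of_forall fun τ => ?_)) ?_
    · simp
    · simp

/-- Coefficientwise solutions are strong ones: the `ℓ²`-valued primitive `y` of the continuous curve
`P.field (x t)` has the same coefficient derivatives and initial value as `x`. Uniqueness of the ODE
then applies to all solutions of the equation. -/
theorem hasDerivAt_of_isSolution {u : ℝ → H P.s} (h : IsSolution P.γ u) (t : ℝ) :
    HasDerivAt (fun t => H.equiv P.s (u t)) (P.field (H.equiv P.s (u t))) t := by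
  set x : ℝ → Seq := fun t => H.equiv P.s (u t)
  have hx : Continuous x := (H.continuous_equiv P.s).comp h.1
  have hG : Continuous fun t => P.field (x t) := P.contDiff_field.continuous.comp hx
  set y : ℝ → Seq := fun t => x 0 + ∫ τ in (0 : ℝ)..t, P.field (x τ)
  have hy : ∀ t, HasDerivAt y (P.field (x t)) t := fun t =>
    (hG.integral_hasStrictDerivAt 0 t).hasDerivAt.const_add _
  suffices hxy : x = y by
    have := hy t
    rwa [← hxy] at this
  have hxn : ∀ (n : ℕ+) (t : ℝ), HasDerivAt (fun t => x t n) (P.field (x t) n) t := fun n t => by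
    have h0 : ((1 + ((n : ℕ) : ℝ) ^ P.γ : ℝ) : ℂ) ≠ 0 := by
      have : 0 < 1 + ((n : ℕ) : ℝ) ^ P.γ := by positivity
      exact_mod_cast this.ne'
    have h1 := h.2 (n : ℕ) t
    have h2 : ∀ τ, coeff (u τ).toFun (n : ℕ) = coefs P.s (x τ) n := fun τ => by
      rw [coeff_eq_herm, herm_coe]
    have h4 := P.mul_coefs_field (u t) n
    simp only [Int.cast_natCast, Nat.abs_cast] at h1
    rw [← h4] at h1
    simp only [h2] at h1
    have h3 := h1.const_mul (((n : ℕ) : ℂ) ^ P.s * ((1 + ((n : ℕ) : ℝ) ^ P.γ : ℝ) : ℂ)⁻¹)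
    have h6 : ∀ z : Seq, ((n : ℕ) : ℂ) ^ P.s * ((1 + ((n : ℕ) : ℝ) ^ P.γ : ℝ) : ℂ)⁻¹ *
        (((1 + ((n : ℕ) : ℝ) ^ P.γ : ℝ) : ℂ) * coefs P.s z n) = z n := fun z => by
      rw [mul_assoc, inv_mul_cancel_left₀ h0, mul_coefs]
    simp only [h6] at h3
    exact h3
  ext τ n
  have h5 : ∀ t, HasDerivAt (fun t => x t n - y t n) 0 t := fun t => by
    have := (hxn n t).sub (hasDerivAt_apply (hy t) n)
    rw [sub_self] at this
    exact this
  have h6 := is_const_of_deriv_eq_zero (fun t => (h5 t).differentiableAt) (fun t => (h5 t).deriv) τ 0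
  have h7 : y 0 = x 0 := by simp [y]
  simp only [h7, sub_self] at h6
  exact sub_eq_zero.1 h6

/-- The flow of the equation on the Sobolev space. -/
noncomputable def solution (t : ℝ) (u : H P.s) : H P.s :=
  (H.equiv P.s).symm (P.flow t (H.equiv P.s u))

theorem isFlow_solution : IsFlow P.γ P.s P.solution := by
  refine fun u₀ => ⟨⟨P.isSolution_of_hasDerivAt fun t => ?_, ?_⟩, fun u hu h0 t => ?_⟩
  · simp only [solution, AddEquiv.apply_symm_apply]
    exact P.tameField.hasDerivAt_flow _ t
  · rw [solution, flow, TameField.flow_zero, AddEquiv.symm_apply_apply]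
  · have h1 := P.tameField.eq_flow (P.hasDerivAt_of_isSolution hu) t
    rw [solution, flow, AddEquiv.eq_symm_apply, ← h0]
    exact h1

/-- The factor `n^s` of the coordinates cancels the `s` in `n^(-(s + γ/2))`, and the remaining
`n^(-γ/2) / √2` is `amp`. -/
theorem equiv_randomTerm (ω : Sample) (n : ℕ+) :
    H.equiv P.s (randomTerm P.γ P.s ω n) = lp.single 2 n (P.draw ω n) := by
  refine lp.ext (funext fun m => ?_)
  set z : ℂ := gauss n ω / (((n : ℕ) : ℝ) ^ ((P.s : ℝ) + P.γ / 2) : ℝ)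
  have h1 : coeff (randomTerm P.γ P.s ω n).toFun m = coeff (modeFun n z) m :=
    coeff_congr (ContinuousMap.coeFn_toLp (p := 2) (𝕜 := ℝ)
      (AddCircle.haarAddCircle : Measure Torus) (modeFun n z)) m
  change ((m : ℕ) : ℂ) ^ P.s * coeff (randomTerm P.γ P.s ω n).toFun m = _
  have hm := m.pos
  have hn := n.pos
  rw [h1, coeff_modeFun, if_neg (c := ((m : ℕ) : ℤ) = -((n : ℕ) : ℤ)) (by omega), add_zero,
    lp.single_apply]
  by_cases h : m = n
  · subst h
    rw [if_pos rfl, Pi.single_eq_same, draw, amp]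
    have h2 : (0 : ℝ) < (m : ℕ) := by simp
    simp only [z, gauss]
    rw [Real.rpow_add h2, Real.rpow_natCast]
    push_cast
    have h3 : ((m : ℕ) : ℂ) ^ P.s ≠ 0 := pnat_pow_ne_zero P.s m
    field_simp
  · rw [Pi.single_eq_of_ne h, if_neg, mul_zero]
    intro h4
    exact h (PNat.coe_injective (by exact_mod_cast h4))

theorem ae_hasSum_randomTerm :
    ∀ᵐ ω ∂prob, HasSum (randomTerm P.γ P.s ω) ((H.equiv P.s).symm (P.sample ω)) := by
  filter_upwards [P.ae_memℓp] with ω hω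
  have h1 := lp.hasSum_single (p := 2) (by norm_num) (P.sample ω)
  have h2 := h1.map (H.equiv P.s).symm (H.continuous_equiv_symm P.s)
  refine h2.congr_fun fun n => ?_
  simp [P.sample_apply hω, ← P.equiv_randomTerm]

theorem gaussianMeasure_eq :
    gaussianMeasure P.γ P.s = (prob.map P.sample).map (H.equiv P.s).symm := by
  rw [AEMeasurable.map_map_of_aemeasurable
    (H.continuous_equiv_symm P.s).measurable.aemeasurable P.aemeasurable_sample]
  refine Measure.map_congr ?_
  filter_upwards [P.ae_hasSum_randomTerm] with ω hω
  exact hω.tsum_eq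

theorem isProbabilityMeasure_gaussianMeasure : IsProbabilityMeasure (gaussianMeasure P.γ P.s) := by
  rw [P.gaussianMeasure_eq]
  have := Measure.isProbabilityMeasure_map (μ := prob) P.aemeasurable_sample
  exact Measure.isProbabilityMeasure_map (H.continuous_equiv_symm P.s).measurable.aemeasurable

theorem quasiMeasurePreserving_solution (t : ℝ) : Measure.QuasiMeasurePreserving (P.solution t)
    (gaussianMeasure P.γ P.s) (gaussianMeasure P.γ P.s) := by
  have h1 : MeasurePreserving (H.equiv P.s).symm (prob.map P.sample) (gaussianMeasure P.γ P.s) :=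
    ⟨(H.continuous_equiv_symm P.s).measurable, P.gaussianMeasure_eq.symm⟩
  have h2 : MeasurePreserving (H.equiv P.s) (gaussianMeasure P.γ P.s) (prob.map P.sample) := by
    refine ⟨(H.continuous_equiv P.s).measurable, ?_⟩
    rw [P.gaussianMeasure_eq, Measure.map_map (H.continuous_equiv P.s).measurable
      (H.continuous_equiv_symm P.s).measurable]
    have : H.equiv P.s ∘ (H.equiv P.s).symm = id := funext (H.equiv P.s).apply_symm_apply
    rw [this, Measure.map_id]
  exact h1.quasiMeasurePreserving.comp
    ((P.quasiMeasurePreserving_flow t).comp h2.quasiMeasurePreserving)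

end Params

end BBM

theorem theorem1 (γ : ℝ) (hγ : 4 / 3 < γ) (s : ℕ) (hs : γ / 2 ≤ (s : ℝ)) :
    (∀ᵐ ω ∂BBM.prob, Summable (BBM.randomTerm γ s ω)) ∧
    IsProbabilityMeasure (BBM.gaussianMeasure γ s) ∧
    ∃ Φ : ℝ → BBM.H s → BBM.H s, BBM.IsFlow γ s Φ ∧
      ∀ t : ℝ, Measure.QuasiMeasurePreserving (Φ t)
        (BBM.gaussianMeasure γ s) (BBM.gaussianMeasure γ s) := by
  let P : BBM.Params := ⟨γ, s, hγ, hs⟩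
  exact ⟨P.ae_hasSum_randomTerm.mono fun _ h => h.summable, P.isProbabilityMeasure_gaussianMeasure,
    P.solution, P.isFlow_solution, P.quasiMeasurePreserving_solution⟩
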